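/- **Setting.** Consider the triangular lattice of unit triangles with horizontal lattice lines. A *lozenge* is a union of two unit triangles sharing an edge; it is *vertical* if the shared edge is horizontal. A *tiling* of a region is a covering of it by lozenges contained in it, without gaps or overlaps. Let $q$ be an element of a field $K$ with $2\neq 0$, $q\ne 0$ and $[k]_{q^2}\neq 0$ for all $k\ge 1$ (for example $q$ an indeterminate over $\mathbb Q$, or $q$ a positive real number), where $[k]_q=1+q+\dots+q^{k-1}$ and $[k]_q!=[1]_q\cdots[k]_q$. **The region.** Let $x,u,d,m,n$ be non-negative integers with $m\le d$, $n\le u$, let $1\le l_1<\dots<l_m\le d$ and $1\le h_1<\dots<h_n\le u$ be integers, and put $e=\min(u-n,d-m)$. Start from the halved hexagon whose north, northeast, southeast and south sides follow lattice lines and have lengths $x+d-m-e$, $2u+m-n+1$, $2d-m+n$, $x+u-n-e$, and whose west side, read from the upper-left corner downwards, is the vertical zigzag lattice path consisting of $2u$ unit steps that alternate down-left, down-right, then one additional down-right unit step, then $2d$ unit steps that alternate down-left, down-right. The west side has $u$ *upper bumps* (pairs of consecutive down-left, down-right steps above the additional step), numbered $1,\dots,u$ from bottom to top, and $d$ *lower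 bumps* (such pairs below it), numbered $1,\dots,d$ from top to bottom. From each upper bump whose number is not among $h_1,\dots,h_n$ remove its up-pointing unit triangle (the one along the down-left step), and from each lower bump whose number is not among $l_1,\dots,l_m$ remove its down-pointing unit triangle (the one along the down-right step). The resulting region is $S_{x,u,d}((l_i)_{i=1}^m;(h_j)_{j=1}^n)$. **The weight** $\mathrm{wt}_2$. Let the horizontal coordinate $i$ be measured from the vertical line through the upper-left corner, in units of half the side of a unit triangle. A vertical lozenge whose centre has horizontal coordinate $i\neq0$ has weight $(q^i+q^{-i})/2$, one with $i=0$ has weight $1/2$, and all other lozenges have weight $1$. The weight of a tiling is the product of the weights of its lozenges, and $\mathrm M(R)$ is the sum of the weights of all tilings of $R$ (so $\mathrm M=1$ for the empty region, and $\mathrm M=0$ if there is no tiling). **Theorem.** With $\overline x=x+\max(u-n,d-m)$, $$\begin{aligned} \mathrm M\big(S_{x,u,d}((l_i)_{i=1}^m;(h_j)_{j=1}^n)\big)={}&2^{-F}q^{-E}\,\frac{\prod_{1\le i<j\le m}[2(l_j-l_i)]_{q^2}\prod_{1\le i<j\le n}[2(h_j-h_i)]_{q^2}}{\prod_{i=1}^m\prod_{j=1}^n[2(l_i+h_j)]_{q^2}\prod_{i=1}^m[2l_i-1]_{q^2}!\prod_{j=1}^n[2h_j]_{q^2}!}\\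 &\times\prod_{i=1}^{\lceil m/2\rceil}\prod_{j=1}^{2m-4i+3}[2\overline x+2i+j-1]_{q^2}\\ &\times\prod_{i=1}^n[2(\overline x+m+i)]_{q^2}\prod_{i=1}^n\prod_{j=1}^{m+i}[2\overline x+m+i+j]_{q^2}\\ &\times\prod_{i=1}^m\prod_{j=1}^n\frac{[2(\overline x+i+j-1)]_{q^2}}{[2(\overline x+i+j-1)+1]_{q^2}}\\ &\times\prod_{i=1}^m\prod_{j=1}^{l_i-i}[2(\overline x+i+j+n)]_{q^2}[2(\overline x-i-j+m+1)]_{q^2}\\ &\times\prod_{i=1}^n\prod_{j=1}^{h_i-i}[2(\overline x+i+j+m)]_{q^2}[2(\overline x-i-j+n+1)]_{q^2}, \end{aligned}$$ where, with $t_1=2(x+u-n-e)+1$, $t_2=2(x+d-m-e)$, $f(t,a,b)=\tfrac{ab(2t+a-b)}2$ and $\left\langle{b\atop a}\right\rangle=a+(a+1)+\dots+b$, $$\begin{aligned} E={}&f(t_1+2d-m,\,n,\,m+1)+\sum_{i=1}^m\left\langle{t_1+2d-m-(m-i+1)\atop t_1+2(d-l_i)-2(m-i)}\right\rangle+\sum_{i=1}^n\left\langle{t_2+2u-n-(n-i+1)\atop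 t_2+2(u-h_i)-2(n-i)}\right\rangle,\\ F={}&n(m+1)+\sum_{i=1}^m(2l_i-i)+\sum_{i=1}^n(2h_i-i). \end{aligned}$$ -/

import Mathlib

/-!
Lozenge tilings of hybrid halved hexagons on the triangular lattice.

Coordinates.  The unit of the horizontal `i`-axis is half the side of a unit triangle, the unit of
the vertical `j`-axis is the height of a unit triangle.  The lattice vertices at height `y` are the
points `(a, y)` with `a ≢ y (mod 2)`.  Consequently a unit triangle lying between the heights
`j` and `j + 1` is determined by `j` and by the horizontal coordinate `i` of its centre: it has its
horizontal extent in `[i - 1, i + 1]`, it is up-pointing (apex `(i, j + 1)`) if `i ≡ j (mod 2)`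
and down-pointing (apex `(i, j)`) otherwise.
-/

namespace HybridHexagon

/-- The unit triangle `(i, j)`: horizontal centre `i`, lying between the heights `j` and `j + 1`. -/
abbrev UnitTriangle : Type := ℤ × ℤ

/-- The unit triangle points up. -/
def IsUp (t : UnitTriangle) : Prop := Even (t.1 - t.2)

/-- The pair `p` of (up-pointing, down-pointing) unit triangles shares a horizontal edge, i.e.
`p` is a vertical lozenge.  Its centre has horizontal coordinate `p.1.1`. -/
def IsVertical (p : UnitTriangle × UnitTriangle) : Prop := p.2 = (p.1.1, p.1.2 - 1)

instance (p : UnitTriangle × UnitTriangle) : Decidable (IsVertical p) :=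
  inferInstanceAs (Decidable (p.2 = (p.1.1, p.1.2 - 1)))

/-- A lozenge is the union of two unit triangles sharing an edge, recorded as the pair of its
up-pointing triangle `p.1` and its down-pointing triangle `p.2`. -/
def IsLozenge (p : UnitTriangle × UnitTriangle) : Prop :=
  IsUp p.1 ∧
    (p.2 = (p.1.1 - 1, p.1.2) ∨ p.2 = (p.1.1 + 1, p.1.2) ∨ IsVertical p)

/-- A (lozenge) tiling of the region `R`: a set of lozenges contained in `R` such that every unit
triangle of `R` belongs to exactly one of them. -/
def IsTiling (R : Finset UnitTriangle) (T : Finset (UnitTriangle × UnitTriangle)) : Prop :=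
  (∀ p ∈ T, IsLozenge p ∧ p.1 ∈ R ∧ p.2 ∈ R) ∧
    ∀ t ∈ R, ∃! p, p ∈ T ∧ (p.1 = t ∨ p.2 = t)

open Classical in
/-- The finite set of all tilings of `R`. -/
noncomputable def tilings (R : Finset UnitTriangle) :
    Finset (Finset (UnitTriangle × UnitTriangle)) :=
  (R ×ˢ R).powerset.filter fun T => IsTiling R T

theorem mem_tilings (R : Finset UnitTriangle) (T : Finset (UnitTriangle × UnitTriangle)) :
    T ∈ tilings R ↔ IsTiling R T := by
  unfold tilings
  simp only [Finset.mem_filter, Finset.mem_powerset]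
  refine ⟨fun h => h.2, fun h => ⟨fun p hp => ?_, h⟩⟩
  exact Finset.mem_product.2 (h.1 p hp).2

section Weights

variable {K : Type*} [Field K]

/-- The weight `wt₂` of a lozenge: a vertical lozenge whose centre has horizontal coordinate `i`
has weight `(q ^ i + q ^ (-i)) / 2`, except that it has weight `1 / 2` if `i = 0` (the `j`-axis
runs through it); all other lozenges have weight `1`. -/
def wt₂ (q : K) (p : UnitTriangle × UnitTriangle) : K :=
  if IsVertical p then
    if p.1.1 = 0 then 1 / 2 else (q ^ p.1.1 + q ^ (-p.1.1)) / 2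
  else 1

/-- The tiling generating function of `R` under `wt₂`: the sum over all tilings of the product of
the weights of the lozenges. -/
noncomputable def tilingGF (q : K) (R : Finset UnitTriangle) : K :=
  ∑ T ∈ tilings R, ∏ p ∈ T, wt₂ q p

end Weights

/-! ### The region -/

/-- Length of the north side, `x + (d - m) - e` with `e = min (u - n) (d - m)`. -/
def north (x u d m n : ℕ) : ℕ := x + (d - m) - min (u - n) (d - m)

/-- Length of the south side, `x + (u - n) - e` with `e = min (u - n) (d - m)`. -/
def south (x u d m n : ℕ) : ℕ := x + (u - n) - min (u - n) (d - m)

/-- Horizontal coordinate at height `y` of the west side, for `0 ≤ y ≤ 2 d + 1 + 2 u`.  From the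
upper-left corner `(0, 2 d + 1 + 2 u)` downwards it makes `2 u` steps that are alternately
down-left and down-right, then one additional down-right step from `(0, 2 d + 1)` to `(1, 2 d)`,
and then `2 d` further steps that are alternately down-left and down-right, ending at the
lower-left corner `(1, 0)`. -/
def west (d : ℕ) (y : ℤ) : ℤ :=
  if y ≤ 2 * d then (if Even y then 1 else 0) else (if Even y then -1 else 0)

/-- Horizontal coordinate at height `y` of the east side, for `0 ≤ y ≤ 2 d + 1 + 2 u`: from the
lower-right corner `(1 + 2 * south, 0)` upwards it makes `2 d - m + n` up-right steps (southeast
side), and the remaining `2 u + m - n + 1` steps are up-left steps (northeast side) that end at the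
upper-right corner `(2 * north, 2 d + 1 + 2 u)`. -/
def east (x u d m n : ℕ) (y : ℤ) : ℤ :=
  if y ≤ 2 * d - m + n then 1 + 2 * (south x u d m n : ℤ) + y
  else 2 * (north x u d m n : ℤ) + (2 * d + 1 + 2 * u - y)

/-- The unit triangle `t` lies inside the halved hexagon: in its row, its left edge is not to the
left of the west side and its right edge is not to the right of the east side (midpoints of edges
are compared). -/
def InHalvedHexagon (x u d m n : ℕ) (t : UnitTriangle) : Prop :=
  0 ≤ t.2 ∧ t.2 < 2 * d + 1 + 2 * u ∧
    west d t.2 + west d (t.2 + 1) ≤ 2 * t.1 - 1 ∧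
    2 * t.1 + 1 ≤ east x u d m n t.2 + east x u d m n (t.2 + 1)

instance (x u d m n : ℕ) (t : UnitTriangle) : Decidable (InHalvedHexagon x u d m n t) :=
  inferInstanceAs (Decidable (_ ∧ _ ∧ _ ∧ _))

/-- The halved hexagon, as a finite set of unit triangles (the box only serves finiteness, see
`mem_halvedHexagon`). -/
noncomputable def halvedHexagon (x u d m n : ℕ) : Finset UnitTriangle :=
  {t ∈ Finset.Icc (0 : ℤ) (2 * north x u d m n + 2 * south x u d m n + 4 * d + 2 * u + 2 * n + 2) ×ˢ
      Finset.Ico (0 : ℤ) (2 * d + 1 + 2 * u) | InHalvedHexagon x u d m n t}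

theorem mem_halvedHexagon (x u d m n : ℕ) (t : UnitTriangle) :
    t ∈ halvedHexagon x u d m n ↔ InHalvedHexagon x u d m n t := by
  unfold halvedHexagon
  rw [Finset.mem_filter, Finset.mem_product, Finset.mem_Icc, Finset.mem_Ico]
  refine ⟨fun h => h.2, fun h => ⟨?_, h⟩⟩
  obtain ⟨h0, h1, h2, h3⟩ := h
  refine ⟨⟨?_, ?_⟩, h0, h1⟩
  · unfold west at h2
    by_cases he : Even t.2
    · have he' : ¬ Even (t.2 + 1) := by simpa [Int.even_add_one] using he
      simp only [he, he', if_true, if_false] at h2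
      split_ifs at h2 <;> omega
    · have he' : Even (t.2 + 1) := by simpa [Int.even_add_one] using he
      simp only [he, he', if_true, if_false] at h2
      split_ifs at h2 <;> omega
  · unfold east at h3
    split_ifs at h3 <;> omega

/-- The up-pointing dents on the upper part of the west side.  The upper bumps are numbered
`1, …, u` from bottom to top; the `k`-th one consists of the two unit triangles `(0, 2 d + 2 k)`
(up-pointing) and `(0, 2 d + 2 k - 1)` (down-pointing).  The up-pointing triangle is removed from
every bump whose number is not among the `h j`. -/
def upperDents (u d : ℕ) {n : ℕ} (h : Fin n → ℕ) : Finset UnitTriangle :=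
  ((Finset.Icc 1 u).filter fun k => ∀ j, h j ≠ k).image fun k : ℕ => ((0 : ℤ), 2 * (d : ℤ) + 2 * (k : ℤ))

/-- The down-pointing dents on the lower part of the west side.  The lower bumps are numbered
`1, …, d` from top to bottom; the `k`-th one consists of the two unit triangles
`(1, 2 d - 2 k + 1)` (up-pointing) and `(1, 2 d - 2 k)` (down-pointing).  The down-pointing
triangle is removed from every bump whose number is not among the `l i`. -/
def lowerDents (d : ℕ) {m : ℕ} (l : Fin m → ℕ) : Finset UnitTriangle :=
  ((Finset.Icc 1 d).filter fun k => ∀ i, l i ≠ k).image fun k : ℕ => ((1 : ℤ), 2 * (d : ℤ) - 2 * (k : ℤ))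

/-- The hybrid halved hexagon `S_{x,u,d}((l_i); (h_j))`. -/
noncomputable def regionS (x u d : ℕ) {m n : ℕ} (l : Fin m → ℕ) (h : Fin n → ℕ) : Finset UnitTriangle :=
  halvedHexagon x u d m n \ (upperDents u d h ∪ lowerDents d l)

/-! ### The product formula -/

section Formula

variable {K : Type*} [Field K]

/-- The `q`-integer `[k]_q = 1 + q + ⋯ + q ^ (k - 1)`. -/
def qInt (q : K) (k : ℕ) : K := ∑ a ∈ Finset.range k, q ^ a

/-- The `q`-factorial `[k]_q! = [1]_q [2]_q ⋯ [k]_q`. -/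
def qFact (q : K) (k : ℕ) : K := ∏ a ∈ Finset.Icc 1 k, qInt q a

/-- `a + (a + 1) + ⋯ + b`. -/
noncomputable def angle (b a : ℤ) : ℤ := ∑ k ∈ Finset.Icc a b, k

/-- `x y (2 t + x - y) / 2`; the numerator is always even. -/
def fExp (t x y : ℤ) : ℤ := x * y * (2 * t + x - y) / 2

/-- The exponent `E`.  An index `i : Fin m` stands for the one-based index `i + 1`. -/
noncomputable def expE (x u d : ℕ) {m n : ℕ} (l : Fin m → ℕ) (h : Fin n → ℕ) : ℤ :=
  let t₁ : ℤ := 2 * (south x u d m n : ℤ) + 1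
  let t₂ : ℤ := 2 * (north x u d m n : ℤ)
  fExp (t₁ + 2 * d - m) n (m + 1)
    + ∑ i : Fin m, angle (t₁ + 2 * d - m - (m - (i + 1 : ℤ) + 1))
        (t₁ + 2 * (d - l i) - 2 * (m - (i + 1 : ℤ)))
    + ∑ i : Fin n, angle (t₂ + 2 * u - n - (n - (i + 1 : ℤ) + 1))
        (t₂ + 2 * (u - h i) - 2 * (n - (i + 1 : ℤ)))

/-- The exponent `F`.  An index `i : Fin m` stands for the one-based index `i + 1`. -/
def expF {m n : ℕ} (l : Fin m → ℕ) (h : Fin n → ℕ) : ℤ :=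
  n * (m + 1) + ∑ i : Fin m, (2 * (l i : ℤ) - (i + 1 : ℤ))
    + ∑ i : Fin n, (2 * (h i : ℤ) - (i + 1 : ℤ))

/-- `x + max (u - n) (d - m)`. -/
def xBar (x u d m n : ℕ) : ℕ := x + max (u - n) (d - m)

/-- The product `P(x, u, d, (l_i), (h_j))`.  An index `i : Fin m` (or `Fin n`) stands for the
one-based index `i + 1`.  All subtractions of natural numbers are exact when `l` and `h` are
strictly increasing with `1 ≤ l i ≤ d` and `1 ≤ h j ≤ u`. -/
noncomputable def prodP (q : K) (x u d : ℕ) {m n : ℕ} (l : Fin m → ℕ) (h : Fin n → ℕ) : K :=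
  let X : ℕ := xBar x u d m n
  let b : ℕ → K := qInt (q ^ 2)
  (2 : K) ^ (-expF l h) * q ^ (-expE x u d l h)
    * (((∏ i : Fin m, ∏ j ∈ Finset.Ioi i, b (2 * (l j - l i)))
          * ∏ i : Fin n, ∏ j ∈ Finset.Ioi i, b (2 * (h j - h i)))
        / ((∏ i : Fin m, ∏ j : Fin n, b (2 * (l i + h j)))
          * (∏ i : Fin m, qFact (q ^ 2) (2 * l i - 1))
          * ∏ j : Fin n, qFact (q ^ 2) (2 * h j)))
    * (∏ i ∈ Finset.Icc 1 ((m + 1) / 2), ∏ j ∈ Finset.Icc 1 (2 * m + 3 - 4 * i),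
        b (2 * X + 2 * i + j - 1))
    * (∏ i ∈ Finset.Icc 1 n, b (2 * (X + m + i)))
    * (∏ i ∈ Finset.Icc 1 n, ∏ j ∈ Finset.Icc 1 (m + i), b (2 * X + m + i + j))
    * (∏ i ∈ Finset.Icc 1 m, ∏ j ∈ Finset.Icc 1 n,
        b (2 * (X + i + j - 1)) / b (2 * (X + i + j - 1) + 1))
    * (∏ i : Fin m, ∏ j ∈ Finset.Icc 1 (l i - (i + 1)),
        (b (2 * (X + (i + 1) + j + n)) * b (2 * (X + m + 1 - (i + 1) - j))))
    * ∏ i : Fin n, ∏ j ∈ Finset.Icc 1 (h i - (i + 1)),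
        (b (2 * (X + (i + 1) + j + m)) * b (2 * (X + n + 1 - (i + 1) - j)))

end Formula

end HybridHexagon

namespace HybridHexagon

/-! ### Weighted tilings with an arbitrary weight of vertical lozenges -/

section WeightedTilings

variable {K : Type*} [Field K]

/-- The weight of a lozenge, for the weight function `w` of vertical lozenges. -/
def lozengeWeight (w : ℤ → K) (p : UnitTriangle × UnitTriangle) : K :=
  if IsVertical p then w p.1.1 else 1

/-- The generating function of tilings of `R`, a vertical lozenge centred at `i` having weight
`w i`. -/
noncomputable def gf (w : ℤ → K) (R : Finset UnitTriangle) : K :=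
  ∑ T ∈ tilings R, ∏ p ∈ T, lozengeWeight w p

open Classical in
/-- The lozenges in `R` that cover the triangle `t`. -/
noncomputable def lozengesAt (R : Finset UnitTriangle) (t : UnitTriangle) :
    Finset (UnitTriangle × UnitTriangle) :=
  (R ×ˢ R).filter fun p => IsLozenge p ∧ (p.1 = t ∨ p.2 = t)

theorem mem_lozengesAt {R : Finset UnitTriangle} {t : UnitTriangle}
    {p : UnitTriangle × UnitTriangle} :
    p ∈ lozengesAt R t ↔ (p.1 ∈ R ∧ p.2 ∈ R) ∧ IsLozenge p ∧ (p.1 = t ∨ p.2 = t) := by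
  simp [lozengesAt, Finset.mem_filter, Finset.mem_product]

theorem IsLozenge.not_isUp_snd {p : UnitTriangle × UnitTriangle} (hp : IsLozenge p) :
    ¬ IsUp p.2 := by
  obtain ⟨h1, h2⟩ := hp
  unfold IsVertical at h2
  unfold IsUp at *
  rw [Int.even_iff] at *
  rcases h2 with h | h | h <;> rw [h] <;> dsimp only <;> omega

theorem IsTiling.erase {R : Finset UnitTriangle} {T : Finset (UnitTriangle × UnitTriangle)}
    (hT : IsTiling R T) {p : UnitTriangle × UnitTriangle} (hp : p ∈ T) :
    IsTiling (R \ {p.1, p.2}) (T.erase p) := by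
  refine ⟨fun p' hp' => ?_, fun t ht => ?_⟩
  · obtain ⟨hne, hp'⟩ := Finset.mem_erase.1 hp'
    obtain ⟨hl, h1, h2⟩ := hT.1 p' hp'
    have key : ∀ t ∈ R, (p.1 = t ∨ p.2 = t) → ¬ (p'.1 = t ∨ p'.2 = t) := fun t ht h h' =>
      hne ((hT.2 t ht).unique ⟨hp', h'⟩ ⟨hp, h⟩)
    refine ⟨hl, ?_, ?_⟩
    · simp only [Finset.mem_sdiff, Finset.mem_insert, Finset.mem_singleton, h1, true_and]
      exact fun h => key _ h1 (h.imp Eq.symm Eq.symm) (Or.inl rfl)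
    · simp only [Finset.mem_sdiff, Finset.mem_insert, Finset.mem_singleton, h2, true_and]
      exact fun h => key _ h2 (h.imp Eq.symm Eq.symm) (Or.inr rfl)
  · simp only [Finset.mem_sdiff, Finset.mem_insert, Finset.mem_singleton, not_or] at ht
    obtain ⟨ht, hn1, hn2⟩ := ht
    obtain ⟨p', ⟨hp', hc⟩, hu⟩ := hT.2 t ht
    refine ⟨p', ⟨Finset.mem_erase.2 ⟨?_, hp'⟩, hc⟩, fun y hy => hu y ⟨(Finset.mem_erase.1 hy.1).2, hy.2⟩⟩
    rintro rfl
    exact hc.elim (fun h => hn1 h.symm) fun h => hn2 h.symm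

theorem IsTiling.insert {R : Finset UnitTriangle} {T : Finset (UnitTriangle × UnitTriangle)}
    {p : UnitTriangle × UnitTriangle} (hT : IsTiling (R \ {p.1, p.2}) T) (hp : IsLozenge p)
    (h1 : p.1 ∈ R) (h2 : p.2 ∈ R) : IsTiling R (insert p T) := by
  refine ⟨fun p' hp' => ?_, fun t ht => ?_⟩
  · rcases Finset.mem_insert.1 hp' with rfl | hp'
    · exact ⟨hp, h1, h2⟩
    · obtain ⟨hl, h1, h2⟩ := hT.1 p' hp'
      exact ⟨hl, (Finset.mem_sdiff.1 h1).1, (Finset.mem_sdiff.1 h2).1⟩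
  · by_cases htp : p.1 = t ∨ p.2 = t
    · refine ⟨p, ⟨Finset.mem_insert_self _ _, htp⟩, fun y hy => ?_⟩
      rcases Finset.mem_insert.1 hy.1 with rfl | hy'
      · rfl
      · obtain ⟨-, h1, h2⟩ := hT.1 y hy'
        simp only [Finset.mem_sdiff, Finset.mem_insert, Finset.mem_singleton] at h1 h2
        rcases hy.2 with h | h <;> rcases htp with h' | h' <;> simp_all
    · have ht' : t ∈ R \ {p.1, p.2} := by
        simp only [Finset.mem_sdiff, Finset.mem_insert, Finset.mem_singleton, ht, true_and]
        exact fun h => htp (h.imp Eq.symm Eq.symm)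
      obtain ⟨p', ⟨hp', hc⟩, hu⟩ := hT.2 t ht'
      refine ⟨p', ⟨Finset.mem_insert_of_mem hp', hc⟩, fun y hy => ?_⟩
      rcases Finset.mem_insert.1 hy.1 with rfl | hy'
      · exact absurd hy.2 htp
      · exact hu y ⟨hy', hy.2⟩

/-- Expansion of the generating function according to the lozenge that covers `t`. -/
theorem gf_eq_sum (w : ℤ → K) {R : Finset UnitTriangle} {t : UnitTriangle} (ht : t ∈ R) :
    gf w R = ∑ p ∈ lozengesAt R t, lozengeWeight w p * gf w (R \ {p.1, p.2}) := by
  classical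
  unfold gf
  simp_rw [Finset.mul_sum]
  rw [Finset.sum_sigma']
  symm
  have hnot : ∀ (p : UnitTriangle × UnitTriangle) (T : Finset (UnitTriangle × UnitTriangle)),
      IsTiling (R \ {p.1, p.2}) T → p ∉ T := fun p T hT hp => by
    have := (hT.1 p hp).2.1
    simp at this
  refine Finset.sum_bij (fun x _ => insert x.1 x.2) ?_ ?_ ?_ ?_
  · rintro ⟨p, T⟩ hx
    obtain ⟨hp, hT⟩ := Finset.mem_sigma.1 hx
    obtain ⟨⟨h1, h2⟩, hl, -⟩ := mem_lozengesAt.1 hp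
    rw [mem_tilings] at hT ⊢
    exact hT.insert hl h1 h2
  · rintro ⟨p, T⟩ hx ⟨p', T'⟩ hx' h
    obtain ⟨hp, hT⟩ := Finset.mem_sigma.1 hx
    obtain ⟨hp', hT'⟩ := Finset.mem_sigma.1 hx'
    obtain ⟨⟨h1, h2⟩, hl, hc⟩ := mem_lozengesAt.1 hp
    obtain ⟨-, -, hc'⟩ := mem_lozengesAt.1 hp'
    rw [mem_tilings] at hT hT'
    have hT2 := hT.insert hl h1 h2
    dsimp only at h hT hT' hc hc'
    obtain rfl : p = p' := (hT2.2 t ht).unique ⟨Finset.mem_insert_self _ _, hc⟩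
      ⟨by dsimp only; rw [h]; exact Finset.mem_insert_self _ _, hc'⟩
    have : T = T' := by
      rw [← Finset.erase_insert (hnot p T hT), ← Finset.erase_insert (hnot p T' hT'), h]
    rw [this]
  · intro T hT
    rw [mem_tilings] at hT
    obtain ⟨p, ⟨hp, hc⟩, -⟩ := hT.2 t ht
    refine ⟨⟨p, T.erase p⟩, Finset.mem_sigma.2 ⟨mem_lozengesAt.2 ⟨(hT.1 p hp).2, (hT.1 p hp).1, hc⟩,
      (mem_tilings _ _).2 (hT.erase hp)⟩, Finset.insert_erase hp⟩
  · rintro ⟨p, T⟩ hx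
    obtain ⟨hp, hT⟩ := Finset.mem_sigma.1 hx
    rw [mem_tilings] at hT
    exact (Finset.prod_insert (hnot p T hT)).symm

theorem tilings_empty : tilings ∅ = {∅} := by
  ext T
  rw [mem_tilings, Finset.mem_singleton]
  constructor
  · intro h
    rw [Finset.eq_empty_iff_forall_notMem]
    exact fun p hp => by simpa using (h.1 p hp).2.1
  · rintro rfl
    exact ⟨by simp, by simp⟩

@[simp] theorem gf_empty (w : ℤ → K) : gf w ∅ = 1 := by
  simp [gf, tilings_empty]

theorem lozengesAt_up (R : Finset UnitTriangle) {i j : ℤ} (hu : IsUp (i, j)) (ht : (i, j) ∈ R) :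
    lozengesAt R (i, j) =
      (({(i - 1, j), (i + 1, j), (i, j - 1)} : Finset UnitTriangle).filter (· ∈ R)).image
        fun s => ((i, j), s) := by
  ext ⟨p1, p2⟩
  rw [mem_lozengesAt]
  simp only [Finset.mem_image, Finset.mem_filter, Finset.mem_insert, Finset.mem_singleton,
    Prod.mk.injEq]
  constructor
  · rintro ⟨⟨h1, h2⟩, hl, h | h⟩
    · subst h
      exact ⟨p2, ⟨hl.2, h2⟩, rfl, rfl⟩
    · subst h
      exact absurd hu hl.not_isUp_snd
  · rintro ⟨s, ⟨h, hR⟩, rfl, rfl⟩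
    exact ⟨⟨ht, hR⟩, ⟨hu, h⟩, Or.inl rfl⟩

theorem lozengesAt_down (R : Finset UnitTriangle) {i j : ℤ} (hu : ¬ IsUp (i, j))
    (ht : (i, j) ∈ R) :
    lozengesAt R (i, j) =
      (({(i - 1, j), (i + 1, j), (i, j + 1)} : Finset UnitTriangle).filter (· ∈ R)).image
        fun s => (s, (i, j)) := by
  ext ⟨p1, p2⟩
  rw [mem_lozengesAt]
  simp only [Finset.mem_image, Finset.mem_filter, Finset.mem_insert, Finset.mem_singleton,
    Prod.mk.injEq]
  unfold IsUp at hu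
  rw [Int.even_iff] at hu
  dsimp only at hu
  constructor
  · rintro ⟨⟨h1, h2⟩, hl, h | h⟩
    · exact absurd (h ▸ hl.1) (by unfold IsUp; rw [Int.even_iff]; exact hu)
    · subst h
      refine ⟨p1, ⟨?_, h1⟩, rfl, rfl⟩
      obtain ⟨a, b⟩ := p1
      have := hl.2
      simp only [IsVertical, Prod.mk.injEq] at this ⊢
      omega
  · rintro ⟨⟨a, b⟩, ⟨h, hR⟩, h', rfl⟩
    simp only [Prod.mk.injEq] at h
    obtain ⟨rfl⟩ := h'
    refine ⟨⟨hR, ht⟩, ⟨?_, ?_⟩, Or.inr rfl⟩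
    · unfold IsUp
      rw [Int.even_iff]
      dsimp only
      omega
    · simp only [IsVertical, Prod.mk.injEq]
      omega

theorem gf_up (w : ℤ → K) {R : Finset UnitTriangle} {i j : ℤ} (hu : IsUp (i, j))
    (ht : (i, j) ∈ R) :
    gf w R = (if (i - 1, j) ∈ R then gf w (R \ {(i, j), (i - 1, j)}) else 0)
      + (if (i + 1, j) ∈ R then gf w (R \ {(i, j), (i + 1, j)}) else 0)
      + (if (i, j - 1) ∈ R then w i * gf w (R \ {(i, j), (i, j - 1)}) else 0) := by
  rw [gf_eq_sum w ht, lozengesAt_up R hu ht, Finset.sum_image (by simp), Finset.sum_filter,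
    Finset.sum_insert (by simp; omega), Finset.sum_insert (by simp), Finset.sum_singleton, add_assoc]
  simp [lozengeWeight, IsVertical]

theorem gf_down (w : ℤ → K) {R : Finset UnitTriangle} {i j : ℤ} (hu : ¬ IsUp (i, j))
    (ht : (i, j) ∈ R) :
    gf w R = (if (i - 1, j) ∈ R then gf w (R \ {(i, j), (i - 1, j)}) else 0)
      + (if (i + 1, j) ∈ R then gf w (R \ {(i, j), (i + 1, j)}) else 0)
      + (if (i, j + 1) ∈ R then w i * gf w (R \ {(i, j), (i, j + 1)}) else 0) := by
  rw [gf_eq_sum w ht, lozengesAt_down R hu ht, Finset.sum_image (by simp), Finset.sum_filter,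
    Finset.sum_insert (by simp; omega), Finset.sum_insert (by simp), Finset.sum_singleton, add_assoc]
  have h1 : ¬ (i = i - 1 ∧ j = j - 1) := by omega
  simp [lozengeWeight, IsVertical, Finset.pair_comm, h1]

/-- The number of up-pointing minus the number of down-pointing triangles. -/
noncomputable def balance (R : Finset UnitTriangle) : ℤ :=
  open Classical in ∑ t ∈ R, if IsUp t then 1 else -1

theorem balance_eq_zero_of_gf_ne_zero (w : ℤ → K) {R : Finset UnitTriangle} (h : gf w R ≠ 0) :
    balance R = 0 := by
  induction hn : R.card using Nat.strong_induction_on generalizing R with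
  | _ N ih =>
    rcases R.eq_empty_or_nonempty with rfl | ⟨t, ht⟩
    · simp [balance]
    rw [gf_eq_sum w ht] at h
    obtain ⟨p, hp, hne⟩ := Finset.exists_ne_zero_of_sum_ne_zero h
    obtain ⟨⟨h1, h2⟩, hl, -⟩ := mem_lozengesAt.1 hp
    have hsub : ({p.1, p.2} : Finset UnitTriangle) ⊆ R := by
      simp [Finset.insert_subset_iff, h1, h2]
    have hpne : p.1 ≠ p.2 := fun h => hl.not_isUp_snd (h ▸ hl.1)
    have := ih _ ?_ (right_ne_zero_of_mul hne) rfl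
    · unfold balance at this ⊢
      rw [← Finset.sum_sdiff hsub, this, Finset.sum_pair hpne, if_pos hl.1, if_neg hl.not_isUp_snd]
      norm_num
    · rw [← hn]
      exact Finset.card_lt_card (Finset.ssubset_iff_subset_ne.2 ⟨Finset.sdiff_subset, fun h => by
        have : p.1 ∈ R \ {p.1, p.2} := by rw [h]; exact h1
        simp at this⟩)

end WeightedTilings

section Decomposition

variable {K : Type*} [Field K]

/-- The reflection in a horizontal line, followed by a unit shift to the left. -/
def flip : UnitTriangle ≃ UnitTriangle where
  toFun t := (t.1 - 1, -t.2)
  invFun t := (t.1 + 1, -t.2)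
  left_inv t := by simp
  right_inv t := by simp

@[simp] theorem flip_apply (i j : ℤ) : flip (i, j) = (i - 1, -j) := rfl

theorem isLozenge_flip {p : UnitTriangle × UnitTriangle} (hp : IsLozenge p) :
    IsLozenge (flip p.2, flip p.1) := by
  obtain ⟨⟨a, b⟩, c, d⟩ := p
  simp only [IsLozenge, IsUp, IsVertical, flip_apply, Prod.mk.injEq, Int.even_iff] at hp ⊢
  omega

theorem isLozenge_of_flip {p : UnitTriangle × UnitTriangle} (hp : IsLozenge (flip p.2, flip p.1)) :
    IsLozenge p := by
  obtain ⟨⟨a, b⟩, c, d⟩ := p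
  simp only [IsLozenge, IsUp, IsVertical, flip_apply, Prod.mk.injEq, Int.even_iff] at hp ⊢
  omega

theorem lozengeWeight_flip (w : ℤ → K) (p : UnitTriangle × UnitTriangle) :
    lozengeWeight (fun i => w (i + 1)) (flip p.2, flip p.1) = lozengeWeight w p := by
  obtain ⟨⟨a, b⟩, c, d⟩ := p
  simp only [lozengeWeight, IsVertical, flip_apply, Prod.mk.injEq]
  by_cases h : c = a ∧ d = b - 1
  · rw [if_pos h, if_pos (by omega)]
    obtain ⟨rfl, -⟩ := h
    simp
  · rw [if_neg h, if_neg (by omega)]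

theorem gf_flip (w : ℤ → K) (R : Finset UnitTriangle) :
    gf (fun i => w (i + 1)) (R.map flip.toEmbedding) = gf w R := by
  induction hn : R.card using Nat.strong_induction_on generalizing R with
  | _ N ih =>
    rcases R.eq_empty_or_nonempty with rfl | ⟨t, ht⟩
    · simp
    have ht' : flip t ∈ R.map flip.toEmbedding := by simpa using ht
    rw [gf_eq_sum w ht, gf_eq_sum _ ht']
    symm
    refine Finset.sum_bij (fun p _ => (flip p.2, flip p.1)) ?_ ?_ ?_ ?_
    · intro p hp
      obtain ⟨⟨h1, h2⟩, hl, hc⟩ := mem_lozengesAt.1 hp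
      refine mem_lozengesAt.2 ⟨⟨by simpa using h2, by simpa using h1⟩, isLozenge_flip hl, ?_⟩
      rcases hc with rfl | rfl
      · exact Or.inr rfl
      · exact Or.inl rfl
    · rintro ⟨a, b⟩ - ⟨c, d⟩ - h
      simp only [Prod.mk.injEq, flip.injective.eq_iff] at h ⊢
      exact h.symm
    · rintro ⟨a, b⟩ hp
      obtain ⟨⟨h1, h2⟩, hl, hc⟩ := mem_lozengesAt.1 hp
      simp only [Finset.mem_map_equiv] at h1 h2
      refine ⟨(flip.symm b, flip.symm a), mem_lozengesAt.2 ⟨⟨h2, h1⟩, ?_, ?_⟩, by simp⟩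
      · exact isLozenge_of_flip (by simpa using hl)
      · rw [Equiv.symm_apply_eq, Equiv.symm_apply_eq]
        exact hc.symm
    · intro p hp
      obtain ⟨⟨h1, h2⟩, hl, hc⟩ := mem_lozengesAt.1 hp
      rw [lozengeWeight_flip]
      congr 1
      rw [← ih (R \ {p.1, p.2}).card ?_ _ rfl]
      · congr 1
        ext s
        simp only [Finset.mem_map_equiv, Finset.mem_sdiff, Finset.mem_insert,
          Finset.mem_singleton, Equiv.symm_apply_eq]
        tauto
      · rw [← hn]
        exact Finset.card_lt_card (Finset.ssubset_iff_subset_ne.2 ⟨Finset.sdiff_subset, fun h => by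
          have : p.1 ∈ R \ {p.1, p.2} := by rw [h]; exact h1
          simp at this⟩)

/-- The generating function of `R \ S`, or `0` if `S` is not contained in `R`. -/
noncomputable def gfRemoved (w : ℤ → K) (R S : Finset UnitTriangle) : K :=
  if S ⊆ R then gf w (R \ S) else 0

@[simp] theorem gfRemoved_empty (w : ℤ → K) (R : Finset UnitTriangle) :
    gfRemoved w R ∅ = gf w R := by
  simp [gfRemoved]

theorem gfRemoved_of_notMem (w : ℤ → K) {R S : Finset UnitTriangle} {t : UnitTriangle}
    (h : t ∉ R) (hS : t ∈ S) : gfRemoved w R S = 0 :=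
  if_neg fun h' => h (h' hS)

theorem gfRemoved_eq_sum (w : ℤ → K) {R S : Finset UnitTriangle} {t : UnitTriangle}
    (ht : t ∈ R) (hS : t ∉ S) :
    gfRemoved w R S =
      ∑ p ∈ lozengesAt R t, lozengeWeight w p * gfRemoved w (R \ {p.1, p.2}) S := by
  unfold gfRemoved
  split_ifs with h
  · rw [gf_eq_sum w (Finset.mem_sdiff.2 ⟨ht, hS⟩)]
    have hsub : lozengesAt (R \ S) t ⊆ lozengesAt R t := fun p hp => by
      rw [mem_lozengesAt] at hp ⊢
      simp only [Finset.mem_sdiff] at hp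
      tauto
    refine Finset.sum_subset_zero_on_sdiff hsub (fun p hp => ?_) fun p hp => ?_
    · simp only [Finset.mem_sdiff, mem_lozengesAt] at hp
      rw [if_neg, mul_zero]
      intro hsub
      have h1 : p.1 ∉ S := fun h => by simpa using hsub h
      have h2 : p.2 ∉ S := fun h => by simpa using hsub h
      tauto
    · rw [if_pos, sdiff_right_comm]
      intro s hs
      simp only [mem_lozengesAt, Finset.mem_sdiff] at hp
      simp only [Finset.mem_sdiff, Finset.mem_insert, Finset.mem_singleton, h hs, true_and, not_or]
      exact ⟨fun h => hp.1.1.2 (h ▸ hs), fun h => hp.1.2.2 (h ▸ hs)⟩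
  · refine (Finset.sum_eq_zero fun p _ => ?_).symm
    rw [if_neg, mul_zero]
    exact fun h' => h (h'.trans Finset.sdiff_subset)

theorem gfRemoved_insert (w : ℤ → K) {R S : Finset UnitTriangle} {t : UnitTriangle}
    (ht : t ∈ R) (hS : t ∉ S) :
    gfRemoved w R (insert t S) = gfRemoved w (R \ {t}) S := by
  unfold gfRemoved
  have : insert t S ⊆ R ↔ S ⊆ R \ {t} := by
    rw [Finset.insert_subset_iff, Finset.subset_sdiff]
    simp [ht, hS]
  simp only [this, Finset.sdiff_insert, ← Finset.sdiff_singleton_eq_erase]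
  congr 2
  ext s
  simp only [Finset.mem_sdiff, Finset.mem_singleton]
  tauto

/-- Cutting a region along the horizontal line at height `y`. -/
theorem gf_union (w : ℤ → K) (y : ℤ) (C : Finset ℤ) (hC : ∀ i ∈ C, IsUp (i, y))
    (R₂ : Finset UnitTriangle) (h₂ : ∀ t ∈ R₂, t.2 < y) (R₁ : Finset UnitTriangle)
    (h₁ : ∀ t ∈ R₁, y ≤ t.2)
    (hRC : ∀ i, IsUp (i, y) → (i, y) ∈ R₁ → (i, y - 1) ∈ R₂ → i ∈ C) :
    gf w (R₁ ∪ R₂) = ∑ S ∈ C.powerset, (∏ i ∈ S, w i) *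
      gfRemoved w R₁ (S ×ˢ {y}) * gfRemoved w R₂ (S ×ˢ {y - 1}) := by
  classical
  induction hn : R₁.card using Nat.strong_induction_on generalizing R₁ R₂ with
  | _ N ih =>
    rcases R₁.eq_empty_or_nonempty with rfl | ⟨t, ht⟩
    · rw [Finset.sum_eq_single ∅]
      · simp
      · intro S _ hS
        obtain ⟨i, hi⟩ := Finset.nonempty_iff_ne_empty.2 hS
        rw [gfRemoved_of_notMem w (R := ∅) (t := (i, y)) (by simp) (by simp [hi])]
        simp
      · simp
    have hlt : ∀ s : Finset UnitTriangle, t ∈ s → (R₁ \ s).card < N := fun s hs => by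
      rw [← hn]
      exact Finset.card_lt_card (Finset.ssubset_iff_subset_ne.2 ⟨Finset.sdiff_subset, fun h => by
        have : t ∈ R₁ \ s := by rw [h]; exact ht
        simp [hs] at this⟩)
    have hd : ∀ s ∈ R₁, s ∉ R₂ := fun s h h' => absurd (h₂ s h') (not_lt.2 (h₁ s h))
    -- lozenges inside `R₁`
    have inner : ∀ p ∈ lozengesAt R₁ t, gf w ((R₁ ∪ R₂) \ {p.1, p.2}) =
        ∑ S ∈ C.powerset, (∏ i ∈ S, w i) *
          gfRemoved w (R₁ \ {p.1, p.2}) (S ×ˢ {y}) * gfRemoved w R₂ (S ×ˢ {y - 1}) := by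
      intro p hp
      obtain ⟨⟨hp1, hp2⟩, hl, hc⟩ := mem_lozengesAt.1 hp
      rw [← ih (R₁ \ {p.1, p.2}).card (hlt _ (by rcases hc with rfl | rfl <;> simp)) R₂ h₂
        (R₁ \ {p.1, p.2}) (fun s hs => h₁ s (Finset.mem_sdiff.1 hs).1)
        (fun i h h1 => hRC i h (Finset.mem_sdiff.1 h1).1) rfl]
      congr 1
      ext s
      have h1 := hd _ hp1
      have h2 := hd _ hp2
      simp only [Finset.mem_sdiff, Finset.mem_union, Finset.mem_insert, Finset.mem_singleton]
      constructor
      · tauto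
      · rintro (h | h)
        · tauto
        · refine ⟨Or.inr h, ?_⟩
          rintro (rfl | rfl) <;> contradiction
    by_cases htC : ∃ i ∈ C, t = (i, y)
    · obtain ⟨i, hi, rfl⟩ := htC
      have hu := hC i hi
      have hsplit : C.powerset = (C.erase i).powerset ∪ (C.erase i).powerset.image (insert i) := by
        rw [← Finset.powerset_insert, Finset.insert_erase hi]
      have hdisj : Disjoint (C.erase i).powerset ((C.erase i).powerset.image (insert i)) := by
        rw [Finset.disjoint_left]
        intro S hS hS'
        obtain ⟨S', -, rfl⟩ := Finset.mem_image.1 hS'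
        have := Finset.mem_powerset.1 hS (Finset.mem_insert_self i S')
        simp at this
      have hinj : Set.InjOn (insert i) ((C.erase i).powerset : Set (Finset ℤ)) := by
        intro S hS S' hS' h
        have h1 : i ∉ S := fun h => by
          simpa using Finset.mem_powerset.1 (Finset.mem_coe.1 hS) h
        have h2 : i ∉ S' := fun h => by
          simpa using Finset.mem_powerset.1 (Finset.mem_coe.1 hS') h
        rw [← Finset.erase_insert h1, ← Finset.erase_insert h2]
        exact congrArg (fun s => Finset.erase s i) h
      have hmem : (i, y) ∈ R₁ ∪ R₂ := Finset.mem_union_left _ ht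
      have hvan : ∀ (R : Finset UnitTriangle) (F : Finset ℤ → K),
          (i, y) ∉ R → ∑ S ∈ C.powerset, F S * gfRemoved w R (S ×ˢ {y}) =
            ∑ S ∈ (C.erase i).powerset, F S * gfRemoved w R (S ×ˢ {y}) := by
        intro R F hR
        rw [hsplit, Finset.sum_union hdisj, Finset.sum_image hinj, add_eq_left]
        refine Finset.sum_eq_zero fun S _ => ?_
        rw [gfRemoved_of_notMem w hR (by simp), mul_zero]
      have hloz : lozengesAt (R₁ ∪ R₂) (i, y) = lozengesAt R₁ (i, y) ∪
          (if (i, y - 1) ∈ R₂ then {((i, y), (i, y - 1))} else ∅) := by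
        ext p
        rw [lozengesAt_up _ hu hmem, lozengesAt_up _ hu ht]
        simp only [Finset.mem_union, Finset.mem_image, Finset.mem_filter, Finset.mem_insert,
          Finset.mem_singleton]
        have e1 : ∀ a, (a, y) ∉ R₂ := fun a h => absurd (h₂ _ h) (by simp)
        have e2 : ∀ a, (a, y - 1) ∉ R₁ := fun a h => absurd (h₁ _ h) (by simp)
        constructor
        · rintro ⟨s, ⟨rfl | rfl | rfl, h | h⟩, rfl⟩
          · exact Or.inl ⟨_, ⟨by simp, h⟩, rfl⟩
          · exact absurd h (e1 _)
          · exact Or.inl ⟨_, ⟨by simp, h⟩, rfl⟩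
          · exact absurd h (e1 _)
          · exact absurd h (e2 _)
          · right
            simp [h]
        · rintro (⟨s, ⟨h, h'⟩, rfl⟩ | h)
          · exact ⟨s, ⟨h, Or.inl h'⟩, rfl⟩
          · split_ifs at h with h'
            · rw [Finset.mem_singleton] at h
              exact ⟨_, ⟨Or.inr (Or.inr rfl), Or.inr h'⟩, h.symm⟩
            · simp at h
      rw [gf_eq_sum w hmem, hloz, Finset.sum_union, Finset.sum_congr rfl
        fun p hp => congrArg _ (inner p hp), hsplit, Finset.sum_union hdisj,
        Finset.sum_image hinj]
      · congr 1
        · rw [← hsplit]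
          simp_rw [Finset.mul_sum]
          rw [Finset.sum_comm]
          have : ∀ S ∈ (C.erase i).powerset, (∏ i ∈ S, w i) * gfRemoved w R₁ (S ×ˢ {y}) *
              gfRemoved w R₂ (S ×ˢ {y - 1}) = ∑ p ∈ lozengesAt R₁ (i, y), lozengeWeight w p *
                ((∏ i ∈ S, w i) * gfRemoved w (R₁ \ {p.1, p.2}) (S ×ˢ {y}) *
                  gfRemoved w R₂ (S ×ˢ {y - 1})) := by
            intro S hS
            rw [gfRemoved_eq_sum w ht, Finset.mul_sum, Finset.sum_mul]
            · exact Finset.sum_congr rfl fun p _ => by ring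
            · intro h
              have := Finset.mem_powerset.1 hS (Finset.mem_product.1 h).1
              simp at this
          rw [Finset.sum_congr rfl this, hsplit, Finset.sum_union hdisj, add_eq_left,
            Finset.sum_image hinj]
          refine Finset.sum_eq_zero fun S _ => Finset.sum_eq_zero fun p hp => ?_
          rw [gfRemoved_of_notMem w (R := R₁ \ {p.1, p.2}) (t := (i, y)) _ (by simp)]
          · ring
          · obtain ⟨-, -, hc⟩ := mem_lozengesAt.1 hp
            rcases hc with h | h <;> simp [← h]
        · have hins : ∀ S ∈ (C.erase i).powerset, (∏ i ∈ insert i S, w i) *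
              gfRemoved w R₁ (insert i S ×ˢ {y}) * gfRemoved w R₂ (insert i S ×ˢ {y - 1}) =
              w i * ((∏ i ∈ S, w i) * gfRemoved w (R₁ \ {(i, y)}) (S ×ˢ {y}) *
              (if (i, y - 1) ∈ R₂ then gfRemoved w (R₂ \ {(i, y - 1)}) (S ×ˢ {y - 1}) else 0)) := by
            intro S hS
            have hiS : i ∉ S := fun h => by simpa using Finset.mem_powerset.1 hS h
            have hprod : ∀ b : ℤ, insert i S ×ˢ {b} = insert (i, b) (S ×ˢ {b}) := fun b => by
              ext ⟨c, d⟩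
              simp only [Finset.mem_product, Finset.mem_insert, Finset.mem_singleton,
                Prod.mk.injEq]
              tauto
            rw [Finset.prod_insert hiS, hprod, hprod, gfRemoved_insert w ht (by simp [hiS])]
            split_ifs with h
            · rw [gfRemoved_insert w h (by simp [hiS])]
              ring
            · rw [gfRemoved_of_notMem w h (Finset.mem_insert_self _ _)]
              ring
          rw [Finset.sum_congr rfl hins, ← Finset.mul_sum]
          split_ifs with h
          · rw [Finset.sum_singleton]
            have hw : lozengeWeight w ((i, y), (i, y - 1)) = w i := by
              simp [lozengeWeight, IsVertical]
            rw [hw]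
            congr 1
            have hR : (R₁ ∪ R₂) \ {(i, y), (i, y - 1)} = (R₁ \ {(i, y)}) ∪ (R₂ \ {(i, y - 1)}) := by
              ext s
              simp only [Finset.mem_sdiff, Finset.mem_union, Finset.mem_insert,
                Finset.mem_singleton]
              constructor
              · tauto
              · rintro (⟨h3, h4⟩ | ⟨h3, h4⟩)
                · refine ⟨Or.inl h3, ?_⟩
                  rintro (rfl | rfl)
                  · exact h4 rfl
                  · exact hd _ h3 h
                · refine ⟨Or.inr h3, ?_⟩
                  rintro (rfl | rfl)
                  · exact hd _ ht h3
                  · exact h4 rfl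
            dsimp only
            rw [hR, ih (R₁ \ {(i, y)}).card (hlt _ (by simp)) (R₂ \ {(i, y - 1)})
              (fun s hs => h₂ s (Finset.mem_sdiff.1 hs).1) (R₁ \ {(i, y)})
              (fun s hs => h₁ s (Finset.mem_sdiff.1 hs).1)
              (fun a h h1 h2 => hRC a h (Finset.mem_sdiff.1 h1).1 (Finset.mem_sdiff.1 h2).1) rfl]
            have := hvan (R₁ \ {(i, y)})
              (fun S => (∏ i ∈ S, w i) * gfRemoved w (R₂ \ {(i, y - 1)}) (S ×ˢ {y - 1})) (by simp)
            convert this using 2 <;> ring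
          · simp
      · rw [Finset.disjoint_left]
        intro p hp hp'
        split_ifs at hp' with h
        · rw [Finset.mem_singleton] at hp'
          subst hp'
          exact hd _ (mem_lozengesAt.1 hp).1.2 h
        · simp at hp'
    · have hloz : lozengesAt (R₁ ∪ R₂) t = lozengesAt R₁ t := by
        ext p
        simp only [mem_lozengesAt, Finset.mem_union]
        constructor
        · rintro ⟨⟨h1, h2⟩, hl, hc⟩
          have : p.1 ∈ R₁ ∧ p.2 ∈ R₁ := by
            rcases hc with rfl | rfl
            · refine ⟨ht, h2.resolve_right fun h => htC ?_⟩
              have e1 := h₁ _ ht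
              have e2 := h₂ _ h
              obtain ⟨⟨a, b⟩, c, d⟩ := p
              have := hl.2
              simp only [IsVertical, Prod.mk.injEq] at this e1 e2 h ht ⊢
              obtain rfl : b = y := by omega
              obtain rfl : c = a := by omega
              obtain rfl : d = b - 1 := by omega
              exact ⟨c, hRC _ hl.1 ht h, rfl, rfl⟩
            · refine ⟨h1.resolve_right fun h => ?_, ht⟩
              have e1 := h₁ _ ht
              have e2 := h₂ _ h
              obtain ⟨⟨a, b⟩, c, d⟩ := p
              have := hl.2
              simp only [IsVertical, Prod.mk.injEq] at this e1 e2
              omega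
          exact ⟨this, hl, hc⟩
        · tauto
      rw [gf_eq_sum w (Finset.mem_union_left _ ht), hloz, Finset.sum_congr rfl
        fun p hp => congrArg _ (inner p hp)]
      simp_rw [Finset.mul_sum]
      rw [Finset.sum_comm]
      refine Finset.sum_congr rfl fun S hS => ?_
      rw [gfRemoved_eq_sum w ht, Finset.mul_sum, Finset.sum_mul]
      · exact Finset.sum_congr rfl fun p _ => by ring
      · intro h
        obtain ⟨h1, h2⟩ := Finset.mem_product.1 h
        exact htC ⟨t.1, Finset.mem_powerset.1 hS h1, Prod.ext rfl (by simpa using h2)⟩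

end Decomposition

/-! ### Products of vectors in the exterior algebra -/

section Wedge

open ExteriorAlgebra

variable {K : Type*} [Field K] {V : Type*} [AddCommGroup V] [Module K V]

/-- The exterior product of a list of vectors. -/
noncomputable def wedge (L : List V) : ExteriorAlgebra K V := (L.map (ι K)).prod

@[simp] theorem wedge_nil : wedge (K := K) ([] : List V) = 1 := rfl

@[simp] theorem wedge_cons (v : V) (L : List V) :
    wedge (K := K) (v :: L) = ι K v * wedge L := by
  simp [wedge]

@[simp] theorem wedge_append (L L' : List V) :
    wedge (K := K) (L ++ L') = wedge L * wedge L' := by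
  simp [wedge]

theorem ι_mul_wedge_map_add (v : V) (L : List V) :
    ι K v * wedge (L.map (v + ·)) = ι K v * wedge L := by
  induction L with
  | nil => simp
  | cons g L ih =>
    have h : ι K v * ι K g = -(ι K g * ι K v) :=
      eq_neg_of_add_eq_zero_left (ι_add_mul_swap v g)
    rw [List.map_cons, wedge_cons, wedge_cons, map_add, add_mul, mul_add, ← mul_assoc,
      ι_sq_zero, zero_mul, zero_add, ← mul_assoc, ← mul_assoc, h, neg_mul, neg_mul, mul_assoc, ih,
      mul_assoc]

theorem ι_mul_wedge_map_sub (v : V) (L : List V) :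
    ι K v * wedge (L.map (· - v)) = ι K v * wedge L := by
  rw [← ι_mul_wedge_map_add v (L.map (· - v)), List.map_map]
  congr 2
  convert List.map_id L using 2
  ext
  simp

/-- The derivative of the exterior product under a common translation of the vectors. -/
noncomputable def wedgeDiff : List V → ExteriorAlgebra K V
  | [] => 0
  | g :: L => wedge (L.map (· - g))

theorem wedge_map_add (v : V) (L : List V) :
    wedge (K := K) (L.map (v + ·)) = wedge L + ι K v * wedgeDiff L := by
  cases L with
  | nil => simp [wedgeDiff]
  | cons g L =>
    rw [List.map_cons, wedge_cons, ← ι_mul_wedge_map_sub, List.map_map, wedge_cons, wedgeDiff,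
      ← ι_mul_wedge_map_sub g L, map_add, add_mul, add_comm]
    congr 4 <;>
    · ext
      simp

theorem wedgeDiff_map_add (v : V) (L : List V) :
    wedgeDiff (K := K) (L.map (v + ·)) = wedgeDiff L := by
  cases L with
  | nil => simp [wedgeDiff]
  | cons g L =>
    simp only [List.map_cons, wedgeDiff, List.map_map]
    congr 2
    ext
    simp

theorem wedge_eq_ιMulti (L : List V) : wedge (K := K) L = ιMulti K L.length L.get := by
  rw [ιMulti_apply, wedge]
  congr 1
  conv_lhs => rw [← List.ofFn_get L]
  rw [List.map_ofFn]
  rfl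

/-- The exterior product of more vectors than the dimension of their span vanishes. -/
theorem wedge_eq_zero_of_card_lt (s : Finset V) (L : List V)
    (hL : ∀ v ∈ L, v ∈ Submodule.span K (s : Set V)) (hs : s.card < L.length) :
    wedge (K := K) L = 0 := by
  rw [wedge_eq_ιMulti]
  refine AlternatingMap.map_linearDependent _ _ fun hli => ?_
  have := linearIndependent_le_span' L.get hli (s : Set V) (by
    rintro _ ⟨i, rfl⟩
    exact hL _ (List.get_mem _ _))
  simp only [Fintype.card_coe, Finset.coe_sort_coe, Cardinal.mk_fin, Nat.cast_le] at this
  omega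

end Wedge

/-! ### Scanning one row -/

section RowScan

open ExteriorAlgebra

variable {K : Type*} [Field K] {V : Type*} [AddCommGroup V] [Module K V]

/-- The sum of `f p` over the `p ∈ [a, s)` for which `(p, j)` is down-pointing. -/
noncomputable def partialSum (f : ℤ → V) (j a s : ℤ) : V :=
  ∑ p ∈ (Finset.Ico a s).filter fun p => Odd (p - j), f p

theorem partialSum_of_odd (f : ℤ → V) {j a s : ℤ} (ha : Odd (a - j)) (has : a < s) :
    partialSum f j a s = f a + partialSum f j (a + 2) s := by
  have : (Finset.Ico a s).filter (fun p => Odd (p - j)) =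
      insert a ((Finset.Ico (a + 2) s).filter fun p => Odd (p - j)) := by
    ext p
    simp only [Finset.mem_filter, Finset.mem_Ico, Finset.mem_insert, Int.odd_iff] at *
    constructor
    · rintro ⟨h1, h2⟩
      omega
    · rintro (rfl | h) <;> omega
  rw [partialSum, this, Finset.sum_insert (by simp), partialSum]

theorem partialSum_of_even (f : ℤ → V) {j a s : ℤ} (ha : Even (a - j)) :
    partialSum f j a s = partialSum f j (a + 1) s := by
  unfold partialSum
  congr 1
  ext p
  simp only [Finset.mem_filter, Finset.mem_Ico, Int.odd_iff, Int.even_iff] at *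
  omega

theorem partialSum_of_le (f : ℤ → V) {j a s : ℤ} (h : s ≤ a) : partialSum f j a s = 0 := by
  simp [partialSum, Finset.Ico_eq_empty_of_le h]

/-- The part to the right of `a` of the row at height `j` with right end `b`, the positions in `L`
being removed. -/
noncomputable def rowPart (j b a : ℤ) (L : List ℤ) : Finset UnitTriangle :=
  (Finset.Icc a b \ L.toFinset) ×ˢ {j}

theorem mem_rowPart {j b a : ℤ} {L : List ℤ} {t : UnitTriangle} :
    t ∈ rowPart j b a L ↔ (a ≤ t.1 ∧ t.1 ≤ b ∧ t.1 ∉ L) ∧ t.2 = j := by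
  obtain ⟨i, i'⟩ := t
  rw [rowPart, Finset.mem_product, Finset.mem_sdiff, Finset.mem_Icc, List.mem_toFinset,
    Finset.mem_singleton]
  tauto

/-- The weighted generating function of a partially scanned row on top of which sits the region `Q`
from which the triangles above the positions in `P` are removed. -/
noncomputable def scanGF (w : ℤ → K) (Q : Finset UnitTriangle) (j b a : ℤ) (L P : List ℤ) : K :=
  (P.map w).prod * if P.toFinset ×ˢ {j + 1} ⊆ Q then
    gf w (rowPart j b a L ∪ (Q \ P.toFinset ×ˢ {j + 1})) else 0

theorem scanGF_skip (w : ℤ → K) (Q : Finset UnitTriangle) (j b a : ℤ) (L P : List ℤ) : scanGF w Q j b a (a :: L) P = scanGF w Q j b (a + 1) L P := by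
  have : rowPart j b a (a :: L) = rowPart j b (a + 1) L := by
    ext t
    simp only [mem_rowPart, List.mem_cons, not_or]
    constructor
    · rintro ⟨⟨h1, h2, h3, h4⟩, h5⟩
      exact ⟨⟨by omega, h2, h4⟩, h5⟩
    · rintro ⟨⟨h1, h2, h3⟩, h5⟩
      exact ⟨⟨by omega, h2, by omega, h3⟩, h5⟩
  rw [scanGF, this, scanGF]

theorem scanGF_up (w : ℤ → K) {Q : Finset UnitTriangle} {j b a : ℤ} {L P : List ℤ}
    (hQ : ∀ t ∈ Q, j < t.2) (hab : a ≤ b) (ha : Even (a - j)) (hL : ∀ s ∈ L, a + 1 < s) :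
    scanGF w Q j b a L P = if a + 1 ≤ b then scanGF w Q j b (a + 2) L P else 0 := by
  unfold scanGF
  by_cases hP : P.toFinset ×ˢ {j + 1} ⊆ Q
  swap
  · simp only [if_neg hP, mul_zero, ite_self]
  simp only [if_pos hP]
  have haL : a ∉ L := fun h => by have := hL _ h; omega
  have haL' : a + 1 ∉ L := fun h => by have := hL _ h; omega
  have hmem : (a, j) ∈ rowPart j b a L ∪ (Q \ P.toFinset ×ˢ {j + 1}) :=
    Finset.mem_union_left _ (mem_rowPart.2 ⟨⟨le_rfl, hab, haL⟩, rfl⟩)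
  have hQj : ∀ i, (i, j) ∉ Q := fun i h => lt_irrefl _ (hQ _ h)
  have hQj' : ∀ i, (i, j - 1) ∉ Q := fun i h => by have := hQ _ h; simp at this; omega
  rw [gf_up w (i := a) (j := j) ha hmem, if_neg (c := (a - 1, j) ∈ _),
    if_neg (c := (a, j - 1) ∈ _), zero_add, add_zero]
  · by_cases hb : a + 1 ≤ b
    · rw [if_pos, if_pos hb]
      · congr 2
        ext ⟨i, i'⟩
        simp only [Finset.mem_sdiff, Finset.mem_union, mem_rowPart, Finset.mem_insert,
          Finset.mem_singleton, Prod.mk.injEq, Finset.mem_product]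
        constructor
        · rintro ⟨h | h, h'⟩
          · exact Or.inl ⟨⟨by omega, h.1.2⟩, h.2⟩
          · exact Or.inr h
        · rintro (h | h)
          · exact ⟨Or.inl ⟨⟨by omega, h.1.2⟩, h.2⟩, by omega⟩
          · refine ⟨Or.inr h, ?_⟩
            rintro (⟨-, rfl⟩ | ⟨-, rfl⟩) <;> exact hQj _ h.1
      · exact Finset.mem_union_left _ (mem_rowPart.2 ⟨⟨by simp, hb, haL'⟩, rfl⟩)
    · rw [if_neg, if_neg hb, mul_zero]
      simp [mem_rowPart, hb, hQj]
  · simp [mem_rowPart, hQj']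
  · simp [mem_rowPart, hQj]

theorem scanGF_down (w : ℤ → K) {Q : Finset UnitTriangle} {j b a : ℤ} {L P : List ℤ}
    (hQ : ∀ t ∈ Q, j < t.2) (hab : a + 1 ≤ b) (ha : Odd (a - j)) (hL : ∀ s ∈ L, a < s)
    (hP : ∀ p ∈ P, p < a) :
    scanGF w Q j b a L P =
      (if a + 1 ∈ L then 0 else scanGF w Q j b (a + 2) L P) +
        scanGF w Q j b (a + 1) L (P ++ [a]) := by
  unfold scanGF
  have hPa : a ∉ P := fun h => lt_irrefl _ (hP _ h)
  by_cases hPQ : P.toFinset ×ˢ {j + 1} ⊆ Q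
  swap
  · have : ¬ (P ++ [a]).toFinset ×ˢ {j + 1} ⊆ Q := fun h => hPQ (by
      refine subset_trans (Finset.product_subset_product_left fun x hx => ?_) h
      simp only [List.mem_toFinset, List.mem_append] at hx ⊢
      exact Or.inl hx)
    simp only [if_neg hPQ, if_neg this, mul_zero, ite_self, add_zero]
  simp only [if_pos hPQ]
  have haL : a ∉ L := fun h => lt_irrefl _ (hL _ h)
  have hmem : (a, j) ∈ rowPart j b a L ∪ (Q \ P.toFinset ×ˢ {j + 1}) :=
    Finset.mem_union_left _ (mem_rowPart.2 ⟨⟨le_rfl, by dsimp only; omega, haL⟩, rfl⟩)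
  have hQj : ∀ i, (i, j) ∉ Q := fun i h => lt_irrefl _ (hQ _ h)
  have hd : ¬ IsUp (a, j) := by rwa [IsUp, Int.not_even_iff_odd]
  have hmem' : ((a, j + 1) ∈ rowPart j b a L ∪ (Q \ P.toFinset ×ˢ {j + 1})) ↔ (a, j + 1) ∈ Q := by
    simp [mem_rowPart, hPa]
  have hmem'' : ((a + 1, j) ∈ rowPart j b a L ∪ (Q \ P.toFinset ×ˢ {j + 1})) ↔ a + 1 ∉ L := by
    simp [mem_rowPart, hQj, hab]
  have hsub : (P ++ [a]).toFinset ×ˢ {j + 1} ⊆ Q ↔ (a, j + 1) ∈ Q := by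
    constructor
    · exact fun h => h (by simp)
    · rintro h ⟨x, y⟩ hx
      simp only [Finset.mem_product, List.mem_toFinset, List.mem_append, List.mem_singleton,
        Finset.mem_singleton] at hx
      obtain ⟨hx | rfl, rfl⟩ := hx
      · exact hPQ (by simp [hx])
      · exact h
  rw [gf_down w hd hmem, if_neg (c := (a - 1, j) ∈ _), zero_add, mul_add]
  · congr 1
    · by_cases h : a + 1 ∈ L
      · rw [if_neg (by rw [hmem'']; simpa using h), if_pos h, mul_zero]
      · rw [if_pos (by rw [hmem'']; simpa using h), if_neg h]
        congr 2
        ext ⟨i, i'⟩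
        simp only [Finset.mem_sdiff, Finset.mem_union, mem_rowPart, Finset.mem_insert,
          Finset.mem_singleton, Prod.mk.injEq, Finset.mem_product]
        constructor
        · rintro ⟨h | h, h'⟩
          · exact Or.inl ⟨⟨by omega, h.1.2⟩, h.2⟩
          · exact Or.inr h
        · rintro (h | h)
          · exact ⟨Or.inl ⟨⟨by omega, h.1.2⟩, h.2⟩, by omega⟩
          · refine ⟨Or.inr h, ?_⟩
            rintro (⟨-, rfl⟩ | ⟨-, rfl⟩) <;> exact hQj _ h.1
    · by_cases h : (a, j + 1) ∈ Q
      · rw [if_pos (hmem'.2 h), if_pos (hsub.2 h), List.map_append, List.prod_append]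
        simp only [List.map_cons, List.map_nil, List.prod_singleton]
        rw [mul_assoc]
        congr 3
        ext ⟨i, i'⟩
        simp only [Finset.mem_sdiff, Finset.mem_union, mem_rowPart, Finset.mem_insert,
          Finset.mem_singleton, Prod.mk.injEq, Finset.mem_product, List.mem_toFinset,
          List.mem_append]
        constructor
        · rintro ⟨h | h, h'⟩
          · exact Or.inl ⟨⟨by omega, h.1.2⟩, h.2⟩
          · right
            refine ⟨h.1, ?_⟩
            rintro ⟨hi | hi, rfl⟩
            · exact h.2 ⟨hi, rfl⟩
            · exact h' (Or.inr ⟨List.mem_singleton.1 hi, rfl⟩)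
        · rintro (h | h)
          · exact ⟨Or.inl ⟨⟨by omega, h.1.2⟩, h.2⟩, by omega⟩
          · refine ⟨Or.inr ⟨h.1, by tauto⟩, ?_⟩
            rintro (⟨-, rfl⟩ | ⟨rfl, rfl⟩)
            · exact hQj _ h.1
            · exact h.2 (by simp)
      · rw [if_neg (by rwa [hmem']), if_neg (by rwa [hsub]), mul_zero, mul_zero]
  · simp [mem_rowPart, hQj]

theorem scanGF_eq_wedge (w : ℤ → K) {Q : Finset UnitTriangle} {j b : ℤ} {k : ℕ} {f : ℤ → V}
    {Ω X : ExteriorAlgebra K V} (hQ : ∀ t ∈ Q, j < t.2) (hb : Even (b - j))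
    (hA : ∀ P : List ℤ, P.Pairwise (· < ·) → (∀ p ∈ P, 0 ≤ p ∧ p < b ∧ Odd (p - j)) →
      P.length = k →
      ((P.map w).prod * gfRemoved w Q (P.toFinset ×ˢ {j + 1})) • Ω = wedge (P.map f) * X)
    (N : ℕ) (a : ℤ) (ha0 : 0 ≤ a) (haN : a + N = b + 1) (L P : List ℤ)
    (hL : L.Pairwise (· < ·)) (hLa : ∀ s ∈ L, a ≤ s ∧ s ≤ b ∧ Even (s - j))
    (hP : P.Pairwise (· < ·)) (hPa : ∀ p ∈ P, 0 ≤ p ∧ p < a ∧ Odd (p - j)) :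
    (Odd (a - j) → P.length + L.length = k → scanGF w Q j b a L P • Ω =
      wedge (P.map f) * wedge (L.map (partialSum f j a)) * X) ∧
    (Even (a - j) → P.length + L.length = k + 1 → scanGF w Q j b a L P • Ω =
      wedge (P.map f) * wedgeDiff (L.map (partialSum f j (a + 1))) * X) := by
  induction N using Nat.strong_induction_on generalizing a L P with
  | _ N ih =>
    constructor
    · intro hodd hk
      rcases N with _ | _ | N
      · obtain rfl : L = [] := List.eq_nil_iff_forall_not_mem.2 fun s hs => by
          have := hLa s hs; push_cast at haN; omega
        have hrow : rowPart j b a [] = ∅ := by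
          ext t
          simp only [mem_rowPart, Finset.notMem_empty, iff_false]
          push_cast at haN
          omega
        have := hA P hP (fun p hp => ⟨(hPa p hp).1, ?_, (hPa p hp).2.2⟩) (by simpa using hk)
        · rw [List.map_nil, wedge_nil, mul_one, ← this, scanGF, hrow, Finset.empty_union,
            gfRemoved]
        · obtain ⟨-, h1, h2⟩ := hPa p hp
          rw [Int.odd_iff] at h2 hodd
          push_cast at haN
          omega
      · exfalso
        rw [Int.odd_iff] at hodd
        rw [Int.even_iff] at hb
        push_cast at haN
        omega
      · push_cast at haN
        have hLa' : ∀ s ∈ L, a < s := fun s hs => by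
          obtain ⟨h1, h2, h3⟩ := hLa s hs
          rw [Int.odd_iff] at hodd
          rw [Int.even_iff] at h3
          omega
        have hev : Even (a + 1 - j) := by
          rw [Int.even_iff]
          rw [Int.odd_iff] at hodd
          omega
        have hodd2 : Odd (a + 2 - j) := by
          rw [Int.odd_iff] at hodd ⊢
          omega
        have hPL : (P ++ [a]).Pairwise (· < ·) := by
          rw [List.pairwise_append]
          exact ⟨hP, List.pairwise_singleton _ _, fun p hp x hx => by
            rw [List.mem_singleton] at hx; subst hx; exact (hPa p hp).2.1⟩
        have hPLa : ∀ c, a < c → ∀ p ∈ P ++ [a], 0 ≤ p ∧ p < c ∧ Odd (p - j) := by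
          intro c hc p hp
          rw [List.mem_append, List.mem_singleton] at hp
          rcases hp with hp | rfl
          · obtain ⟨h1, h2, h3⟩ := hPa p hp
            exact ⟨h1, by omega, h3⟩
          · exact ⟨ha0, hc, hodd⟩
        have hLmap : L.map (partialSum f j a) =
            (L.map (partialSum f j (a + 2))).map (f a + ·) := by
          rw [List.map_map]
          refine List.map_congr_left fun s hs => ?_
          exact partialSum_of_odd f hodd (hLa' s hs)
        rw [scanGF_down w hQ (by omega) hodd hLa' fun p hp => (hPa p hp).2.1]
        by_cases hmem : a + 1 ∈ L
        · obtain ⟨s, L', rfl⟩ : ∃ s L', L = s :: L' := by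
            cases L with
            | nil => simp at hmem
            | cons s L' => exact ⟨s, L', rfl⟩
          have hs1 : s = a + 1 := by
            have h1 := hLa' s (by simp)
            rcases List.mem_cons.1 hmem with h | h
            · exact h.symm
            · have := List.rel_of_pairwise_cons hL h
              omega
          subst hs1
          have hL' : ∀ s ∈ L', a + 1 < s := fun s hs => List.rel_of_pairwise_cons hL hs
          have hL2 : ∀ s ∈ L', a + 2 ≤ s ∧ s ≤ b ∧ Even (s - j) := fun s hs =>
            ⟨by have := hL' s hs; omega, (hLa s (by simp [hs])).2⟩
          rw [if_pos hmem, zero_add, scanGF_skip _ _ _ _ _ _ _, add_assoc,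
            show (1 : ℤ) + 1 = 2 by norm_num,
            (ih N (by omega) (a + 2) (by omega) (by omega) L' (P ++ [a]) hL.of_cons
              hL2 hPL (hPLa _ (by omega))).1 hodd2 ?_]
          · rw [hLmap]
            simp only [List.map_append, List.map_cons, List.map_nil, wedge_append, wedge_cons,
              wedge_nil, mul_one]
            rw [partialSum_of_le f (show a + 1 ≤ a + 2 by omega), add_zero, ι_mul_wedge_map_add]
            simp only [mul_assoc]
          · simp only [List.length_append, List.length_cons, List.length_nil] at hk ⊢
            omega
        · have hL' : ∀ s ∈ L, a + 2 ≤ s := fun s hs => by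
            have h1 := hLa' s hs
            have : s ≠ a + 1 := fun h => hmem (h ▸ hs)
            omega
          rw [if_neg hmem, add_smul,
            (ih N (by omega) (a + 2) (by omega) (by omega) L P hL
              (fun s hs => ⟨hL' s hs, (hLa s hs).2⟩) hP
              (fun p hp => ⟨(hPa p hp).1, by have := (hPa p hp).2.1; omega, (hPa p hp).2.2⟩)).1
              hodd2 hk,
            (ih (N + 1) (by omega) (a + 1) (by omega) (by push_cast; omega) L (P ++ [a]) hL
              (fun s hs => ⟨by have := hL' s hs; omega, (hLa s hs).2⟩) hPL
              (hPLa _ (by omega))).2 hev ?_, hLmap, wedge_map_add, add_assoc,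
            show (1 : ℤ) + 1 = 2 by norm_num]
          · simp only [List.map_append, List.map_cons, List.map_nil, wedge_append, wedge_cons,
              wedge_nil, mul_one, mul_add, add_mul, mul_assoc]
          · simp only [List.length_append, List.length_cons, List.length_nil]
            omega
    · intro hev hk
      have hab : a ≤ b := by
        rcases N with _ | N
        · exfalso
          rw [Int.even_iff] at hev hb
          push_cast at haN
          omega
        · push_cast at haN
          omega
      have hodd1 : Odd (a + 1 - j) := by
        rw [Int.odd_iff]
        rw [Int.even_iff] at hev
        omega
      have hPa' : ∀ c, a ≤ c → ∀ p ∈ P, 0 ≤ p ∧ p < c ∧ Odd (p - j) := fun c hc p hp =>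
        ⟨(hPa p hp).1, by have := (hPa p hp).2.1; omega, (hPa p hp).2.2⟩
      by_cases hmem : a ∈ L
      · obtain ⟨s, L', rfl⟩ : ∃ s L', L = s :: L' := by
          cases L with
          | nil => simp at hmem
          | cons s L' => exact ⟨s, L', rfl⟩
        have hs1 : s = a := by
          have h1 := hLa s (by simp)
          rcases List.mem_cons.1 hmem with h | h
          · exact h.symm
          · have := List.rel_of_pairwise_cons hL h
            omega
        subst hs1
        have hL' : ∀ t ∈ L', s < t := fun t ht => List.rel_of_pairwise_cons hL ht
        rw [scanGF_skip _ _ _ _ _ _ _,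
          (ih (N - 1) (by omega) (s + 1) (by omega) (by omega) L' P hL.of_cons
            (fun t ht => ⟨by have := hL' t ht; omega, (hLa t (by simp [ht])).2⟩) hP
            (hPa' _ (by omega))).1 hodd1 ?_]
        · rw [List.map_cons, wedgeDiff, partialSum_of_le f (show s ≤ s + 1 by omega)]
          simp only [sub_zero, List.map_id']
        · simp only [List.length_cons] at hk
          omega
      · have hL' : ∀ s ∈ L, a + 2 ≤ s := fun s hs => by
          obtain ⟨h1, h2, h3⟩ := hLa s hs
          have : s ≠ a := fun h => hmem (h ▸ hs)
          rw [Int.even_iff] at hev h3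
          omega
        rw [scanGF_up w hQ hab hev fun s hs => by have := hL' s hs; omega]
        by_cases hb' : a + 1 ≤ b
        · have hab2 : a + 2 ≤ b := by
            rw [Int.even_iff] at hev hb
            omega
          rw [if_pos hb', (ih (N - 2) (by omega) (a + 2) (by omega) (by omega) L P hL
            (fun s hs => ⟨hL' s hs, (hLa s hs).2⟩) hP (hPa' _ (by omega))).2 (by
              rw [Int.even_iff] at hev ⊢; omega) hk]
          have : L.map (partialSum f j (a + 1)) =
              (L.map (partialSum f j (a + 2 + 1))).map (f (a + 1) + ·) := by
            rw [List.map_map]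
            refine List.map_congr_left fun s hs => ?_
            rw [partialSum_of_odd f hodd1 (by have := hL' s hs; omega)]
            simp only [Function.comp_apply]
            congr 2
            ring
          rw [this, wedgeDiff_map_add]
        · obtain rfl : L = [] := List.eq_nil_iff_forall_not_mem.2 fun s hs => by
            have := hL' s hs
            have := (hLa s hs).2.1
            omega
          rw [if_neg hb', zero_smul, List.map_nil, wedgeDiff]
          simp

end RowScan

/-! ### Regions built row by row -/

section Chain

open ExteriorAlgebra

variable {K : Type*} [Field K] {V : Type*} [AddCommGroup V] [Module K V]

theorem wedge_eq_zero_of_zero_mem {L : List V} (h : (0 : V) ∈ L) : wedge (K := K) L = 0 := by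
  induction L with
  | nil => simp at h
  | cons v L ih =>
    rcases List.mem_cons.1 h with h | h
    · rw [wedge_cons, ← h, map_zero, zero_mul]
    · rw [wedge_cons, ih h, mul_zero]

theorem wedge_map_smul (w : ℤ → K) (f : ℤ → V) (P : List ℤ) :
    wedge (K := K) (P.map fun p => w p • f p) = (P.map w).prod • wedge (P.map f) := by
  induction P with
  | nil => simp
  | cons p P ih =>
    rw [List.map_cons, wedge_cons, ih, List.map_cons, List.prod_cons, List.map_cons, wedge_cons,
      map_smul, smul_mul_smul_comm]

theorem scanGF_nil (w : ℤ → K) {Q : Finset UnitTriangle} {j b : ℤ} {P : List ℤ}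
    (hQ : ∀ t ∈ Q, j < t.2) (N : ℕ) (a : ℤ) (hab : a + N = b) (ha : Even (a - j))
    (hb : Even (b - j)) : scanGF w Q j b a [] P = 0 := by
  induction N using Nat.twoStepInduction generalizing a with
  | zero => rw [scanGF_up w hQ (by push_cast at hab; omega) ha (by simp),
      if_neg (by push_cast at hab; omega)]
  | one =>
    rw [Int.even_iff] at ha hb
    push_cast at hab
    omega
  | more N ih _ =>
    push_cast at hab
    rw [scanGF_up w hQ (by omega) ha (by simp), if_pos (by omega)]
    exact ih (a + 2) (by omega) (by rw [Int.even_iff] at ha ⊢; omega)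

variable (inj ex : ℕ → Prop) [DecidablePred inj] [DecidablePred ex] (b : ℕ → ℤ) (c : ℤ)

/-- The left end of the row number `r`: position `0`, unless a dent has been removed. -/
def leftEnd (r : ℕ) : ℤ := if Even r ∧ ¬ inj r then 1 else 0

/-- The region consisting of `r` rows, from top to bottom, the first one being at height `c`.  The
row number `r` extends to the position `b r`, which is removed if `ex r` holds. -/
noncomputable def chain : ℕ → Finset UnitTriangle
  | 0 => ∅
  | r + 1 => rowPart (c - r) (b r) (leftEnd inj r) (if ex r then [b r] else []) ∪ chain r

theorem mem_chain {T : ℕ} {t : UnitTriangle} :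
    t ∈ chain inj ex b c T ↔ ∃ r < T, t.2 = c - r ∧ leftEnd inj r ≤ t.1 ∧ t.1 ≤ b r ∧
      (ex r → t.1 ≠ b r) := by
  induction T with
  | zero => simp [chain]
  | succ T ih =>
    rw [chain, Finset.mem_union, mem_rowPart, ih]
    constructor
    · rintro (⟨⟨h1, h2, h3⟩, h4⟩ | ⟨r, hr, h⟩)
      · exact ⟨T, T.lt_succ_self, h4, h1, h2, fun h => by simpa [h] using h3⟩
      · exact ⟨r, hr.trans T.lt_succ_self, h⟩
    · rintro ⟨r, hr, h1, h2, h3, h4⟩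
      rcases Nat.lt_succ_iff_lt_or_eq.1 hr with hr | rfl
      · exact Or.inr ⟨r, hr, h1, h2, h3, h4⟩
      · refine Or.inl ⟨⟨h2, h3, ?_⟩, h1⟩
        split_ifs with h
        · simpa using h4 h
        · simp

variable {b} in
theorem lt_of_mem_chain {T : ℕ} {t : UnitTriangle} (h : t ∈ chain inj ex b c T) : c - T < t.2 := by
  obtain ⟨r, hr, h, -⟩ := (mem_chain ..).1 h
  omega

variable (w : ℤ → K) (e : ℕ → V)

/-- The vector attached to the position `s` below the first `r` rows: its components count weighted
paths starting at the various left ends. -/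
noncomputable def pathVec : ℕ → ℤ → V
  | 0 => fun _ => 0
  | r + 1 => fun s => (if inj r then e r else 0) +
      partialSum (fun p => w p • pathVec r p) r 0 s

theorem pathVec_succ (r : ℕ) (s : ℤ) : pathVec inj w e (r + 1) s = (if inj r then e r else 0) +
    partialSum (fun p => w p • pathVec inj w e r p) r 0 s := rfl

/-- The vectors attached to the left ends of the first `r` rows. -/
def startVecs : ℕ → List V
  | 0 => []
  | r + 1 => if inj r then e r :: startVecs r else startVecs r

/-- The vectors attached to the right ends of the first `r` rows. -/
noncomputable def exitVecs : ℕ → List V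
  | 0 => []
  | r + 1 => if ex r then pathVec inj w e (r + 1) (b r) :: exitVecs r else exitVecs r

open Classical in
theorem span_startVecs_mono (r : ℕ) :
    Submodule.span K ((startVecs inj e r).toFinset : Set V) ≤
      Submodule.span K ((startVecs inj e (r + 1)).toFinset : Set V) := by
  refine Submodule.span_mono fun v hv => ?_
  rw [startVecs]
  split_ifs
  · simp only [List.coe_toFinset, Set.mem_ofPred_eq] at hv ⊢
    exact List.mem_cons_of_mem _ hv
  · exact hv

open Classical in
theorem pathVec_mem_span (r : ℕ) (s : ℤ) :
    pathVec inj w e r s ∈ Submodule.span K ((startVecs inj e r).toFinset : Set V) := by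
  induction r generalizing s with
  | zero => exact Submodule.zero_mem _
  | succ r ih =>
    rw [pathVec_succ]
    refine Submodule.add_mem _ ?_ (Submodule.sum_mem _ fun p _ => Submodule.smul_mem _ _
      (span_startVecs_mono inj e r (ih p)))
    split_ifs with h
    · refine Submodule.subset_span ?_
      simp [startVecs, h]
    · exact Submodule.zero_mem _

open Classical in
theorem exitVecs_mem_span (r : ℕ) : ∀ v ∈ exitVecs inj ex b w e r,
    v ∈ Submodule.span K ((startVecs inj e r).toFinset : Set V) := by
  induction r with
  | zero => simp [exitVecs]
  | succ r ih =>
    intro v hv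
    rw [exitVecs] at hv
    split_ifs at hv with h
    · rcases List.mem_cons.1 hv with rfl | hv
      · exact pathVec_mem_span inj w e _ _
      · exact span_startVecs_mono inj e r (ih v hv)
    · exact span_startVecs_mono inj e r (ih v hv)

theorem wedge_mul_exitVecs_eq_zero (r : ℕ) (L : List V)
    (hL : ∀ v ∈ L, ∃ (a : ℤ → K) (s : Finset ℤ), v = ∑ p ∈ s, a p • pathVec inj w e r p)
    (h : (startVecs inj e r).length < L.length + (exitVecs inj ex b w e r).length) :
    wedge L * wedge (K := K) (exitVecs inj ex b w e r) = 0 := by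
  classical
  rw [← wedge_append]
  refine wedge_eq_zero_of_card_lt (startVecs inj e r).toFinset _ (fun v hv => ?_) ?_
  · rcases List.mem_append.1 hv with hv | hv
    · obtain ⟨a, s, rfl⟩ := hL v hv
      exact Submodule.sum_mem _ fun p _ => Submodule.smul_mem _ _ (pathVec_mem_span inj w e _ _)
    · exact exitVecs_mem_span inj ex b w e r v hv
  · rw [List.length_append]
    exact (List.toFinset_card_le _).trans_lt h

theorem partialSum_congr_parity (f : ℤ → V) {j j' a s : ℤ} (h : Even (j - j')) :
    partialSum f j a s = partialSum f j' a s := by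
  unfold partialSum
  congr 1
  ext p
  simp only [Finset.mem_filter, Int.odd_iff, Int.even_iff] at *
  constructor
  · rintro ⟨h1, h2⟩
    exact ⟨h1, by omega⟩
  · rintro ⟨h1, h2⟩
    exact ⟨h1, by omega⟩

/-- The region with `r` rows from whose last row the triangles at the positions in `P` are removed
has a generating function that is a determinant, here written in the exterior algebra. -/
theorem gfRemoved_chain_smul_wedge (hc : Even c) (T : ℕ)
    (hinj : ∀ r, inj r → Even r) (hb : ∀ r < T, Even (b r - r)) (hb0 : ∀ r < T, 0 ≤ b r)
    (hb1 : ∀ r < T, b (r + 1) ≤ b r + 1) (hb2 : ∀ r < T, ex r → 1 ≤ b r ∧ b (r + 1) ≤ b r - 1)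
    (r : ℕ) (hr : r ≤ T) (P : List ℤ) (hP : P.Pairwise (· < ·))
    (hPb : ∀ p ∈ P, 0 ≤ p ∧ p < b r ∧ Odd (p - r))
    (hk : P.length + (exitVecs inj ex b w e r).length = (startVecs inj e r).length) :
    gfRemoved w (chain inj ex b c r) (P.toFinset ×ˢ {c - r + 1}) • wedge (K := K) (startVecs inj e r) =
      wedge (P.map (pathVec inj w e r)) * wedge (exitVecs inj ex b w e r) := by
  induction r generalizing P with
  | zero =>
    obtain rfl : P = [] := by
      rw [startVecs, exitVecs] at hk
      simpa using hk
    simp [chain, exitVecs, startVecs]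
  | succ r ih =>
    have hrT : r < T := hr
    specialize ih hrT.le
    have hbr := hb r hrT
    have hbr0 := hb0 r hrT
    have hcr : ∀ p : ℤ, Odd (p - (c - r)) ↔ Odd (p - r) := fun p => by
      rw [Int.odd_iff, Int.odd_iff]
      rw [Int.even_iff] at hc
      omega
    have hcr' : ∀ p : ℤ, Even (p - (c - r)) ↔ Even (p - r) := fun p => by
      rw [Int.even_iff, Int.even_iff]
      rw [Int.even_iff] at hc
      omega
    have hcast : c - ((r + 1 : ℕ) : ℤ) + 1 = c - r := by push_cast; ring
    have hP1 : ∀ p ∈ P, p ≤ b r := fun p hp => by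
      have := (hPb p hp).2.1
      have := hb1 r hrT
      omega
    have hP2 : ∀ p ∈ P, ex r → p < b r := fun p hp h => by
      have := (hPb p hp).2.1
      have := (hb2 r hrT h).2
      omega
    have hPe : ∀ p ∈ P, Even (p - r) := fun p hp => by
      have := (hPb p hp).2.2
      push_cast at this
      rw [Int.odd_iff] at this
      rw [Int.even_iff]
      omega
    set P' : List ℤ := P ++ (if ex r then [b r] else []) with hP'
    have hP's : P'.Pairwise (· < ·) := by
      rw [hP']
      split_ifs with h
      · rw [List.pairwise_append]
        exact ⟨hP, List.pairwise_singleton _ _, fun p hp x hx => by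
          rw [List.mem_singleton] at hx; subst hx; exact hP2 p hp h⟩
      · simpa using hP
    rw [hcast]
    set f : ℤ → V := fun p => w p • pathVec inj w e r p with hf
    have hA : ∀ P : List ℤ, P.Pairwise (· < ·) →
        (∀ p ∈ P, 0 ≤ p ∧ p < b r ∧ Odd (p - (c - r))) →
        P.length + (exitVecs inj ex b w e r).length = (startVecs inj e r).length →
        ((P.map w).prod * gfRemoved w (chain inj ex b c r) (P.toFinset ×ˢ {c - r + 1})) •
          wedge (K := K) (startVecs inj e r) = wedge (P.map f) * wedge (exitVecs inj ex b w e r) := by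
      intro P h1 h2 h3
      rw [mul_smul, ih P h1 (fun p hp => ⟨(h2 p hp).1, (h2 p hp).2.1, (hcr p).1 (h2 p hp).2.2⟩) h3,
        hf, wedge_map_smul, smul_mul_assoc]
    have hQ : ∀ t ∈ chain inj ex b c r, c - r < t.2 := fun t ht => lt_of_mem_chain _ _ _ ht
    have hexit : wedge (K := K) (P.map (pathVec inj w e (r + 1))) * wedge (exitVecs inj ex b w e (r + 1)) =
        wedge (P'.map (pathVec inj w e (r + 1))) * wedge (exitVecs inj ex b w e r) := by
      rw [exitVecs, hP']
      split_ifs with h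
      · simp [mul_assoc]
      · simp
    have hlen : P.length + (exitVecs inj ex b w e (r + 1)).length =
        P'.length + (exitVecs inj ex b w e r).length := by
      rw [exitVecs, hP']
      split_ifs with h
      · simp only [List.length_cons, List.length_append, List.length_nil]
        omega
      · simp
    rw [hexit]
    rw [hlen] at hk
    by_cases hleft : ∀ p ∈ P, leftEnd inj r ≤ p
    swap
    · push Not at hleft
      obtain ⟨p, hp, hlt⟩ := hleft
      have hp0 := (hPb p hp).1
      unfold leftEnd at hlt
      split_ifs at hlt with h
      · obtain rfl : p = 0 := by omega
        rw [gfRemoved_of_notMem w (t := (0, c - r)) _ (by simp [hp]), zero_smul,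
          wedge_eq_zero_of_zero_mem, zero_mul]
        · refine List.mem_map.2 ⟨0, List.mem_append_left _ hp, ?_⟩
          rw [pathVec_succ, if_neg h.2, partialSum_of_le _ le_rfl, zero_add]
        · rw [mem_chain]
          rintro ⟨r', hr', h1, h2, -⟩
          obtain rfl : r' = r := by simp at h1; omega
          rw [leftEnd, if_pos h] at h2
          simp at h2
      · omega
    have hscan : gfRemoved w (chain inj ex b c (r + 1)) (P.toFinset ×ˢ {c - (r : ℤ)}) =
        scanGF w (chain inj ex b c r) (c - r) (b r) (leftEnd inj r) P' [] := by
      rw [gfRemoved, if_pos, scanGF, chain]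
      · simp only [List.map_nil, List.prod_nil, one_mul, List.toFinset_nil, Finset.empty_product,
          Finset.empty_subset, if_true, Finset.sdiff_empty]
        congr 1
        ext ⟨i, i'⟩
        simp only [Finset.mem_sdiff, Finset.mem_union, mem_rowPart, Finset.mem_product,
          List.mem_toFinset, Finset.mem_singleton, hP', List.mem_append]
        constructor
        · rintro ⟨h | h, h'⟩
          · exact Or.inl ⟨⟨h.1.1, h.1.2.1, fun hi => hi.elim (fun hi => h' ⟨hi, h.2⟩) h.1.2.2⟩, h.2⟩
          · exact Or.inr h
        · rintro (h | h)
          · exact ⟨Or.inl ⟨⟨h.1.1, h.1.2.1, fun hi => h.1.2.2 (Or.inr hi)⟩, h.2⟩,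
              fun hi => h.1.2.2 (Or.inl hi.1)⟩
          · refine ⟨Or.inr h, fun hi => ?_⟩
            have := hQ _ h
            rw [hi.2] at this
            exact lt_irrefl _ this
      · rintro ⟨i, i'⟩ hi
        simp only [Finset.mem_product, List.mem_toFinset, Finset.mem_singleton] at hi
        rw [chain, Finset.mem_union, mem_rowPart]
        refine Or.inl ⟨⟨hleft i hi.1, hP1 i hi.1, fun h => ?_⟩, hi.2⟩
        split_ifs at h with h'
        · rw [List.mem_singleton] at h
          have := hP2 i hi.1 h'
          simp only at h
          omega
        · simp at h
    rw [hscan]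
    have hP'a : ∀ s ∈ P', leftEnd inj r ≤ s ∧ s ≤ b r ∧ Even (s - (c - r)) := by
      intro s hs
      rw [hP', List.mem_append] at hs
      rcases hs with hs | hs
      · exact ⟨hleft s hs, hP1 s hs, (hcr' s).2 (hPe s hs)⟩
      · split_ifs at hs with h
        · rw [List.mem_singleton] at hs
          subst hs
          refine ⟨?_, le_rfl, (hcr' _).2 hbr⟩
          unfold leftEnd
          split_ifs with h'
          · exact (hb2 r hrT h).1
          · exact hbr0
        · simp at hs
    have hle : leftEnd inj r ≤ b r + 1 := by
      unfold leftEnd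
      split_ifs <;> omega
    have hl0 : 0 ≤ leftEnd inj r := by
      unfold leftEnd
      split_ifs <;> omega
    obtain ⟨N, hN⟩ := Int.eq_ofNat_of_zero_le (sub_nonneg.2 hle)
    have hpar : ∀ s, partialSum f (c - r) 0 s = partialSum f r 0 s := fun s =>
      partialSum_congr_parity f (by rw [Int.even_iff] at hc ⊢; omega)
    by_cases hi : inj r
    · have hl : leftEnd inj r = 0 := by simp [leftEnd, hi]
      have hev : Even (0 - (c - (r : ℤ))) := by
        rw [hcr']
        have := hinj r hi
        rw [Nat.even_iff] at this
        rw [Int.even_iff]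
        omega
      have hvec : P'.map (pathVec inj w e (r + 1)) =
          (P'.map (partialSum f (c - r) (0 + 1))).map (e r + ·) := by
        rw [List.map_map]
        refine List.map_congr_left fun s _ => ?_
        rw [pathVec_succ, if_pos hi, Function.comp_apply, ← partialSum_of_even f hev, hpar]
      have hzero : wedge (K := K) (P'.map (partialSum f (c - r) (0 + 1))) *
          wedge (K := K) (exitVecs inj ex b w e r) = 0 := by
        refine wedge_mul_exitVecs_eq_zero inj ex b w e r _ (fun v hv => ?_) ?_
        · obtain ⟨s, -, rfl⟩ := List.mem_map.1 hv
          exact ⟨w, _, rfl⟩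
        · rw [List.length_map, hk, startVecs, if_pos hi]
          simp
      have hst : startVecs inj e (r + 1) = e r :: startVecs inj e r := by
        rw [startVecs, if_pos hi]
      rw [hst, List.length_cons] at hk
      rw [hst, hvec, wedge_map_add, add_mul, hzero, zero_add, wedge_cons, ← mul_smul_comm,
        mul_assoc]
      by_cases hnil : P' = []
      · rw [hnil, hl, scanGF_nil w hQ (b r).toNat 0 (by omega) hev ((hcr' _).2 hbr)]
        simp [wedgeDiff]
      · have hpos : 0 < P'.length := List.length_pos_iff.2 hnil
        rw [((scanGF_eq_wedge w (k := P'.length - 1) (f := f) hQ ((hcr' _).2 hbr)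
          (fun P h1 h2 h3 => hA P h1 h2 (by omega)) N _ hl0 (by omega) P' [] hP's hP'a
          List.Pairwise.nil (by simp)).2 (by rwa [hl]) (by simp; omega)), hl]
        simp
    · have hodd : Odd (leftEnd inj r - (c - r)) := by
        rw [hcr]
        unfold leftEnd
        rw [Int.odd_iff]
        split_ifs with h
        · have := h.1
          rw [Nat.even_iff] at this
          omega
        · have : ¬ Even r := fun h' => h ⟨h', hi⟩
          rw [Nat.even_iff] at this
          omega
      have hst : startVecs inj e (r + 1) = startVecs inj e r := by
        rw [startVecs, if_neg hi]
      rw [hst] at hk ⊢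
      have hvec : P'.map (pathVec inj w e (r + 1)) =
          P'.map (partialSum f (c - r) (leftEnd inj r)) := by
        refine List.map_congr_left fun s _ => ?_
        rw [pathVec_succ, if_neg hi, zero_add, ← hpar]
        unfold leftEnd
        split_ifs with h
        · refine partialSum_of_even f ?_
          rw [hcr', Int.even_iff]
          have := h.1
          rw [Nat.even_iff] at this
          omega
        · rfl
      rw [((scanGF_eq_wedge w (k := P'.length) (f := f) hQ ((hcr' _).2 hbr)
        (fun P h1 h2 h3 => hA P h1 h2 (by omega)) N _ hl0 (by omega) P' [] hP's hP'a
        List.Pairwise.nil (by simp)).1 hodd (by simp)), hvec]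
      simp

end Chain

/-! ### Determinants in the exterior algebra -/

section CauchyBinet

open ExteriorAlgebra

variable {K : Type*} [Field K] {V : Type*} [AddCommGroup V] [Module K V]

theorem wedge_ofFn {n : ℕ} (v : Fin n → V) : wedge (K := K) (List.ofFn v) = ιMulti K n v := by
  rw [ιMulti_apply, wedge, List.map_ofFn]
  rfl

/-- The determinant as a linear functional on the exterior algebra of `Fin n → K`. -/
noncomputable def wedgeDet (n : ℕ) : ExteriorAlgebra K (Fin n → K) →ₗ[K] K :=
  liftAlternating (Pi.single n Matrix.detRowAlternating)

theorem wedgeDet_wedge_ofFn {n : ℕ} (v : Fin n → Fin n → K) :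
    wedgeDet n (wedge (List.ofFn v)) = (Matrix.of v).det := by
  rw [wedge_ofFn, wedgeDet, liftAlternating_apply_ιMulti, Pi.single_eq_same]
  rfl

theorem sort_eq_ofFn (S : Finset ℤ) {m : ℕ} (h : S.card = m) :
    S.sort (· ≤ ·) = List.ofFn (S.orderEmbOfFin h) := by
  subst h
  refine List.ext_getElem (by simp) fun i h1 h2 => ?_
  rw [List.getElem_ofFn, Finset.orderEmbOfFin_apply]
  rfl

/-- The Cauchy-Binet formula, in the exterior algebra. -/
theorem wedge_ofFn_sum {m : ℕ} (C : Finset ℤ) (L : ℤ → Fin m → K) (v : ℤ → V) :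
    wedge (K := K) (List.ofFn fun l => ∑ s ∈ C, L s l • v s) =
      ∑ S ∈ C.powersetCard m,
        wedgeDet m (wedge ((S.sort (· ≤ ·)).map L)) • wedge ((S.sort (· ≤ ·)).map v) := by
  classical
  rw [wedge_ofFn]
  have h1 : ιMulti K m (fun l => ∑ s ∈ C, L s l • v s) =
      ∑ r ∈ Fintype.piFinset fun _ : Fin m => C, (∏ l, L (r l) l) • ιMulti K m (fun l => v (r l)) := by
    rw [← AlternatingMap.coe_multilinearMap, MultilinearMap.map_sum_finset]
    refine Finset.sum_congr rfl fun r _ => ?_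
    rw [MultilinearMap.map_smul_univ]
  rw [h1, ← Finset.sum_filter_add_sum_filter_not _ (fun r => Function.Injective r),
    Finset.sum_eq_zero (s := Finset.filter (fun r => ¬ Function.Injective r) _), add_zero]
  swap
  · intro r hr
    have hinj := (Finset.mem_filter.1 hr).2
    rw [ιMulti_eq_zero_of_not_inj, smul_zero]
    exact fun h => hinj (Function.Injective.of_comp (f := v) h)
  rw [← Finset.sum_fiberwise_of_maps_to (t := C.powersetCard m)
    (g := fun r : Fin m → ℤ => Finset.univ.image r)]
  swap
  · intro r hr
    obtain ⟨hr, hinj⟩ := Finset.mem_filter.1 hr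
    rw [Finset.mem_powersetCard, Finset.card_image_of_injective _ hinj, Finset.card_univ,
      Fintype.card_fin]
    refine ⟨fun x hx => ?_, rfl⟩
    obtain ⟨l, -, rfl⟩ := Finset.mem_image.1 hx
    exact Fintype.mem_piFinset.1 hr l
  refine Finset.sum_congr rfl fun S hS => ?_
  obtain ⟨hSC, hcard⟩ := Finset.mem_powersetCard.1 hS
  rw [sort_eq_ofFn S hcard, List.map_ofFn, List.map_ofFn, wedgeDet_wedge_ofFn, Matrix.det_apply,
    Finset.sum_smul]
  set φ := S.orderEmbOfFin hcard with hφ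
  have hφS : Finset.univ.image φ = S := by
    rw [hφ, ← Finset.coe_inj, Finset.coe_image, Finset.coe_univ, Set.image_univ,
      Finset.range_orderEmbOfFin]
  symm
  refine Finset.sum_bij (fun σ _ l => φ (σ l)) ?_ ?_ ?_ ?_
  · intro σ _
    rw [Finset.mem_filter, Finset.mem_filter, Fintype.mem_piFinset]
    refine ⟨⟨fun l => hSC (Finset.orderEmbOfFin_mem S hcard _), φ.injective.comp σ.injective⟩, ?_⟩
    rw [← hφS]
    ext x
    simp only [Finset.mem_image, Finset.mem_univ, true_and]
    exact ⟨fun ⟨l, h⟩ => ⟨σ l, h⟩, fun ⟨l, h⟩ => ⟨σ.symm l, by simpa using h⟩⟩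
  · intro σ _ τ _ h
    ext l
    exact congrArg Fin.val (φ.injective (congrFun h l))
  · intro r hr
    obtain ⟨hr, hrS⟩ := Finset.mem_filter.1 hr
    obtain ⟨-, hinj⟩ := Finset.mem_filter.1 hr
    have : ∀ l, ∃ b, φ b = r l := fun l => by
      have : r l ∈ Finset.univ.image φ := by
        rw [hφS, ← hrS]
        exact Finset.mem_image_of_mem _ (Finset.mem_univ _)
      simpa using this
    choose σ hσ using this
    have hσinj : Function.Injective σ := fun a b h => hinj (by rw [← hσ, ← hσ, h])
    exact ⟨Equiv.ofBijective σ (Finite.injective_iff_bijective.1 hσinj), Finset.mem_univ _,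
      funext hσ⟩
  · intro σ _
    rw [wedge_ofFn]
    have := (ιMulti K m).map_perm (v ∘ φ) σ
    have h2 : (fun l => v (φ (σ l))) = (v ∘ φ) ∘ σ := rfl
    rw [h2, this, smul_comm, smul_assoc]
    rfl

end CauchyBinet

/-! ### Symmetric `q`-integers -/

section QSin

variable {K : Type*} [Field K]

open Classical in
/-- The symmetric `q`-integer `(q ^ k - q ^ (-k)) / (q - q⁻¹)`, or its limit if `q ^ 2 = 1`. -/
noncomputable def qs (q : K) (k : ℤ) : K :=
  if q ^ 2 = 1 then k * q ^ (k - 1) else (q ^ k - q ^ (-k)) / (q - q⁻¹)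

variable {q : K}

theorem sub_inv_ne_zero (hq : q ≠ 0) (h : q ^ 2 ≠ 1) : q - q⁻¹ ≠ 0 := by
  intro h'
  apply h
  field_simp at h'
  linear_combination h'

@[simp] theorem qs_zero : qs q 0 = 0 := by
  unfold qs
  split_ifs <;> simp

theorem qs_neg (hq : q ≠ 0) (a : ℤ) : qs q (-a) = -qs q a := by
  unfold qs
  split_ifs with h
  · have h1 : q ^ (-a - 1) = q ^ (a - 1) := by
      have h2 : q ^ (a * 2) = 1 := by
        rw [mul_comm, zpow_mul, zpow_ofNat, h, one_zpow]
      have : a - 1 = (-a - 1) + a * 2 := by ring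
      rw [this, zpow_add₀ hq, h2, mul_one]
    rw [h1]
    push_cast
    ring
  · rw [neg_neg]
    ring

theorem qs_add (hq : q ≠ 0) (a b : ℤ) : qs q (a + b) = q ^ b * qs q a + q ^ (-a) * qs q b := by
  unfold qs
  split_ifs with h
  · have h1 : q ^ (-a + (b - 1)) = q ^ (a + b - 1) := by
      have h2 : q ^ (a * 2) = 1 := by
        rw [mul_comm, zpow_mul, zpow_ofNat, h, one_zpow]
      have : a + b - 1 = (-a + (b - 1)) + a * 2 := by ring
      rw [this, zpow_add₀ hq (-a + (b - 1)), h2, mul_one]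
    have h3 : q ^ b * ((a : K) * q ^ (a - 1)) = a * q ^ (a + b - 1) := by
      rw [mul_left_comm, ← zpow_add₀ hq]
      congr 2
      ring
    have h4 : q ^ (-a) * ((b : K) * q ^ (b - 1)) = b * q ^ (a + b - 1) := by
      rw [mul_left_comm, ← zpow_add₀ hq, h1]
    rw [h3, h4]
    push_cast
    ring
  · have h' := sub_inv_ne_zero hq h
    rw [neg_add, zpow_add₀ hq, zpow_add₀ hq]
    field_simp
    ring

theorem qs_one (hq : q ≠ 0) : qs q 1 = 1 := by
  unfold qs
  split_ifs with h
  · simp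
  · rw [zpow_one, zpow_neg, zpow_one, div_self (sub_inv_ne_zero hq h)]

theorem zpow_mul_qs_natCast (hq : q ≠ 0) (k : ℕ) : q ^ (k - 1 : ℤ) * qs q k = qInt (q ^ 2) k := by
  induction k with
  | zero => simp [qInt]
  | succ k ih =>
    have h : qInt (q ^ 2) (k + 1) = qInt (q ^ 2) k + (q ^ 2) ^ k := by
      rw [qInt, Finset.sum_range_succ, qInt]
    rw [h, ← ih, Nat.cast_succ, add_comm (k : ℤ) 1, qs_add hq, qs_one hq,
      show (1 + k - 1 : ℤ) = (k - 1) + 1 by ring, zpow_add₀ hq]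
    have e1 : (q ^ 2) ^ k = q ^ (k - 1 : ℤ) * q * q ^ (k : ℤ) := by
      rw [zpow_sub_one₀ hq, zpow_natCast]
      field_simp
      ring
    rw [e1]
    simp only [zpow_one, zpow_neg]
    field_simp
    ring

theorem qs_natCast (hq : q ≠ 0) (k : ℕ) : qInt (q ^ 2) k = q ^ (k - 1 : ℤ) * qs q k :=
  (zpow_mul_qs_natCast hq k).symm

theorem qs_ne_zero (hq : q ≠ 0) (hqInt : ∀ k : ℕ, 1 ≤ k → qInt (q ^ 2) k ≠ 0) {a : ℤ}
    (ha : a ≠ 0) : qs q a ≠ 0 := by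
  obtain ⟨k, rfl | rfl⟩ := Int.eq_nat_or_neg a
  · intro h
    refine hqInt k (by omega) ?_
    rw [qs_natCast hq, h, mul_zero]
  · rw [qs_neg hq, neg_ne_zero]
    intro h
    refine hqInt k (by omega) ?_
    rw [qs_natCast hq, h, mul_zero]

theorem qs_sub (hq : q ≠ 0) (a b : ℤ) : qs q (a - b) = q ^ (-b) * qs q a - q ^ (-a) * qs q b := by
  rw [sub_eq_add_neg, qs_add hq, qs_neg hq]
  ring

theorem qs_mul_q_sub (hq : q ≠ 0) (a : ℤ) : (q - q⁻¹) * qs q a = q ^ a - q ^ (-a) := by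
  unfold qs
  split_ifs with h
  · have h1 : q = q⁻¹ := by
      field_simp
      exact h
    rw [zpow_neg, ← inv_zpow, ← h1]
    simp
  · field_simp [sub_inv_ne_zero hq h]

theorem qs_two_mul (hq : q ≠ 0) (a : ℤ) : qs q (2 * a) = (q ^ a + q ^ (-a)) * qs q a := by
  rw [two_mul, qs_add hq]
  ring

theorem qs_add_sub_qs_sub (hq : q ≠ 0) (a r : ℤ) :
    qs q (a + r) - qs q (a - r) = (q ^ a + q ^ (-a)) * qs q r := by
  have h := qs_add hq r a
  rw [add_comm] at h
  have h2 := qs_sub hq r a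
  rw [← neg_sub, qs_neg hq] at h2
  rw [h]
  linear_combination h2

theorem qs_mul_sub_qs_mul (hq : q ≠ 0) (a b c : ℤ) :
    qs q (a + b) * qs q (a + c) - qs q (a - b) * qs q (a - c) = qs q (2 * a) * qs q (b + c) := by
  rw [qs_two_mul hq, qs_add hq a b, qs_add hq a c, qs_sub hq a b, qs_sub hq a c, qs_add hq b c]
  have ha := qs_mul_q_sub hq a
  have hb := qs_mul_q_sub hq b
  have hc := qs_mul_q_sub hq c
  linear_combination qs q a * (qs q a * (-(q ^ c * hb + q ^ (-b) * hc)) +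
    qs q c * (-(q ^ (-a) * hb - q ^ (-b) * ha)) + qs q b * (q ^ c * ha + q ^ (-a) * hc))

end QSin

/-! ### A determinant of Cauchy-Vandermonde type -/

section Determinant

variable {K : Type*} [Field K] {q : K}

/-- The functions on the integers that are homogeneous polynomials of degree `n - 1` in `qs q a`
and `q ^ (-a)`. -/
noncomputable def symSpan (q : K) (n : ℕ) : Submodule K (ℤ → K) :=
  Submodule.span K (Set.range fun j : Fin n => fun a : ℤ =>
    qs q a ^ (j : ℕ) * (q ^ (-a)) ^ (j.rev : ℕ))

theorem one_mem_symSpan : (fun _ => 1 : ℤ → K) ∈ symSpan q 1 :=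
  Submodule.subset_span ⟨0, by simp⟩

theorem linear_mul_mem_symSpan (u t : K) {n : ℕ} {φ : ℤ → K} (hφ : φ ∈ symSpan q n) :
    (fun a => (u * qs q a + t * q ^ (-a)) * φ a) ∈ symSpan q (n + 1) := by
  have h : symSpan q n ≤ (symSpan q (n + 1)).comap
      (LinearMap.mulLeft K (fun a => u * qs q a + t * q ^ (-a))) := by
    refine Submodule.span_le.2 ?_
    rintro _ ⟨j, rfl⟩
    have e : LinearMap.mulLeft K (fun a => u * qs q a + t * q ^ (-a))
        (fun a : ℤ => qs q a ^ (j : ℕ) * (q ^ (-a)) ^ (j.rev : ℕ)) =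
        u • (fun a : ℤ => qs q a ^ (j.succ : ℕ) * (q ^ (-a)) ^ (j.succ.rev : ℕ)) +
        t • (fun a : ℤ => qs q a ^ (j.castSucc : ℕ) * (q ^ (-a)) ^ (j.castSucc.rev : ℕ)) := by
      funext a
      have h1 : (j.succ.rev : ℕ) = j.rev := by simp [Fin.val_rev]
      have h2 : (j.castSucc.rev : ℕ) = j.rev + 1 := by
        simp only [Fin.val_rev, Fin.val_castSucc]
        omega
      simp only [LinearMap.mulLeft_apply, Pi.mul_apply, Pi.add_apply, Pi.smul_apply, smul_eq_mul,
        h1, h2, Fin.val_succ, Fin.val_castSucc]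
      ring
    rw [SetLike.mem_coe, Submodule.mem_comap, e]
    exact Submodule.add_mem _ (Submodule.smul_mem _ _ (Submodule.subset_span ⟨_, rfl⟩))
      (Submodule.smul_mem _ _ (Submodule.subset_span ⟨_, rfl⟩))
  exact h hφ

theorem prod_mul_mem_symSpan {ι : Type*} (s : Finset ι) (g : ι → ℤ → K)
    (hg : ∀ i, ∃ u t : K, ∀ a, g i a = u * qs q a + t * q ^ (-a)) {n N : ℕ} {φ : ℤ → K}
    (hφ : φ ∈ symSpan q n) (hN : n + s.card = N) :
    (fun a => (∏ i ∈ s, g i a) * φ a) ∈ symSpan q N := by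
  classical
  induction s using Finset.induction_on generalizing N with
  | empty =>
    obtain rfl : n = N := by simpa using hN
    simpa using hφ
  | insert i s his ih =>
    rw [Finset.card_insert_of_notMem his] at hN
    obtain ⟨u, t, h⟩ := hg i
    have := linear_mul_mem_symSpan u t (ih (N := N - 1) (by omega))
    rw [show N - 1 + 1 = N by omega] at this
    convert this using 2 with a
    rw [Finset.prod_insert his, h, mul_assoc]

theorem exists_linear_qs_sub (hq : q ≠ 0) (α : ℤ) :
    ∃ u t : K, ∀ a, qs q (a - α) = u * qs q a + t * q ^ (-a) :=
  ⟨q ^ (-α), -qs q α, fun a => by rw [qs_sub hq]; ring⟩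

theorem exists_linear_sub_qs (hq : q ≠ 0) (γ : ℤ) :
    ∃ u t : K, ∀ a, qs q (γ - a) = u * qs q a + t * q ^ (-a) :=
  ⟨-q ^ (-γ), qs q γ, fun a => by rw [qs_sub hq]; ring⟩

theorem exists_linear_qs_add (hq : q ≠ 0) (b : ℤ) :
    ∃ u t : K, ∀ a, qs q (a + b) = u * qs q a + t * q ^ (-a) :=
  ⟨q ^ b, qs q b, fun a => by rw [qs_add hq]; ring⟩

/-- The analogue of the Vandermonde product. -/
noncomputable def pairProd (q : K) {n : ℕ} (a : Fin n → ℤ) : K :=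
  ∏ i, ∏ j ∈ Finset.Ioi i, qs q (a j - a i)

theorem exists_det_eq_mul_pairProd (hq : q ≠ 0) {n : ℕ} (φ : Fin n → ℤ → K)
    (hφ : ∀ c, φ c ∈ symSpan q n) :
    ∃ Γ : K, ∀ a : Fin n → ℤ, (Matrix.of fun i c => φ c (a i)).det = Γ * pairProd q a := by
  have : ∀ c, ∃ d : Fin n → K, ∑ j, d j • (fun a : ℤ =>
      qs q a ^ (j : ℕ) * (q ^ (-a)) ^ (j.rev : ℕ)) = φ c := fun c =>
    (Submodule.mem_span_range_iff_exists_fun K).1 (hφ c)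
  choose d hd using this
  refine ⟨(Matrix.of fun j c => d c j).det, fun a => ?_⟩
  have hM : (Matrix.of fun i c => φ c (a i)) =
      Matrix.projVandermonde (fun i => qs q (a i)) (fun i => q ^ (-a i)) *
        Matrix.of fun j c => d c j := by
    ext i c
    rw [Matrix.mul_apply, Matrix.of_apply, ← hd c, Finset.sum_apply]
    refine Finset.sum_congr rfl fun j _ => ?_
    simp only [Pi.smul_apply, smul_eq_mul, Matrix.projVandermonde_apply, Matrix.of_apply]
    ring
  rw [hM, Matrix.det_mul, Matrix.det_projVandermonde, mul_comm, pairProd]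
  congr 1
  refine Finset.prod_congr rfl fun i _ => Finset.prod_congr rfl fun j _ => ?_
  rw [qs_sub hq]
  ring

theorem prod_Ioi_add {m k : ℕ} (F : Fin (m + k) → Fin (m + k) → K) :
    ∏ i, ∏ j ∈ Finset.Ioi i, F i j =
      (∏ l : Fin m, ∏ l' ∈ Finset.Ioi l, F (l.castAdd k) (l'.castAdd k)) *
      (∏ l : Fin m, ∏ c : Fin k, F (l.castAdd k) (c.natAdd m)) *
      ∏ c : Fin k, ∏ c' ∈ Finset.Ioi c, F (c.natAdd m) (c'.natAdd m) := by
  have h : ∀ {n : ℕ} (G : Fin n → Fin n → K), ∏ i, ∏ j ∈ Finset.Ioi i, G i j =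
      ∏ i, ∏ j, if i < j then G i j else 1 := fun G => by
    refine Finset.prod_congr rfl fun i _ => ?_
    rw [← Finset.prod_filter]
    congr 1
    ext j
    simp
  rw [h, h, h, Fin.prod_univ_add]
  simp only [Fin.prod_univ_add, Finset.prod_mul_distrib]
  have h1 : ∀ (l : Fin m) (c : Fin k), l.castAdd k < c.natAdd m := fun l c => by
    rw [Fin.lt_def, Fin.val_castAdd, Fin.val_natAdd]
    omega
  have h2 : ∀ (l : Fin m) (c : Fin k), ¬ c.natAdd m < l.castAdd k := fun l c => (h1 l c).le.not_gt
  have h3 : ∀ l l' : Fin m, l.castAdd k < l'.castAdd k ↔ l < l' := fun l l' => Iff.rfl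
  have h4 : ∀ c c' : Fin k, c.natAdd m < c'.natAdd m ↔ c < c' := fun c c' => by
    rw [Fin.lt_def, Fin.lt_def, Fin.val_natAdd, Fin.val_natAdd]
    omega
  simp only [h1, h2, h3, h4, if_true, if_false, Finset.prod_const_one, one_mul]

theorem prod_prod_erase {m : ℕ} (F : Fin m → Fin m → K) :
    ∏ l, ∏ l' ∈ Finset.univ.erase l, F l l' =
      (∏ l, ∏ l' ∈ Finset.Ioi l, F l l') * ∏ l, ∏ l' ∈ Finset.Ioi l, F l' l := by
  have h1 : ∏ l, ∏ l' ∈ Finset.Ioi l, F l' l = ∏ l, ∏ l' ∈ Finset.Iio l, F l l' := by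
    refine Finset.prod_comm' ?_
    simp
  rw [h1, ← Finset.prod_mul_distrib]
  refine Finset.prod_congr rfl fun l _ => ?_
  rw [← Finset.prod_union]
  · congr 1
    ext x
    simp only [Finset.mem_erase, Finset.mem_univ, and_true, Finset.mem_union, Finset.mem_Ioi,
      Finset.mem_Iio]
    rw [or_comm, ← ne_iff_lt_or_gt]
  · rw [Finset.disjoint_left]
    intro x
    simp only [Finset.mem_Ioi, Finset.mem_Iio]
    exact fun h h' => lt_asymm h h'

/-- A mixture of the Cauchy determinant and Krattenthaler's determinant. -/
theorem det_cauchy_append (hq : q ≠ 0) (hqs : ∀ a : ℤ, a ≠ 0 → qs q a ≠ 0) {m k : ℕ}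
    (a : Fin (m + k) → ℤ) (b : Fin m → ℤ) (α γ : Fin k → ℤ) (hb : Function.Injective b)
    (hα : Function.Injective α) (hbα : ∀ l c, b l + α c ≠ 0) (hab : ∀ i l, a i + b l ≠ 0) :
    (Matrix.of fun i => Fin.append
      (fun l => (∏ t, qs q (γ t - a i)) / qs q (a i + b l))
      (fun c => (∏ t ∈ Finset.Iio c, qs q (a i - α t)) *
        ∏ t ∈ Finset.Ioi c, qs q (γ t - a i))).det =
    (∏ l, ∏ t, qs q (γ t + b l)) * pairProd q a * pairProd q b *
      (∏ c, ∏ t ∈ Finset.Ioi c, qs q (γ t - α c)) / ∏ i, ∏ l, qs q (a i + b l) := by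
  set φ : Fin (m + k) → ℤ → K := Fin.append
    (fun l a => (∏ t, qs q (γ t - a)) * ∏ l' ∈ Finset.univ.erase l, qs q (a + b l'))
    (fun c a => (∏ t ∈ Finset.Iio c, qs q (a - α t)) * ((∏ t ∈ Finset.Ioi c, qs q (γ t - a)) *
      ∏ l, qs q (a + b l))) with hφ
  have hmem : ∀ c, φ c ∈ symSpan q (m + k) := by
    intro c
    refine Fin.addCases (fun l => ?_) (fun c => ?_) c
    · rw [hφ, Fin.append_left]
      refine prod_mul_mem_symSpan _ (fun t a => qs q (γ t - a))
        (fun t => exists_linear_sub_qs hq _) (n := m) ?_ (by simp)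
      have := prod_mul_mem_symSpan (N := m) (Finset.univ.erase l) (fun l' a => qs q (a + b l'))
        (fun l' => exists_linear_qs_add hq _) one_mem_symSpan (by
          rw [Finset.card_erase_of_mem (Finset.mem_univ _), Finset.card_univ, Fintype.card_fin]
          have := l.2
          omega)
      simpa using this
    · rw [hφ, Fin.append_right]
      refine prod_mul_mem_symSpan _ (fun t a => qs q (a - α t))
        (fun t => exists_linear_qs_sub hq _) (n := m + k - c) ?_ (by
          have := c.2
          rw [Fin.card_Iio]
          omega)
      refine prod_mul_mem_symSpan _ (fun t a => qs q (γ t - a))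
        (fun t => exists_linear_sub_qs hq _) (n := m + 1) ?_ (by
          have := c.2
          rw [Fin.card_Ioi]
          omega)
      have := prod_mul_mem_symSpan (N := m + 1) Finset.univ (fun l' a => qs q (a + b l'))
        (fun l' => exists_linear_qs_add hq _) one_mem_symSpan (by
          rw [Finset.card_univ, Fintype.card_fin]
          omega)
      simpa using this
  obtain ⟨Γ, hΓ⟩ := exists_det_eq_mul_pairProd hq φ hmem
  -- the determinant in question
  have hmain : (Matrix.of fun i c => φ c (a i)).det = (∏ i, ∏ l, qs q (a i + b l)) *
      (Matrix.of fun i => Fin.append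
        (fun l => (∏ t, qs q (γ t - a i)) / qs q (a i + b l))
        (fun c => (∏ t ∈ Finset.Iio c, qs q (a i - α t)) *
          ∏ t ∈ Finset.Ioi c, qs q (γ t - a i))).det := by
    rw [← Matrix.det_mul_column]
    congr 1
    ext i c
    rw [Matrix.of_apply, Matrix.of_apply, Matrix.of_apply, hφ]
    refine Fin.addCases (fun l => ?_) (fun c => ?_) c
    · rw [Fin.append_left, Fin.append_left, ← Finset.mul_prod_erase _ _ (Finset.mem_univ l)]
      field_simp [hqs _ (hab i l)]
    · rw [Fin.append_right, Fin.append_right]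
      ring
  -- evaluation at special points
  set x : Fin (m + k) → ℤ := Fin.append (fun l => -b l) α with hx
  have hspecial : (Matrix.of fun i c => φ c (x i)).det =
      (∏ l, (∏ t, qs q (γ t + b l)) * ∏ l' ∈ Finset.univ.erase l, qs q (b l' - b l)) *
      ∏ c, (∏ t ∈ Finset.Iio c, qs q (α c - α t)) * ((∏ t ∈ Finset.Ioi c, qs q (γ t - α c)) *
        ∏ l, qs q (α c + b l)) := by
    rw [← Matrix.det_reindex_self finSumFinEquiv.symm, ← Matrix.fromBlocks_toBlocks
      (Matrix.reindex finSumFinEquiv.symm finSumFinEquiv.symm _)]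
    set M := Matrix.reindex finSumFinEquiv.symm finSumFinEquiv.symm
      (Matrix.of fun i c => φ c (x i)) with hM
    have h11 : M.toBlocks₁₁ = Matrix.diagonal fun l => (∏ t, qs q (γ t + b l)) *
        ∏ l' ∈ Finset.univ.erase l, qs q (b l' - b l) := by
      ext l l'
      simp only [Matrix.toBlocks₁₁, hM, Matrix.of_apply, Matrix.reindex_apply,
        Matrix.submatrix_apply, Equiv.symm_symm, finSumFinEquiv_apply_left, hφ, hx,
        Fin.append_left]
      by_cases h : l = l'
      · subst h
        rw [Matrix.diagonal_apply_eq]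
        congr 1 <;> refine Finset.prod_congr rfl fun t _ => congrArg _ (by ring)
      · rw [Matrix.diagonal_apply_ne _ h, Finset.prod_eq_zero (i := l) (s := Finset.univ.erase l')
          (by simpa using h) (by simp), mul_zero]
    have h12 : M.toBlocks₁₂ = 0 := by
      ext l c
      simp only [Matrix.toBlocks₁₂, hM, Matrix.of_apply, Matrix.reindex_apply,
        Matrix.submatrix_apply, Equiv.symm_symm, finSumFinEquiv_apply_left,
        finSumFinEquiv_apply_right, hφ, hx, Fin.append_left, Fin.append_right]
      rw [Finset.prod_eq_zero (i := l) (s := Finset.univ) (Finset.mem_univ _) (by simp), mul_zero,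
        mul_zero, Matrix.zero_apply]
    have h22 : M.toBlocks₂₂.IsLowerTriangular := by
      intro c c' h
      simp only [Matrix.toBlocks₂₂, hM, Matrix.of_apply, Matrix.reindex_apply,
        Matrix.submatrix_apply, Equiv.symm_symm, finSumFinEquiv_apply_right, hφ, hx,
        Fin.append_right]
      rw [Finset.prod_eq_zero (i := c) (s := Finset.Iio c') (by simpa using h) (by simp), zero_mul]
    rw [h12, Matrix.det_fromBlocks_zero₁₂, h11, Matrix.det_diagonal,
      Matrix.det_of_isLowerTriangular _ h22]
    congr 1
    refine Finset.prod_congr rfl fun c _ => ?_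
    simp only [Matrix.toBlocks₂₂, hM, Matrix.of_apply, Matrix.reindex_apply,
      Matrix.submatrix_apply, Equiv.symm_symm, finSumFinEquiv_apply_right, hφ, hx,
      Fin.append_right]
  have hpair : pairProd q x = (∏ l, ∏ l' ∈ Finset.Ioi l, qs q (b l - b l')) *
      (∏ l, ∏ c, qs q (α c + b l)) * ∏ c, ∏ c' ∈ Finset.Ioi c, qs q (α c' - α c) := by
    rw [pairProd, prod_Ioi_add, hx]
    simp only [Fin.append_left, Fin.append_right]
    congr 2 <;> refine Finset.prod_congr rfl fun l _ => Finset.prod_congr rfl fun l' _ =>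
      congrArg _ (by ring)
  have hne1 : ∏ l, ∏ l' ∈ Finset.Ioi l, qs q (b l - b l') ≠ 0 :=
    Finset.prod_ne_zero_iff.2 fun l _ => Finset.prod_ne_zero_iff.2 fun l' hl' =>
      hqs _ (sub_ne_zero.2 fun h => by simp [hb h] at hl')
  have hne2 : ∏ l, ∏ c, qs q (α c + b l) ≠ 0 :=
    Finset.prod_ne_zero_iff.2 fun l _ => Finset.prod_ne_zero_iff.2 fun c _ =>
      hqs _ (by rw [add_comm]; exact hbα l c)
  have hne3 : ∏ c, ∏ c' ∈ Finset.Ioi c, qs q (α c' - α c) ≠ 0 :=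
    Finset.prod_ne_zero_iff.2 fun l _ => Finset.prod_ne_zero_iff.2 fun l' hl' =>
      hqs _ (sub_ne_zero.2 fun h => by simp [hα h] at hl')
  have hne4 : ∏ i, ∏ l, qs q (a i + b l) ≠ 0 :=
    Finset.prod_ne_zero_iff.2 fun i _ => Finset.prod_ne_zero_iff.2 fun l _ => hqs _ (hab i l)
  have hΓval : Γ = (∏ l, ∏ t, qs q (γ t + b l)) * pairProd q b *
      ∏ c, ∏ t ∈ Finset.Ioi c, qs q (γ t - α c) := by
    have h1 := hΓ x
    rw [hspecial, hpair] at h1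
    simp only [Finset.prod_mul_distrib] at h1
    rw [prod_prod_erase] at h1
    have h2 : ∏ c, ∏ t ∈ Finset.Iio c, qs q (α c - α t) =
        ∏ c, ∏ c' ∈ Finset.Ioi c, qs q (α c' - α c) := by
      refine Finset.prod_comm' ?_
      simp
    have h3 : ∏ c, ∏ l, qs q (α c + b l) = ∏ l, ∏ c, qs q (α c + b l) := Finset.prod_comm
    rw [h2, h3] at h1
    refine mul_right_cancel₀ (mul_ne_zero (mul_ne_zero hne1 hne2) hne3) ?_
    rw [← h1, pairProd]
    ring
  rw [eq_div_iff hne4, mul_comm, ← hmain, hΓ a, hΓval]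
  ring

end Determinant

/-! ### Weighted path counts in closed form -/

section PathFunctions

variable {K : Type*} [Field K] {q : K}

theorem partialSum_add_two {V : Type*} [AddCommGroup V] (f : ℤ → V) {j a s : ℤ}
    (hs : Even (s - j)) (has : a ≤ s + 1) :
    partialSum f j a (s + 2) = partialSum f j a s + f (s + 1) := by
  have : (Finset.Ico a (s + 2)).filter (fun p => Odd (p - j)) =
      insert (s + 1) ((Finset.Ico a s).filter fun p => Odd (p - j)) := by
    ext p
    simp only [Finset.mem_filter, Finset.mem_Ico, Finset.mem_insert, Int.odd_iff, Int.even_iff] at *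
    omega
  rw [partialSum, this, Finset.sum_insert (by simp), partialSum, add_comm]

theorem partialSum_eq_of_step (f G : ℤ → K) (j : ℤ)
    (hstep : ∀ s, -1 ≤ s → Even (s - j) → G (s + 2) = G s + f (s + 1))
    (hbase : ∀ s, s = -1 ∨ s = 0 → Even (s - j) → G s = 0) {s : ℤ} (hs : -1 ≤ s)
    (hsj : Even (s - j)) : partialSum f j 0 s = G s := by
  obtain ⟨N, hN⟩ := Int.eq_ofNat_of_zero_le (show 0 ≤ s + 1 by omega)
  induction N using Nat.twoStepInduction generalizing s with
  | zero =>
    rw [hbase s (by push_cast at hN; omega) hsj, partialSum_of_le f (by push_cast at hN; omega)]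
  | one =>
    rw [hbase s (by push_cast at hN; omega) hsj, partialSum_of_le f (by push_cast at hN; omega)]
  | more N ih _ =>
    push_cast at hN
    have hpar : Even (s - 2 - j) := by
      rw [Int.even_iff] at hsj ⊢
      omega
    have h1 := hstep (s - 2) (by omega) hpar
    have h2 := partialSum_add_two f (a := 0) hpar (by omega)
    rw [sub_add_cancel] at h1 h2
    rw [h2, h1, ih (s := s - 2) (by omega) hpar (by omega)]

/-- The weighted number of paths after `i` steps. -/
noncomputable def pathFun (w : ℤ → K) : ℕ → ℤ → K
  | 0 => fun _ => 1
  | i + 1 => fun s => partialSum (fun p => w p * pathFun w i p) (i + 1 : ℕ) 0 s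

theorem pathFun_succ (w : ℤ → K) (i : ℕ) (s : ℤ) : pathFun w (i + 1) s =
    partialSum (fun p => w p * pathFun w i p) (i + 1 : ℕ) 0 s := rfl

/-- The product of `k` symmetric `q`-integers in steps of two, centred at `s`. -/
noncomputable def qsProd (q : K) (k : ℕ) (s : ℤ) : K :=
  ∏ t ∈ Finset.range k, qs q (s - (k - 1) + 2 * t)

theorem qsProd_succ_add_one (k : ℕ) (s : ℤ) :
    qsProd q (k + 1) (s + 1) = qsProd q k s * qs q (s + (k + 1)) := by
  rw [qsProd, Finset.prod_range_succ, qsProd]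
  congr 1
  · refine Finset.prod_congr rfl fun t _ => congrArg _ ?_
    push_cast
    ring
  · congr 1
    push_cast
    ring

theorem qsProd_succ_sub_one (k : ℕ) (s : ℤ) :
    qsProd q (k + 1) (s - 1) = qs q (s - (k + 1)) * qsProd q k s := by
  rw [qsProd, Finset.prod_range_succ', qsProd, mul_comm]
  congr 1
  · congr 1
    push_cast
    ring
  · refine Finset.prod_congr rfl fun t _ => congrArg _ ?_
    push_cast
    ring

theorem qsProd_eq_zero {k : ℕ} {s : ℤ} (t : ℕ) (ht : t < k) (h : s - (k - 1) + 2 * t = 0) :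
    qsProd q k s = 0 :=
  Finset.prod_eq_zero (Finset.mem_range.2 ht) (by rw [h, qs_zero])

/-- The normalization `∏_{t ≤ r} (2 [t])⁻¹`. -/
noncomputable def qsInvFact (q : K) (r : ℕ) : K :=
  ∏ t ∈ Finset.range r, (2 * qs q (t + 1))⁻¹

theorem qsInvFact_succ (r : ℕ) :
    qsInvFact q (r + 1) = qsInvFact q r * (2 * qs q (r + 1))⁻¹ := by
  rw [qsInvFact, Finset.prod_range_succ, qsInvFact]

/-- The weight of vertical lozenges. -/
noncomputable def wtFun (q : K) (i : ℤ) : K :=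
  if i = 0 then 1 / 2 else (q ^ i + q ^ (-i)) / 2

theorem two_mul_wtFun_mul_qs (h2 : (2 : K) ≠ 0) (hq : q ≠ 0) (a : ℤ) :
    2 * wtFun q a * qs q a = qs q (2 * a) := by
  unfold wtFun
  split_ifs with h
  · simp [h]
  · rw [qs_two_mul hq]
    field_simp

theorem pathFun_wtFun (h2 : (2 : K) ≠ 0) (hq : q ≠ 0) (hqs : ∀ a : ℤ, a ≠ 0 → qs q a ≠ 0) (i : ℕ)
    {s : ℤ} (hs : 0 ≤ s) (hsi : Even (s - (i + 1 : ℕ))) :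
    pathFun (wtFun q) (i + 1) s = qsInvFact q (i + 1) * qs q s * qsProd q i s := by
  induction i generalizing s with
  | zero =>
    rw [pathFun_succ, partialSum_eq_of_step _ (fun s => if s ≤ 0 then 0 else qs q s / 2) _ _ _
      (by omega) hsi]
    · have : ¬ s ≤ 0 := by
        rw [Int.even_iff] at hsi
        push_cast at hsi
        omega
      simp only [this, if_false, qsInvFact, qsProd, Finset.prod_range_succ, Finset.prod_range_zero]
      simp only [Nat.cast_zero, zero_add, qs_one hq]
      field_simp
    · intro s hs _
      simp only [pathFun, mul_one]
      rcases lt_or_eq_of_le hs with hs' | rfl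
      · by_cases h0 : s = 0
        · subst h0
          simp at *
        · rw [if_neg (by omega), if_neg (by omega), wtFun, if_neg (by omega)]
          have h3 := qs_add_sub_qs_sub hq (s + 1) 1
          rw [qs_one hq, mul_one, show s + 1 + 1 = s + 2 by ring, add_sub_cancel_right] at h3
          linear_combination h3 / 2
      · norm_num [wtFun, qs_one hq]
    · intro s hs _
      rw [if_pos (by omega)]
  | succ i ih =>
    rw [pathFun_succ, partialSum_eq_of_step _
      (fun s => qsInvFact q (i + 2) * qs q s * qsProd q (i + 1) s) _ _ _ (by omega) hsi]
    · intro s hs hsi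
      have hpar : Even (s + 1 - (i + 1 : ℕ)) := by
        rw [Int.even_iff] at hsi ⊢
        push_cast at *
        omega
      rw [ih (by omega) hpar, qsInvFact_succ (i + 1)]
      have e1 : qsProd q (i + 1) (s + 2) = qsProd q i (s + 1) * qs q (s + 1 + (i + 1)) := by
        rw [← qsProd_succ_add_one]
        congr 1
        ring
      have e2 : qsProd q (i + 1) s = qs q (s + 1 - (i + 1)) * qsProd q i (s + 1) := by
        rw [← qsProd_succ_sub_one]
        congr 1
        ring
      have h3 := qs_mul_sub_qs_mul hq (s + 1) 1 (i + 1)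
      have h4 := two_mul_wtFun_mul_qs h2 hq (s + 1)
      have h5 : qs q ((i + 1 : ℕ) + 1) ≠ 0 := hqs _ (by positivity)
      have h6 : qs q (1 + (i + 1 : ℤ)) = qs q ((i + 1 : ℕ) + 1) := by
        congr 1
        push_cast
        ring
      rw [h6, ← h4, show s + 1 + 1 = s + 2 by ring, add_sub_cancel_right] at h3
      rw [e1, e2]
      field_simp
      linear_combination (qsInvFact q (i + 1) * qsProd q i (s + 1)) * h3
    · rintro s (rfl | rfl) hsi
      · rw [Int.even_iff] at hsi
        push_cast at hsi
        rw [qsProd_eq_zero ((i + 1) / 2) (by omega) (by push_cast; omega), mul_zero]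
      · simp

theorem pathFun_wtFun_shift (h2 : (2 : K) ≠ 0) (hq : q ≠ 0) (hqs : ∀ a : ℤ, a ≠ 0 → qs q a ≠ 0)
    (i : ℕ) {s : ℤ} (hs : 0 ≤ s) (hsi : Even (s - i)) :
    pathFun (fun p => wtFun q (p + 1)) i s = qsInvFact q i * qsProd q i (s + 1) := by
  induction i generalizing s with
  | zero => simp [pathFun, qsInvFact, qsProd]
  | succ i ih =>
    rw [pathFun_succ, partialSum_eq_of_step _
      (fun s => qsInvFact q (i + 1) * qsProd q (i + 1) (s + 1)) _ _ _ (by omega) hsi]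
    · intro s hs hsi
      have hpar : Even (s + 1 - i) := by
        rw [Int.even_iff] at hsi ⊢
        push_cast at *
        omega
      rw [ih (by omega) hpar, qsInvFact_succ, wtFun, if_neg (by omega),
        show s + 2 + 1 = (s + 2) + 1 by ring, qsProd_succ_add_one,
        show s + 1 + 1 = s + 2 by ring]
      have e2 : qsProd q (i + 1) (s + 1) = qs q (s + 2 - (i + 1)) * qsProd q i (s + 2) := by
        rw [← qsProd_succ_sub_one]
        congr 1
        ring
      have h3 := qs_add_sub_qs_sub hq (s + 2) (i + 1)
      have h5 : qs q ((i : ℤ) + 1) ≠ 0 := hqs _ (by positivity)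
      rw [e2]
      field_simp
      linear_combination (qsInvFact q i * qsProd q i (s + 2)) * h3
    · rintro s (rfl | rfl) hsi
      all_goals
        rw [Int.even_iff] at hsi
        push_cast at hsi
      · rw [qsProd_eq_zero (i / 2) (by omega) (by push_cast; omega), mul_zero]
      · rw [qsProd_eq_zero ((i - 1) / 2) (by omega) (by push_cast; omega), mul_zero]

/-- The summation formula for pairs of paths meeting on a horizontal line. -/
theorem partialSum_pathFun_mul (h2 : (2 : K) ≠ 0) (hq : q ≠ 0)
    (hqs : ∀ a : ℤ, a ≠ 0 → qs q a ≠ 0) (h l : ℕ) {N : ℤ} (hN : 0 ≤ N) (hNe : Even N) :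
    partialSum (fun s => wtFun q s * (pathFun (wtFun q) (2 * (h + 1)) s *
        pathFun (fun p => wtFun q (p + 1)) (2 * l + 1) (s - 1))) 1 0 (N + 1) =
      qsInvFact q (2 * (h + 1)) * qsInvFact q (2 * l + 1) / 2 *
        (qsProd q (2 * (h + 1)) (N + 1) * qsProd q (2 * (l + 1)) (N + 1)) /
          qs q (2 * (h + 1) + 2 * (l + 1)) := by
  have hne : qs q (2 * (h + 1) + 2 * (l + 1) : ℤ) ≠ 0 := hqs _ (by positivity)
  rw [partialSum_eq_of_step _ (fun s => qsInvFact q (2 * (h + 1)) * qsInvFact q (2 * l + 1) / 2 *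
    (qsProd q (2 * (h + 1)) s * qsProd q (2 * (l + 1)) s) /
      qs q (2 * (h + 1) + 2 * (l + 1))) _ _ _ (by omega)
      (by rw [Int.even_iff] at *; omega)]
  · intro s hs hse
    have e1 : pathFun (wtFun q) (2 * (h + 1)) (s + 1) =
        qsInvFact q (2 * (h + 1)) * qs q (s + 1) * qsProd q (2 * h + 1) (s + 1) :=
      pathFun_wtFun h2 hq hqs (2 * h + 1) (by omega) (by
        rw [Int.even_iff] at *; push_cast; omega)
    have e2 : qsProd q (2 * l + 1) (s + 1) = 0 ∨ 0 ≤ s := by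
      rcases lt_or_eq_of_le hs with hs | rfl
      · right
        omega
      · left
        exact qsProd_eq_zero l (by omega) (by push_cast; ring)
    have e3 : qs q (s + 1) * pathFun (fun p => wtFun q (p + 1)) (2 * l + 1) (s + 1 - 1) =
        qs q (s + 1) * (qsInvFact q (2 * l + 1) * qsProd q (2 * l + 1) (s + 1)) := by
      rcases lt_or_eq_of_le hs with hs | rfl
      · rw [add_sub_cancel_right, pathFun_wtFun_shift h2 hq hqs _ (by omega) (by
          rw [Int.even_iff] at *; push_cast; omega)]
      · simp
    have e4 : ∀ j : ℕ, qsProd q (2 * (j + 1)) (s + 2) =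
        qsProd q (2 * j + 1) (s + 1) * qs q (s + 1 + 2 * (j + 1)) := fun j => by
      have := qsProd_succ_add_one (q := q) (2 * j + 1) (s + 1)
      rw [show s + 1 + 1 = s + 2 by ring] at this
      rw [show 2 * (j + 1) = 2 * j + 1 + 1 by ring, this]
      congr 2
    have e5 : ∀ j : ℕ, qsProd q (2 * (j + 1)) s =
        qs q (s + 1 - 2 * (j + 1)) * qsProd q (2 * j + 1) (s + 1) := fun j => by
      have := qsProd_succ_sub_one (q := q) (2 * j + 1) (s + 1)
      rw [add_sub_cancel_right] at this
      rw [show 2 * (j + 1) = 2 * j + 1 + 1 by ring, this]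
      congr 2
    have h3 := qs_mul_sub_qs_mul hq (s + 1) (2 * (h + 1)) (2 * (l + 1))
    rw [← two_mul_wtFun_mul_qs h2 hq] at h3
    rw [e1, e4, e4, e5, e5]
    have e6 : wtFun q (s + 1) * (qsInvFact q (2 * (h + 1)) * qs q (s + 1) *
        qsProd q (2 * h + 1) (s + 1) *
          pathFun (fun p => wtFun q (p + 1)) (2 * l + 1) (s + 1 - 1)) =
        wtFun q (s + 1) * qsInvFact q (2 * (h + 1)) * qsProd q (2 * h + 1) (s + 1) *
          (qs q (s + 1) * (qsInvFact q (2 * l + 1) * qsProd q (2 * l + 1) (s + 1))) := by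
      rw [← e3]
      ring
    rw [e6]
    field_simp
    linear_combination (qsInvFact q (2 * (h + 1)) * qsInvFact q (2 * l + 1) *
      qsProd q (2 * h + 1) (s + 1) * qsProd q (2 * l + 1) (s + 1)) * h3
  · rintro s (rfl | rfl) hs
    · rw [qsProd_eq_zero (k := 2 * (h + 1)) (h + 1) (by omega) (by push_cast; ring)]
      simp
    · rw [Int.even_iff] at hs
      omega

end PathFunctions

/-! ### Chains as determinants of path counts -/

section ChainDet

open ExteriorAlgebra

variable {K : Type*} [Field K]

theorem balance_union {R S : Finset UnitTriangle} (h : Disjoint R S) :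
    balance (R ∪ S) = balance R + balance S := by
  unfold balance
  rw [Finset.sum_union h]

theorem balance_sdiff {R S : Finset UnitTriangle} (h : S ⊆ R) :
    balance (R \ S) = balance R - balance S := by
  unfold balance
  rw [← Finset.sum_sdiff h, add_sub_cancel_right]

theorem balance_of_isUp {S : Finset UnitTriangle} (h : ∀ t ∈ S, IsUp t) : balance S = S.card := by
  unfold balance
  rw [Finset.sum_congr rfl fun t ht => if_pos (h t ht)]
  simp

theorem balance_row (j a : ℤ) (N : ℕ) : balance (Finset.Icc a (a - 1 + N) ×ˢ {j}) =
    (if Even (a - 1 + N - j) then 1 else 0) - (if Even (a - 1 - j) then 1 else 0) := by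
  induction N with
  | zero => simp [balance]
  | succ N ih =>
    have h : Finset.Icc a (a - 1 + (N + 1 : ℕ)) ×ˢ {j} =
        (Finset.Icc a (a - 1 + N) ×ˢ {j}) ∪ {(a - 1 + (N + 1 : ℕ), j)} := by
      ext ⟨p, p'⟩
      simp only [Finset.mem_product, Finset.mem_Icc, Finset.mem_singleton, Finset.mem_union,
        Prod.mk.injEq]
      push_cast
      omega
    rw [h, balance_union, ih]
    · have h1 : balance {(a - 1 + (N + 1 : ℕ), j)} =
          if Even (a - 1 + (N + 1 : ℕ) - j) then 1 else -1 := by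
        simp only [balance, IsUp, Finset.sum_singleton]
        congr
      rw [h1]
      have h2 : Even (a - 1 + (N + 1 : ℕ) - j) ↔ ¬ Even (a - 1 + N - j) := by
        rw [Int.even_iff, Int.even_iff]
        push_cast
        omega
      simp only [h2]
      split_ifs <;> simp
    · rw [Finset.disjoint_singleton_right]
      simp only [Finset.mem_product, Finset.mem_Icc, Finset.mem_singleton]
      push_cast
      omega

section

variable {V : Type*} [AddCommGroup V] [Module K V]
variable (inj ex : ℕ → Prop) [DecidablePred inj] [DecidablePred ex] (b : ℕ → ℤ) (c : ℤ)

theorem balance_chain (hc : Even c) (w : ℤ → K) (e : ℕ → V) (T : ℕ)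
    (hinj : ∀ r, inj r → Even r) (hb : ∀ r < T, Even (b r - r)) (hb0 : ∀ r < T, 0 ≤ b r)
    (hb2 : ∀ r < T, ex r → 1 ≤ b r) :
    balance (chain inj ex b c T) =
      (startVecs inj e T).length - (exitVecs inj ex b w e T).length := by
  induction T with
  | zero => simp [chain, balance, startVecs, exitVecs]
  | succ T ih =>
    have hbT := hb T T.lt_succ_self
    have hbT0 := hb0 T T.lt_succ_self
    specialize ih (fun r hr => hb r (by omega)) (fun r hr => hb0 r (by omega))
      (fun r hr => hb2 r (by omega))
    have hle : leftEnd inj T ≤ b T + 1 := by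
      unfold leftEnd
      split_ifs <;> omega
    obtain ⟨N, hN⟩ := Int.eq_ofNat_of_zero_le (sub_nonneg.2 hle)
    have hrow : balance (Finset.Icc (leftEnd inj T) (b T) ×ˢ {c - T}) = if inj T then 1 else 0 := by
      have := balance_row (c - T) (leftEnd inj T) N
      rw [show leftEnd inj T - 1 + N = b T by omega] at this
      rw [this, if_pos (by rw [Int.even_iff] at *; omega)]
      unfold leftEnd
      by_cases hi : inj T
      · have := hinj T hi
        rw [if_neg (not_and_not_right.2 fun _ => hi), if_neg, if_pos hi, sub_zero]
        rw [Nat.even_iff] at this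
        rw [Int.even_iff] at *
        omega
      · rw [if_neg hi, if_pos, sub_self]
        split_ifs with h
        · have := h.1
          rw [Nat.even_iff] at this
          rw [Int.even_iff] at *
          omega
        · have : ¬ Even T := fun h' => h ⟨h', hi⟩
          rw [Nat.even_iff] at this
          rw [Int.even_iff] at *
          omega
    have hpart : balance (rowPart (c - T) (b T) (leftEnd inj T) (if ex T then [b T] else [])) =
        (if inj T then 1 else 0) - if ex T then 1 else 0 := by
      by_cases h1 : ex T
      · have hsub : ({(b T, c - (T : ℤ))} : Finset UnitTriangle) ⊆
            Finset.Icc (leftEnd inj T) (b T) ×ˢ {c - (T : ℤ)} := by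
          have := hb2 T T.lt_succ_self h1
          have : leftEnd inj T ≤ b T := by
            unfold leftEnd
            split_ifs <;> omega
          simpa using this
        have hrow' : rowPart (c - T) (b T) (leftEnd inj T) [b T] =
            (Finset.Icc (leftEnd inj T) (b T) ×ˢ {c - (T : ℤ)}) \ {(b T, c - (T : ℤ))} := by
          ext ⟨p, p'⟩
          simp only [mem_rowPart, Finset.mem_sdiff, Finset.mem_product, Finset.mem_Icc,
            Finset.mem_singleton, List.mem_singleton, Prod.mk.injEq]
          tauto
        rw [if_pos h1, if_pos h1, hrow', balance_sdiff hsub, hrow, balance_of_isUp (S := {_})]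
        · simp
        · intro t ht
          rw [Finset.mem_singleton.1 ht, IsUp, Int.even_iff]
          rw [Int.even_iff] at hc hbT
          dsimp only
          omega
      · rw [if_neg h1, if_neg h1, sub_zero, ← hrow, rowPart]
        simp
    rw [chain, balance_union, ih, hpart, startVecs, exitVecs]
    · split_ifs <;> simp <;> ring
    · rw [Finset.disjoint_left]
      intro t ht ht'
      have h1 := lt_of_mem_chain _ _ _ ht'
      have h2 := (mem_rowPart.1 ht).2
      omega

theorem gfRemoved_chain_eq_zero (hc : Even c) (w : ℤ → K) (e : ℕ → V) (T : ℕ)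
    (hinj : ∀ r, inj r → Even r) (hb : ∀ r < T, Even (b r - r)) (hb0 : ∀ r < T, 0 ≤ b r)
    (hb2 : ∀ r < T, ex r → 1 ≤ b r) (S : Finset ℤ) (hS : ∀ p ∈ S, Odd (p - T))
    (hcard : S.card + (exitVecs inj ex b w e T).length ≠ (startVecs inj e T).length) :
    gfRemoved w (chain inj ex b c T) (S ×ˢ {c - T + 1}) = 0 := by
  unfold gfRemoved
  split_ifs with h
  · by_contra hne
    have h1 := balance_eq_zero_of_gf_ne_zero w hne
    rw [balance_sdiff h, balance_chain inj ex b c hc w e T hinj hb hb0 hb2,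
      balance_of_isUp (fun t ht => ?_), Finset.card_product, Finset.card_singleton] at h1
    · omega
    · obtain ⟨h2, h3⟩ := Finset.mem_product.1 ht
      have h4 := hS _ h2
      rw [Finset.mem_singleton] at h3
      rw [IsUp, h3, Int.even_iff]
      rw [Int.even_iff] at hc
      rw [Int.odd_iff] at h4
      omega
  · rfl

end

variable {n : ℕ} (ρ : Fin n → ℕ)

/-- The path counts from the starting rows `ρ j`. -/
noncomputable def startFun (w : ℤ → K) (r : ℕ) (s : ℤ) (j : Fin n) : K :=
  if ρ j < r then pathFun w (r - 1 - ρ j) s else 0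

/-- The standard basis vectors attached to the starting rows `ρ j`. -/
def startVec (r : ℕ) (j : Fin n) : K := if ρ j = r then 1 else 0

theorem partialSum_apply (f : ℤ → Fin n → K) (i a s : ℤ) (j : Fin n) :
    partialSum f i a s j = partialSum (fun p => f p j) i a s := by
  simp [partialSum, Finset.sum_apply]

theorem pathVec_eq_startFun (hρ : ∀ j, Even (ρ j)) (w : ℤ → K) (r : ℕ) (s : ℤ) :
    pathVec (fun r => ∃ j, ρ j = r) w (startVec (K := K) ρ) r s = startFun ρ w r s := by
  induction r generalizing s with
  | zero =>
    ext j
    simp [pathVec, startFun]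
  | succ r ih =>
    ext j
    rw [pathVec_succ, Pi.add_apply, partialSum_apply, startFun]
    simp only [ih, Pi.smul_apply, startFun, smul_eq_mul]
    have h0 : (if ∃ j, ρ j = r then startVec (K := K) ρ r else 0) j = if ρ j = r then 1 else 0 := by
      by_cases h : ∃ j, ρ j = r
      · rw [if_pos h, startVec]
      · rw [if_neg h, if_neg fun h' => h ⟨j, h'⟩, Pi.zero_apply]
    rw [h0]
    rcases lt_trichotomy (ρ j) r with h | h | h
    · rw [if_neg h.ne, if_pos (by omega), zero_add]
      simp only [if_pos h]
      obtain ⟨i, rfl⟩ : ∃ i, r = i + 1 + ρ j := ⟨r - 1 - ρ j, by omega⟩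
      rw [show i + 1 + ρ j + 1 - 1 - ρ j = i + 1 by omega, pathFun_succ,
        show i + 1 + ρ j - 1 - ρ j = i by omega]
      refine partialSum_congr_parity _ ?_
      have := hρ j
      rw [Nat.even_iff] at this
      rw [Int.even_iff]
      push_cast
      omega
    · rw [if_pos h, if_pos (by omega)]
      simp only [h, lt_irrefl, if_false, mul_zero]
      rw [show r + 1 - 1 - r = 0 by omega]
      simp [partialSum, pathFun]
    · rw [if_neg h.ne', if_neg (by omega)]
      simp only [if_neg (not_lt.2 h.le), mul_zero]
      simp [partialSum]

theorem startVecs_eq (hρ : StrictAnti ρ) (r : ℕ) :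
    startVecs (fun r => ∃ j, ρ j = r) (startVec (K := K) ρ) r =
      ((List.finRange n).filter fun j => ρ j < r).map fun j => startVec (K := K) ρ (ρ j) := by
  induction r with
  | zero => simp [startVecs]
  | succ r ih =>
    rw [startVecs]
    split_ifs with h
    · obtain ⟨j, rfl⟩ := h
      have : (List.finRange n).filter (fun i => ρ i < ρ j + 1) =
          j :: (List.finRange n).filter (fun i => ρ i < ρ j) := by
        refine List.Perm.eq_of_pairwise (le := (· < ·)) ?_ ?_ ?_ ?_
        · exact fun a b _ _ h1 h2 => absurd h1 (lt_asymm h2)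
        · exact (List.pairwise_lt_finRange n).filter _
        · refine List.pairwise_cons.2 ⟨fun i hi => ?_, (List.pairwise_lt_finRange n).filter _⟩
          have := (List.mem_filter.1 hi).2
          simp only [decide_eq_true_eq] at this
          exact hρ.lt_iff_gt.1 this
        · refine (List.perm_ext_iff_of_nodup ((List.nodup_finRange n).filter _)
            (List.nodup_cons.2 ⟨by simp, (List.nodup_finRange n).filter _⟩)).2 fun i => ?_
          simp only [List.mem_filter, List.mem_finRange, true_and, decide_eq_true_eq,
            List.mem_cons, Nat.lt_succ_iff_lt_or_eq]
          rw [hρ.injective.eq_iff, or_comm]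
      rw [this, List.map_cons, ih]
    · rw [ih]
      congr 1
      refine List.filter_congr fun j _ => ?_
      have : ρ j ≠ r := fun h' => h ⟨j, h'⟩
      simp only [decide_eq_decide]
      omega

theorem startVecs_eq_ofFn (hρ : StrictAnti ρ) {r : ℕ} (hr : ∀ j, ρ j < r) :
    startVecs (fun r => ∃ j, ρ j = r) (startVec (K := K) ρ) r =
      List.ofFn fun j => startVec (K := K) ρ (ρ j) := by
  rw [startVecs_eq ρ hρ, List.filter_eq_self.2 (by simpa using hr), List.ofFn_eq_map]

theorem wedgeDet_startVecs (hρ : StrictAnti ρ) {r : ℕ} (hr : ∀ j, ρ j < r) :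
    wedgeDet n (wedge (startVecs (fun r => ∃ j, ρ j = r) (startVec (K := K) ρ) r)) = 1 := by
  rw [startVecs_eq_ofFn ρ hρ hr, wedgeDet_wedge_ofFn]
  convert Matrix.det_one (R := K) (n := Fin n)
  ext i j
  rw [Matrix.of_apply, startVec, Matrix.one_apply]
  simp only [hρ.injective.eq_iff]
  exact if_congr eq_comm rfl rfl

theorem exitVecs_eq_ofFn {V : Type*} [AddCommGroup V] [Module K V] (inj : ℕ → Prop)
    [DecidablePred inj] (b : ℕ → ℤ) (w : ℤ → K) (e : ℕ → V) (T k : ℕ) :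
    exitVecs inj (fun r => T ≤ r) b w e (T + k) =
      List.ofFn fun i : Fin k => pathVec inj w e (T + k - i) (b (T + k - 1 - i)) := by
  induction k with
  | zero =>
    have : ∀ r ≤ T, exitVecs inj (fun r => T ≤ r) b w e r = [] := fun r => by
      induction r with
      | zero => simp [exitVecs]
      | succ r ih =>
        intro hr
        rw [exitVecs, if_neg (by omega), ih (by omega)]
    simpa using this T le_rfl
  | succ k ih =>
    rw [← add_assoc, exitVecs, if_pos (by omega), ih, List.ofFn_succ]
    refine congrArg₂ List.cons (by simp) (congrArg List.ofFn (funext fun i => ?_))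
    rw [Fin.val_succ, show T + k + 1 - (i + 1) = T + k - i by omega,
      show T + k + 1 - 1 - (i + 1) = T + k - 1 - i by omega]

/-- The generating function of a chain from whose last row the triangles at the positions in `S`
are removed. -/
theorem gfRemoved_chain_eq_wedgeDet (b : ℕ → ℤ) {c : ℤ} (hc : Even c) (w : ℤ → K) (T k : ℕ)
    (hρ : StrictAnti ρ) (hρe : ∀ j, Even (ρ j)) (hρT : ∀ j, ρ j < T + k)
    (hb : ∀ r < T + k, Even (b r - r)) (hb0 : ∀ r < T + k, 0 ≤ b r)
    (hb1 : ∀ r < T + k, b (r + 1) ≤ b r + 1)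
    (hb2 : ∀ r < T + k, T ≤ r → 1 ≤ b r ∧ b (r + 1) ≤ b r - 1)
    (S : Finset ℤ) (hS : ∀ p ∈ S, 0 ≤ p ∧ p < b (T + k) ∧ Odd (p - (T + k : ℕ))) :
    gfRemoved w (chain (fun r => ∃ j, ρ j = r) (fun r => T ≤ r) b c (T + k))
        (S ×ˢ {c - (T + k : ℕ) + 1}) =
      if S.card + k = n then
        wedgeDet n (wedge ((S.sort (· ≤ ·)).map (startFun ρ w (T + k))) *
          wedge (List.ofFn fun i : Fin k => startFun ρ w (T + k - i) (b (T + k - 1 - i))))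
      else 0 := by
  have hinj : ∀ r, (∃ j, ρ j = r) → Even r := fun r ⟨j, hj⟩ => hj ▸ hρe j
  have h1 : (startVecs (fun r => ∃ j, ρ j = r) (startVec (K := K) ρ) (T + k)).length = n := by
    rw [startVecs_eq_ofFn ρ hρ hρT, List.length_ofFn]
  have h2 : (exitVecs (fun r => ∃ j, ρ j = r) (fun r => T ≤ r) b w (startVec (K := K) ρ)
      (T + k)).length = k := by
    rw [exitVecs_eq_ofFn, List.length_ofFn]
  split_ifs with h
  · have h3 := gfRemoved_chain_smul_wedge (fun r => ∃ j, ρ j = r) (fun r => T ≤ r) b c w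
      (startVec (K := K) ρ) hc (T + k) hinj hb hb0 hb1 hb2 (T + k) le_rfl (S.sort (· ≤ ·))
      (Finset.sortedLT_sort S).pairwise (fun p hp => hS p ((Finset.mem_sort _).1 hp))
      (by rw [h1, h2, Finset.length_sort, h])
    have h4 := congrArg (wedgeDet (K := K) n) h3
    rw [map_smul, wedgeDet_startVecs ρ hρ hρT, smul_eq_mul, mul_one, Finset.sort_toFinset,
      exitVecs_eq_ofFn] at h4
    have h5 : pathVec (fun r => ∃ j, ρ j = r) w (startVec (K := K) ρ) (T + k) =
        startFun ρ w (T + k) := funext fun s => pathVec_eq_startFun ρ hρe w _ s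
    simp only [h4, h5, pathVec_eq_startFun ρ hρe]
  · exact gfRemoved_chain_eq_zero _ _ b c hc w (startVec (K := K) ρ) (T + k) hinj hb hb0
      (fun r hr hT => (hb2 r hr hT).1) S (fun p hp => (hS p hp).2.2) (by rw [h1, h2]; exact h)

/-- Gluing two determinants. -/
theorem sum_powerset_eq_det {m k : ℕ} (C : Finset ℤ) (w : ℤ → K) (A B : Finset ℤ → K)
    (L : ℤ → Fin m → K) (v : ℤ → Fin (m + k) → K) (x : Fin k → Fin (m + k) → K)
    (hA : ∀ S ⊆ C, A S = if S.card + k = m + k then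
      wedgeDet (m + k) (wedge ((S.sort (· ≤ ·)).map v) * wedge (List.ofFn x)) else 0)
    (hB : ∀ S ⊆ C, S.card = m → B S = wedgeDet m (wedge ((S.sort (· ≤ ·)).map L))) :
    ∑ S ∈ C.powerset, (∏ i ∈ S, w i) * A S * B S =
      (Matrix.of fun i => Fin.append (fun l => ∑ s ∈ C, w s * (v s i * L s l)) fun c => x c i).det := by
  have h1 : ∑ S ∈ C.powerset, (∏ i ∈ S, w i) * A S * B S =
      ∑ S ∈ C.powersetCard m, (∏ i ∈ S, w i) * A S * B S := by
    refine (Finset.sum_subset (fun S hS => ?_) fun S hS hS' => ?_).symm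
    · exact Finset.mem_powerset.2 (Finset.mem_powersetCard.1 hS).1
    · have hSC := Finset.mem_powerset.1 hS
      rw [hA S hSC, if_neg, mul_zero, zero_mul]
      exact fun h => hS' (Finset.mem_powersetCard.2 ⟨hSC, by omega⟩)
  have h2 : (Matrix.of fun i => Fin.append (fun l => ∑ s ∈ C, w s * (v s i * L s l))
        fun c => x c i).det =
      wedgeDet (m + k) (wedge (List.ofFn fun l => ∑ s ∈ C, (w s * L s l) • v s) *
        wedge (List.ofFn x)) := by
    rw [← wedge_append, ← List.ofFn_fin_append, wedgeDet_wedge_ofFn, ← Matrix.det_transpose]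
    congr 1
    ext j i
    rw [Matrix.transpose_apply, Matrix.of_apply, Matrix.of_apply]
    refine Fin.addCases (fun l => ?_) (fun c => ?_) j
    · rw [Fin.append_left, Fin.append_left, Finset.sum_apply]
      refine Finset.sum_congr rfl fun s _ => ?_
      rw [Pi.smul_apply, smul_eq_mul]
      ring
    · rw [Fin.append_right, Fin.append_right]
  rw [h1, h2]
  have h3 := wedge_ofFn_sum C (fun s => w s • L s) v
  simp only [Pi.smul_apply, smul_eq_mul] at h3
  rw [h3, Finset.sum_mul, map_sum]
  refine Finset.sum_congr rfl fun S hS => ?_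
  obtain ⟨hSC, hcard⟩ := Finset.mem_powersetCard.1 hS
  rw [hA S hSC, if_pos (by omega), hB S hSC hcard, wedge_map_smul, smul_mul_assoc, map_smul,
    map_smul, smul_eq_mul, smul_eq_mul]
  have h4 : ((S.sort (· ≤ ·)).map w).prod = ∏ i ∈ S, w i := by
    conv_rhs => rw [← Finset.sort_toFinset S (· ≤ ·)]
    rw [List.prod_toFinset _ (Finset.sort_nodup _ _)]
  rw [h4]
  ring

end ChainDet

/-! ### The two halves of the region -/

section Halves

theorem mem_upperDents {u d n : ℕ} {h : Fin n → ℕ} {t : UnitTriangle} :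
    t ∈ upperDents u d h ↔
      t.1 = 0 ∧ ∃ k : ℕ, (1 ≤ k ∧ k ≤ u) ∧ (∀ j, h j ≠ k) ∧ t.2 = 2 * d + 2 * k := by
  obtain ⟨i, j⟩ := t
  simp only [upperDents, Finset.mem_image, Finset.mem_filter, Finset.mem_Icc, Prod.mk.injEq]
  constructor
  · rintro ⟨k, ⟨h1, h2⟩, h3, h4⟩
    exact ⟨h3.symm, k, h1, h2, h4.symm⟩
  · rintro ⟨h3, k, h1, h2, h4⟩
    exact ⟨k, ⟨h1, h2⟩, h3.symm, h4.symm⟩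

theorem mem_lowerDents {d m : ℕ} {l : Fin m → ℕ} {t : UnitTriangle} :
    t ∈ lowerDents d l ↔
      t.1 = 1 ∧ ∃ k : ℕ, (1 ≤ k ∧ k ≤ d) ∧ (∀ j, l j ≠ k) ∧ t.2 = 2 * d - 2 * k := by
  obtain ⟨i, j⟩ := t
  simp only [lowerDents, Finset.mem_image, Finset.mem_filter, Finset.mem_Icc, Prod.mk.injEq]
  constructor
  · rintro ⟨k, ⟨h1, h2⟩, h3, h4⟩
    exact ⟨h3.symm, k, h1, h2, h4.symm⟩
  · rintro ⟨h3, k, h1, h2, h4⟩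
    exact ⟨k, ⟨h1, h2⟩, h3.symm, h4.symm⟩

theorem south_sub_north {x u d m n : ℕ} (hmd : m ≤ d) (hnu : n ≤ u) :
    (south x u d m n : ℤ) - north x u d m n = (u - n) - (d - m) := by
  unfold south north
  omega

theorem two_mul_lt_east_iff {x u d m n : ℕ} (hmd : m ≤ d) (hnu : n ≤ u) (i j : ℤ) :
    2 * i + 1 ≤ east x u d m n j + east x u d m n (j + 1) ↔
      i ≤ 2 * north x u d m n + 2 * d + 2 * u - j ∧
      i ≤ 1 + 2 * south x u d m n + j := by
  have := south_sub_north (x := x) hmd hnu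
  unfold east
  split_ifs <;> omega

theorem west_le_iff (d : ℕ) (i j : ℤ) : west d j + west d (j + 1) ≤ 2 * i - 1 ↔
    if j ≤ 2 * d then 1 ≤ i else 0 ≤ i := by
  unfold west
  simp only [Int.even_iff]
  split_ifs <;> omega

variable {x u d m n : ℕ} {l : Fin m → ℕ} {h : Fin n → ℕ}

/-- The right ends of the rows of one half. -/
def rightEnd (B T r : ℕ) : ℤ := min (2 * B + r) (2 * B + 2 * T - r)

theorem regionS_upper (hmd : m ≤ d) (hnu : n ≤ u) (hh1 : ∀ j, 1 ≤ h j) (hhu : ∀ j, h j ≤ u)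
    {T k : ℕ} (hT : T + k = 2 * u + 1) (hk : k = n - m) :
    (regionS x u d l h).filter (fun t => 2 * (d : ℤ) ≤ t.2) =
      chain (fun r => ∃ j, 2 * u - 2 * h j = r) (fun r => T ≤ r)
        (rightEnd (north x u d m n) T) (2 * d + 2 * u) (T + k) := by
  ext ⟨i, j⟩
  rw [Finset.mem_filter, regionS, Finset.mem_sdiff, mem_halvedHexagon, InHalvedHexagon,
    Finset.mem_union, mem_upperDents, mem_lowerDents, mem_chain, two_mul_lt_east_iff hmd hnu,
    west_le_iff, hT]
  dsimp only
  have hsn := south_sub_north (x := x) hmd hnu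
  constructor
  · rintro ⟨⟨⟨h1, h2, h3, h4, h5⟩, h6⟩, h7⟩
    refine ⟨(2 * d + 2 * u - j).toNat, by omega, by omega, ?_, ?_, fun h => ?_⟩
    · unfold leftEnd
      split_ifs with hl
      · split_ifs at h3 with hj
        · exact h3
        · by_contra hi
          have := hl.1
          rw [Nat.even_iff] at this
          refine h6 (Or.inl ⟨by omega, ((j - 2 * d) / 2).toNat, by omega, fun j' hj' => ?_,
            by omega⟩)
          exact hl.2 ⟨j', by omega⟩
      · split_ifs at h3 <;> omega
    · unfold rightEnd
      omega
    · unfold rightEnd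
      omega
  · rintro ⟨r, hr, h1, h2, h3, h4⟩
    have h0 : 0 ≤ i := by
      unfold leftEnd at h2
      split_ifs at h2 <;> omega
    have hnd : r = 2 * u → 1 ≤ i := by
      rintro rfl
      unfold leftEnd at h2
      rw [if_pos] at h2
      · exact h2
      · refine ⟨⟨u, by ring⟩, ?_⟩
        rintro ⟨j', hj'⟩
        have := hh1 j'
        have := hhu j'
        omega
    unfold rightEnd at h3 h4
    refine ⟨⟨⟨by omega, by omega, ?_, by omega, by omega⟩, ?_⟩, by omega⟩
    · split_ifs
      · exact hnd (by omega)
      · exact h0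
    · rintro (⟨hi, k', hk1, hk2, hk3⟩ | ⟨hi, k', hk1, hk2, hk3⟩)
      · unfold leftEnd at h2
        rw [if_pos] at h2
        · omega
        · refine ⟨?_, ?_⟩
          · rw [Nat.even_iff]
            omega
          · rintro ⟨j', hj'⟩
            have := hh1 j'
            have := hhu j'
            exact hk2 j' (by omega)
      · omega

theorem regionS_lower (hmd : m ≤ d) (hnu : n ≤ u) (hl1 : ∀ i, 1 ≤ l i) (hld : ∀ i, l i ≤ d)
    {T k : ℕ} (hT : T + k = 2 * d) (hk : k = m - n) :
    ((regionS x u d l h).filter (fun t => t.2 < 2 * (d : ℤ))).map flip.toEmbedding =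
      chain (fun r => ∃ i, 2 * d - 2 * l i = r) (fun r => T ≤ r)
        (rightEnd (south x u d m n) T) 0 (T + k) := by
  ext ⟨i, j⟩
  rw [Finset.mem_map_equiv, Finset.mem_filter, regionS, Finset.mem_sdiff, mem_halvedHexagon,
    InHalvedHexagon,
    Finset.mem_union, mem_upperDents, mem_lowerDents, mem_chain, two_mul_lt_east_iff hmd hnu,
    west_le_iff, hT]
  have hflip : flip.symm (i, j) = (i + 1, -j) := rfl
  rw [hflip]
  dsimp only
  have hsn := south_sub_north (x := x) hmd hnu
  constructor
  · rintro ⟨⟨⟨h1, h2, h3, h4, h5⟩, h6⟩, h7⟩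
    rw [if_pos (by omega)] at h3
    refine ⟨(-j).toNat, by omega, by omega, ?_, ?_, fun h => ?_⟩
    · unfold leftEnd
      split_ifs with hl
      · by_contra hi
        have := hl.1
        rw [Nat.even_iff] at this
        refine h6 (Or.inr ⟨by omega, ((2 * d + j) / 2).toNat, by omega, fun j' hj' => ?_, by omega⟩)
        exact hl.2 ⟨j', by omega⟩
      · omega
    · unfold rightEnd
      omega
    · unfold rightEnd
      omega
  · rintro ⟨r, hr, h1, h2, h3, h4⟩
    have h0 : 0 ≤ i := by
      unfold leftEnd at h2
      split_ifs at h2 <;> omega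
    unfold rightEnd at h3 h4
    rw [if_pos (by omega)]
    refine ⟨⟨⟨by omega, by omega, by omega, by omega, by omega⟩, ?_⟩, by omega⟩
    rintro (⟨hi, k', hk1, hk2, hk3⟩ | ⟨hi, k', hk1, hk2, hk3⟩)
    · omega
    · unfold leftEnd at h2
      rw [if_pos] at h2
      · omega
      · refine ⟨?_, ?_⟩
        · rw [Nat.even_iff]
          omega
        · rintro ⟨j', hj'⟩
          have := hl1 j'
          have := hld j'
          exact hk2 j' (by omega)

end Halves

/-! ### The generating function of the region as a determinant -/

section RegionDet

open ExteriorAlgebra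

variable {K : Type*} [Field K] (w : ℤ → K)

theorem sort_map_sub_one (S : Finset ℤ) :
    (S.map (Equiv.subRight (1 : ℤ)).toEmbedding).sort (· ≤ ·) =
      (S.sort (· ≤ ·)).map (fun p => p - 1) := by
  refine List.Perm.eq_of_pairwise (le := (· < ·)) ?_ ?_ ?_ ?_
  · exact fun a b _ _ h1 h2 => absurd h1 (lt_asymm h2)
  · exact (Finset.sortedLT_sort _).pairwise
  · exact (Finset.sortedLT_sort S).pairwise.map _ fun a b h => by omega
  · refine (List.perm_ext_iff_of_nodup (Finset.sort_nodup _ _)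
      ((Finset.sort_nodup S _).map fun a b h => by simpa using h)).2 fun p => ?_
    simp [sub_eq_iff_eq_add]

theorem gfRemoved_flip (R S : Finset UnitTriangle) :
    gfRemoved (fun i => w (i + 1)) (R.map flip.toEmbedding) (S.map flip.toEmbedding) =
      gfRemoved w R S := by
  unfold gfRemoved
  simp only [Finset.map_subset_map, ← Finset.map_sdiff, gf_flip]

variable {B T k : ℕ}

theorem even_rightEnd_sub (B T r : ℕ) : Even (rightEnd B T r - r) := by
  unfold rightEnd
  rw [Int.even_iff]
  omega

theorem rightEnd_nonneg (hk : k ≤ T) {r : ℕ} (hr : r < T + k) : 0 ≤ rightEnd B T r := by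
  unfold rightEnd
  omega

theorem rightEnd_succ_le (B T r : ℕ) : rightEnd B T (r + 1) ≤ rightEnd B T r + 1 := by
  unfold rightEnd
  omega

theorem rightEnd_of_le {r : ℕ} (hT : T ≤ r) : rightEnd B T r = 2 * B + 2 * T - r := by
  unfold rightEnd
  omega

variable {x u d m n : ℕ} {l : Fin m → ℕ} {h : Fin n → ℕ}

theorem gfRemoved_upper (hmd : m ≤ d) (hnu : n ≤ u) (hh : StrictMono h) (hh1 : ∀ j, 1 ≤ h j)
    (hhu : ∀ j, h j ≤ u) (hk : k = n - m) {β : ℤ}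
    (hβ : β = 2 * north x u d m n + 2 * u + 2 - 2 * k) (S : Finset ℤ)
    (hS : ∀ p ∈ S, 1 ≤ p ∧ p ≤ β - 2 ∧ Even p) :
    gfRemoved w ((regionS x u d l h).filter (fun t => 2 * (d : ℤ) ≤ t.2)) (S ×ˢ {2 * (d : ℤ)}) =
      if S.card + k = n then
        wedgeDet n (wedge ((S.sort (· ≤ ·)).map fun s j => pathFun w (2 * h j) s) *
          wedge (List.ofFn fun (c : Fin k) j =>
            if c ≤ 2 * h j then pathFun w (2 * h j - c) (β + c) else 0))
      else 0 := by
  obtain ⟨T, hT⟩ : ∃ T, T + k = 2 * u + 1 := ⟨2 * u + 1 - k, by omega⟩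
  have hkT : k ≤ T := by omega
  have hend : rightEnd (north x u d m n) T (T + k) = β - 1 := by
    rw [rightEnd_of_le (by omega)]
    omega
  have key := gfRemoved_chain_eq_wedgeDet (fun j => 2 * u - 2 * h j)
    (rightEnd (north x u d m n) T) (c := 2 * d + 2 * u) (by rw [Int.even_iff]; omega) w T k
    (fun i j hij => by
      have := hh hij
      have := hhu j
      dsimp only
      omega) (fun j => by rw [Nat.even_iff]; omega) (fun j => by omega)
    (fun r _ => even_rightEnd_sub _ _ r) (fun r hr => rightEnd_nonneg hkT hr)
    (fun r _ => rightEnd_succ_le _ _ r)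
    (fun r hr hTr => by
      rw [rightEnd_of_le hTr, rightEnd_of_le (by omega)]
      push_cast
      omega) S (fun p hp => by
      obtain ⟨h1, h2, h3⟩ := hS p hp
      rw [hend, Int.odd_iff]
      rw [Int.even_iff] at h3
      omega)
  rw [regionS_upper hmd hnu hh1 hhu hT hk,
    show 2 * (d : ℤ) = 2 * d + 2 * u - (T + k : ℕ) + 1 by rw [hT]; push_cast; ring]
  rw [show (2 * d + 2 * u - (T + k : ℕ) + 1 : ℤ) + 2 * u = 2 * d + 2 * u by
    rw [hT]; push_cast; ring, key]
  congr 3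
  · congr 2
    · funext s j
      have := hh1 j
      have := hhu j
      rw [startFun, if_pos (by omega)]
      congr 1
      omega
  · congr 2
    funext c j
    have := hh1 j
    have := hhu j
    have := c.2
    rw [startFun, rightEnd_of_le (by omega)]
    refine if_congr (by omega) ?_ rfl
    congr 1 <;> omega

theorem gfRemoved_lower (hmd : m ≤ d) (hnu : n ≤ u) (hl : StrictMono l) (hl1 : ∀ j, 1 ≤ l j)
    (hld : ∀ j, l j ≤ d) (hk : k = m - n) {β : ℤ}
    (hβ : β = 2 * south x u d m n + 2 * d + 2 - 2 * k) (S : Finset ℤ)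
    (hS : ∀ p ∈ S, 1 ≤ p ∧ p ≤ β - 2 ∧ Even p) :
    gfRemoved w ((regionS x u d l h).filter (fun t => t.2 < 2 * (d : ℤ))) (S ×ˢ {2 * (d : ℤ) - 1}) =
      if S.card + k = m then
        wedgeDet m (wedge ((S.sort (· ≤ ·)).map fun s j =>
            pathFun (fun i => w (i + 1)) (2 * l j - 1) (s - 1)) *
          wedge (List.ofFn fun (c : Fin k) j =>
            if c < 2 * l j then pathFun (fun i => w (i + 1)) (2 * l j - 1 - c) (β + c - 1) else 0))
      else 0 := by
  obtain ⟨T, hT⟩ : ∃ T, T + k = 2 * d := ⟨2 * d - k, by omega⟩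
  have hkT : k ≤ T := by omega
  have hend : rightEnd (south x u d m n) T (T + k) = β - 2 := by
    rw [rightEnd_of_le (by omega)]
    omega
  have key := gfRemoved_chain_eq_wedgeDet (fun j => 2 * d - 2 * l j)
    (rightEnd (south x u d m n) T) (c := 0) (by simp) (fun i => w (i + 1)) T k
    (fun i j hij => by
      have := hl hij
      have := hld j
      dsimp only
      omega) (fun j => by rw [Nat.even_iff]; omega)
    (fun j => by
      have := hl1 j
      have := hld j
      omega)
    (fun r _ => even_rightEnd_sub _ _ r) (fun r hr => rightEnd_nonneg hkT hr)
    (fun r _ => rightEnd_succ_le _ _ r)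
    (fun r hr hTr => by
      rw [rightEnd_of_le hTr, rightEnd_of_le (by omega)]
      push_cast
      omega) (S.map (Equiv.subRight (1 : ℤ)).toEmbedding) (fun p hp => by
      obtain ⟨p', hp', rfl⟩ := Finset.mem_map.1 hp
      obtain ⟨h1, h2, h3⟩ := hS p' hp'
      rw [hend, Int.odd_iff]
      rw [Int.even_iff] at h3
      simp only [Equiv.toEmbedding_apply, Equiv.subRight_apply]
      omega)
  have hmap : (S ×ˢ {2 * (d : ℤ) - 1}).map flip.toEmbedding =
      S.map (Equiv.subRight (1 : ℤ)).toEmbedding ×ˢ {0 - ((T + k : ℕ) : ℤ) + 1} := by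
    ext ⟨i, j⟩
    simp only [Finset.mem_map_equiv, Finset.mem_product, Finset.mem_singleton, flip,
      Equiv.coe_fn_symm_mk, hT, Equiv.subRight_symm_apply]
    push_cast
    refine and_congr Iff.rfl ?_
    omega
  rw [← gfRemoved_flip, regionS_lower hmd hnu hl1 hld hT hk, hmap, key, Finset.card_map,
    sort_map_sub_one, List.map_map]
  congr 3
  · congr 2
    · funext s j
      have := hl1 j
      have := hld j
      rw [Function.comp_apply, startFun, if_pos (by omega)]
      congr 1
      omega
  · congr 2
    funext c j
    have := hl1 j
    have := hld j
    have := c.2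
    rw [startFun, rightEnd_of_le (by omega)]
    refine if_congr (by omega) ?_ rfl
    congr 1 <;> omega

theorem gf_regionS_eq_sum (hmd : m ≤ d) (hnu : n ≤ u) {β : ℤ}
    (hβ : β = 2 * (xBar x u d m n + min m n : ℕ) + 2) :
    gf w (regionS x u d l h) =
      ∑ S ∈ ((Finset.Ico 1 (β - 1)).filter fun p => Odd (p - 1)).powerset, (∏ i ∈ S, w i) *
        gfRemoved w ((regionS x u d l h).filter (fun t => 2 * (d : ℤ) ≤ t.2)) (S ×ˢ {2 * (d : ℤ)}) *
        gfRemoved w ((regionS x u d l h).filter (fun t => t.2 < 2 * (d : ℤ)))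
          (S ×ˢ {2 * (d : ℤ) - 1}) := by
  have hsplit : regionS x u d l h = (regionS x u d l h).filter (fun t => 2 * (d : ℤ) ≤ t.2) ∪
      (regionS x u d l h).filter (fun t => t.2 < 2 * (d : ℤ)) := by
    simp only [← not_le]
    rw [Finset.filter_union_filter_not_eq]
  conv_lhs => rw [hsplit]
  refine gf_union w _ _ (fun i hi => ?_) _ (fun t ht => (Finset.mem_filter.1 ht).2) _
    (fun t ht => (Finset.mem_filter.1 ht).2) fun i hi h1 h2 => ?_
  · have := (Finset.mem_filter.1 hi).2
    rw [IsUp, Int.even_iff]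
    rw [Int.odd_iff] at this
    dsimp only
    omega
  · have h1' := (Finset.mem_filter.1 h1).1
    have h2' := (Finset.mem_filter.1 h2).1
    rw [regionS, Finset.mem_sdiff, mem_halvedHexagon, InHalvedHexagon,
      two_mul_lt_east_iff hmd hnu, west_le_iff] at h1' h2'
    obtain ⟨⟨-, -, h3, h4, -⟩, -⟩ := h1'
    obtain ⟨⟨-, -, -, -, h5⟩, -⟩ := h2'
    rw [IsUp, Int.even_iff] at hi
    rw [Finset.mem_filter, Finset.mem_Ico, Int.odd_iff]
    dsimp only at h3 h4 h5 hi
    rw [if_pos le_rfl] at h3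
    have hsn := south_sub_north (x := x) hmd hnu
    have hX : (south x u d m n : ℤ) + d = xBar x u d m n + m := by
      unfold south xBar
      omega
    omega

theorem partialSum_eq_sum {f : ℤ → K} (h0 : f 0 = 0) {s : ℤ} (hs : 0 < s) :
    ∑ p ∈ (Finset.Ico 1 s).filter (fun p => Odd (p - 1)), f p = partialSum f 1 0 s := by
  rw [partialSum_of_odd f (by simp) hs, h0, zero_add]
  exact partialSum_of_even f (by simp)

theorem pathFun_zero {i : ℕ} (hi : 0 < i) : pathFun w i 0 = 0 := by
  obtain ⟨i, rfl⟩ := Nat.exists_eq_succ_of_ne_zero hi.ne'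
  exact partialSum_of_le _ le_rfl

theorem mem_crossing {β p : ℤ} (h : p ∈ (Finset.Ico 1 (β - 1)).filter fun p => Odd (p - 1)) :
    1 ≤ p ∧ p ≤ β - 2 ∧ Even p := by
  rw [Finset.mem_filter, Finset.mem_Ico, Int.odd_iff] at h
  rw [Int.even_iff]
  omega

theorem gf_regionS_eq_det_upper {l : Fin m → ℕ} {h : Fin (m + k) → ℕ}
    (hmd : m ≤ d) (hnu : m + k ≤ u)
    (hl : StrictMono l) (hl1 : ∀ j, 1 ≤ l j) (hld : ∀ j, l j ≤ d)
    (hh : StrictMono h) (hh1 : ∀ j, 1 ≤ h j) (hhu : ∀ j, h j ≤ u) {β : ℤ}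
    (hβ : β = 2 * (xBar x u d m (m + k) + m : ℕ) + 2) :
    gf w (regionS x u d l h) = (Matrix.of fun i => Fin.append
      (fun j => partialSum (fun s => w s * (pathFun w (2 * h i) s *
        pathFun (fun i => w (i + 1)) (2 * l j - 1) (s - 1))) 1 0 (β - 1))
      (fun c : Fin k => if c ≤ 2 * h i then pathFun w (2 * h i - c) (β + c) else 0)).det := by
  have h1 : (south x u d m (m + k) : ℤ) + d = xBar x u d m (m + k) + m := by
    unfold south xBar
    omega
  have h2 := south_sub_north (x := x) hmd hnu
  push_cast at h2
  rw [gf_regionS_eq_sum w hmd hnu (β := β) (by rw [hβ, Nat.min_eq_left (by omega)]),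
    sum_powerset_eq_det _ w
      (fun S => gfRemoved w ((regionS x u d l h).filter (fun t => 2 * (d : ℤ) ≤ t.2))
        (S ×ˢ {2 * (d : ℤ)}))
      (fun S => gfRemoved w ((regionS x u d l h).filter (fun t => t.2 < 2 * (d : ℤ)))
        (S ×ˢ {2 * (d : ℤ) - 1}))
      (fun s j => pathFun (fun i => w (i + 1)) (2 * l j - 1) (s - 1))
      (fun s j => pathFun w (2 * h j) s)
      (fun c j => if c ≤ 2 * h j then pathFun w (2 * h j - c) (β + c) else 0)
      (fun S hS => gfRemoved_upper w hmd hnu hh hh1 hhu (by omega) (by omega) S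
        fun p hp => mem_crossing (hS hp))
      (fun S hS hcard => by
        rw [gfRemoved_lower w hmd hnu hl hl1 hld (k := 0) (by omega) (β := β) (by omega) S
          fun p hp => mem_crossing (hS hp), if_pos (show S.card + 0 = _ from hcard)]
        simp)]
  congr 3
  funext i
  congr 1
  funext j
  refine partialSum_eq_sum (by
    have := hh1 i
    rw [pathFun_zero w (by omega), zero_mul, mul_zero]) (by omega)

theorem gf_regionS_eq_det_lower {l : Fin (n + k) → ℕ} {h : Fin n → ℕ}
    (hmd : n + k ≤ d) (hnu : n ≤ u)
    (hl : StrictMono l) (hl1 : ∀ j, 1 ≤ l j) (hld : ∀ j, l j ≤ d)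
    (hh : StrictMono h) (hh1 : ∀ j, 1 ≤ h j) (hhu : ∀ j, h j ≤ u) {β : ℤ}
    (hβ : β = 2 * (xBar x u d (n + k) n + n : ℕ) + 2) :
    gf w (regionS x u d l h) = (Matrix.of fun i => Fin.append
      (fun j => partialSum (fun s => w s * (pathFun w (2 * h j) s *
        pathFun (fun i => w (i + 1)) (2 * l i - 1) (s - 1))) 1 0 (β - 1))
      (fun c : Fin k => if c < 2 * l i then
        pathFun (fun i => w (i + 1)) (2 * l i - 1 - c) (β + c - 1) else 0)).det := by
  have h1 : (south x u d (n + k) n : ℤ) + d = xBar x u d (n + k) n + (n + k) := by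
    unfold south xBar
    omega
  have h2 := south_sub_north (x := x) hmd hnu
  push_cast at h2
  rw [gf_regionS_eq_sum w hmd hnu (β := β) (by rw [hβ, Nat.min_eq_right (by omega)])]
  rw [Finset.sum_congr rfl fun S _ => mul_right_comm _ _ _]
  rw [sum_powerset_eq_det _ w
      (fun S => gfRemoved w ((regionS x u d l h).filter (fun t => t.2 < 2 * (d : ℤ)))
        (S ×ˢ {2 * (d : ℤ) - 1}))
      (fun S => gfRemoved w ((regionS x u d l h).filter (fun t => 2 * (d : ℤ) ≤ t.2))
        (S ×ˢ {2 * (d : ℤ)}))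
      (fun s j => pathFun w (2 * h j) s)
      (fun s j => pathFun (fun i => w (i + 1)) (2 * l j - 1) (s - 1))
      (fun c j => if c < 2 * l j then
        pathFun (fun i => w (i + 1)) (2 * l j - 1 - c) (β + c - 1) else 0)
      (fun S hS => gfRemoved_lower w hmd hnu hl hl1 hld (by omega) (by omega) S
        fun p hp => mem_crossing (hS hp))
      (fun S hS hcard => by
        rw [gfRemoved_upper w hmd hnu hh hh1 hhu (k := 0) (by omega) (β := β) (by omega) S
          fun p hp => mem_crossing (hS hp), if_pos (show S.card + 0 = _ from hcard)]
        simp)]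
  congr 3
  funext i
  congr 1
  funext j
  simp_rw [mul_comm (pathFun (fun i => w (i + 1)) _ _)]
  refine partialSum_eq_sum (by
    have := hh1 j
    rw [pathFun_zero w (by omega), zero_mul, mul_zero]) (by omega)

end RegionDet

/-! ### Evaluation of the determinants -/

section Evaluation

variable {K : Type*} [Field K] {q : K}

/-- The product of the `N` symmetric `q`-integers `[2 a], [2 a + 2], …`. -/
noncomputable def evenProd (q : K) (a : ℤ) (N : ℕ) : K := ∏ i ∈ Finset.range N, qs q (2 * (a + i))

/-- The product of the first `N` even symmetric `q`-integers. -/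
noncomputable def evenFact (q : K) (N : ℕ) : K := evenProd q 1 N

theorem evenProd_add (a : ℤ) (N M : ℕ) :
    evenProd q a (N + M) = evenProd q a N * evenProd q (a + N) M := by
  simp only [evenProd, Finset.prod_range_add]
  congr 1
  refine Finset.prod_congr rfl fun i _ => congrArg _ ?_
  push_cast
  ring

theorem evenProd_eq_zero {a : ℤ} {N : ℕ} (ha : a ≤ 0) (hN : 1 ≤ a + N) : evenProd q a N = 0 :=
  Finset.prod_eq_zero (i := (-a).toNat) (Finset.mem_range.2 (by omega)) (by
    rw [show 2 * (a + (-a).toNat) = 0 by omega, qs_zero])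

theorem evenFact_add (N M : ℕ) :
    evenFact q (N + M) = evenFact q N * evenProd q (N + 1) M := by
  rw [evenFact, evenProd_add, add_comm (1 : ℤ), evenFact]

theorem evenFact_succ (N : ℕ) : evenFact q (N + 1) = evenFact q N * qs q (2 * (N + 1)) := by
  rw [evenFact_add, evenProd]
  simp

theorem evenFact_ne_zero (hqs : ∀ a : ℤ, a ≠ 0 → qs q a ≠ 0) (N : ℕ) : evenFact q N ≠ 0 := by
  unfold evenFact evenProd
  exact Finset.prod_ne_zero_iff.2 fun i _ => hqs _ (by positivity)

theorem evenProd_mul_evenFact (a : ℤ) {N M p r : ℕ} (hp : a + N = p + 1) (hr : a + M = r + 1) :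
    evenProd q a N * evenFact q r = evenFact q p * evenProd q a M := by
  rcases le_or_gt a 0 with ha | ha
  · rw [evenProd_eq_zero ha (by omega), evenProd_eq_zero ha (by omega), zero_mul, mul_zero]
  · obtain ⟨j, rfl⟩ : ∃ j : ℕ, a = j + 1 := ⟨(a - 1).toNat, by omega⟩
    obtain rfl : p = j + N := by omega
    obtain rfl : r = j + M := by omega
    rw [evenFact_add, evenFact_add]
    ring

theorem qsProd_eq_evenProd {i : ℕ} {s a : ℤ} (h : s + 1 = 2 * a + i) :
    qsProd q i s = evenProd q a i :=
  Finset.prod_congr rfl fun t _ => congrArg _ (by linarith)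

theorem prod_fin_Ioi {k : ℕ} (f : ℕ → K) (c : Fin k) :
    ∏ t ∈ Finset.Ioi c, f t = ∏ i ∈ Finset.range (k - 1 - c), f (c + 1 + i) := by
  have h := Finset.prod_map (Finset.Ioi c) Fin.valEmbedding f
  rw [Fin.map_valEmbedding_Ioi] at h
  rw [show k - 1 - c = k - (c + 1) by omega, ← Finset.prod_Ico_eq_prod_range f]
  refine Eq.trans h.symm (Finset.prod_congr ?_ fun _ _ => rfl)
  ext t
  simp only [Finset.mem_Ioo, Finset.mem_Ico]
  omega

theorem prod_fin_Iio {k : ℕ} (f : ℕ → K) (c : Fin k) :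
    ∏ t ∈ Finset.Iio c, f t = ∏ i ∈ Finset.range c, f i := by
  have h := Finset.prod_map (Finset.Iio c) Fin.valEmbedding f
  rw [Fin.map_valEmbedding_Iio, Nat.Iio_eq_range] at h
  exact h.symm

theorem qsInvFact_sub (hqs : ∀ a : ℤ, a ≠ 0 → qs q a ≠ 0) (h2 : (2 : K) ≠ 0) {r c : ℕ}
    (hc : c ≤ r) :
    qsInvFact q (r - c) = qsInvFact q r * 2 ^ c * ∏ t ∈ Finset.range c, qs q (r - t) := by
  induction c with
  | zero => simp
  | succ c ih =>
    have h1 := qsInvFact_succ (q := q) (r - (c + 1))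
    have h3 : qs q (((r - (c + 1) : ℕ) : ℤ) + 1) = qs q (r - c) := by
      congr 1
      omega
    have h4 : qs q (r - c) ≠ 0 := hqs _ (by omega)
    rw [show r - (c + 1) + 1 = r - c by omega, ih (by omega), h3] at h1
    rw [Finset.prod_range_succ, pow_succ]
    field_simp at h1
    linear_combination -h1

theorem prod_range_qs_sub_eq_zero {r c : ℕ} (hc : r < c) :
    ∏ t ∈ Finset.range c, qs q ((r : ℤ) - t) = 0 :=
  Finset.prod_eq_zero (Finset.mem_range.2 hc) (by rw [sub_self, qs_zero])

/-- The number of weighted paths that leave the upper half to the right. -/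
theorem exit_upper (h2 : (2 : K) ≠ 0) (hq : q ≠ 0) (hqs : ∀ a : ℤ, a ≠ 0 → qs q a ≠ 0)
    {Y k h c : ℕ} (hhY : h ≤ Y + k) (hc : c < k) :
    (if c ≤ 2 * h then pathFun (wtFun q) (2 * h - c) ((2 * Y + 2 : ℤ) + c) else 0) =
      qsInvFact q (2 * h) * evenFact q (Y + h) / evenFact q (Y + k - h) *
        (2 ^ c * qs q (2 * Y + 2 + c)) *
        ((∏ t ∈ Finset.range c, qs q (2 * h - t)) *
          ∏ i ∈ Finset.range (k - 1 - c), qs q (2 * Y + 2 + 2 * (c + 1 + i : ℕ) - 2 * h)) := by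
  have hne := evenFact_ne_zero hqs (Y + k - h)
  have hprod : ∏ i ∈ Finset.range (k - 1 - c), qs q (2 * Y + 2 + 2 * (c + 1 + i : ℕ) - 2 * h) =
      evenProd q (Y + 2 + c - h) (k - 1 - c) :=
    Finset.prod_congr rfl fun i _ => congrArg _ (by push_cast; ring)
  have hcast : ∀ t : ℕ, (2 * (h : ℤ) - t) = ((2 * h : ℕ) : ℤ) - t := fun t => by push_cast; ring
  simp only [hcast]
  rw [hprod]
  split_ifs with hch
  · have h3 := qsInvFact_sub hqs h2 hch
    rcases hch.lt_or_eq with hlt | heq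
    · obtain ⟨i, hi⟩ : ∃ i, 2 * h - c = i + 1 := ⟨2 * h - c - 1, by omega⟩
      rw [hi] at h3 ⊢
      rw [pathFun_wtFun h2 hq hqs i (by positivity) (by rw [Int.even_iff]; omega), h3,
        qsProd_eq_evenProd (a := Y + 2 + c - h) (by omega)]
      have h4 := evenProd_mul_evenFact (q := q) (Y + 2 + c - h) (N := i) (M := k - 1 - c)
        (p := Y + h) (r := Y + k - h) (by omega) (by omega)
      field_simp
      linear_combination (qsInvFact q (2 * h) * qs q (2 * Y + 2 + c) *
        ∏ t ∈ Finset.range c, qs q (((2 * h : ℕ) : ℤ) - t)) * h4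
    · rw [heq, Nat.sub_self] at h3
      have h4 : evenFact q (Y + k - h) =
          evenFact q (Y + h) * qs q (2 * Y + 2 + c) * evenProd q (Y + 2 + c - h) (k - 1 - c) := by
        rw [show Y + k - h = (Y + h + 1) + (k - 1 - c) by omega, evenFact_add, evenFact_succ]
        congr 1
        · congr 2
          omega
        · congr 1
          omega
      rw [heq, Nat.sub_self]
      rw [heq] at h4
      simp only [pathFun]
      have h5 : qsInvFact q 0 = 1 := by simp [qsInvFact]
      rw [h5] at h3
      field_simp
      rw [h4]
      linear_combination (evenFact q (Y + h) * qs q (2 * Y + 2 + (2 * h : ℕ)) *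
        evenProd q (Y + 2 + (2 * h : ℕ) - h) (k - 1 - 2 * h)) * h3
  · rw [prod_range_qs_sub_eq_zero (by omega)]
    ring

/-- The number of weighted paths that leave the lower half to the right. -/
theorem exit_lower (h2 : (2 : K) ≠ 0) (hq : q ≠ 0) (hqs : ∀ a : ℤ, a ≠ 0 → qs q a ≠ 0)
    {Y k l c : ℕ} (hl : 1 ≤ l) (hlY : l ≤ Y + k) (hc : c < k) :
    (if c < 2 * l then pathFun (fun p => wtFun q (p + 1)) (2 * l - 1 - c) ((2 * Y + 2 : ℤ) + c - 1)
      else 0) =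
      qsInvFact q (2 * l - 1) * evenFact q (Y + l) / evenFact q (Y + k - l) * 2 ^ c *
        ((∏ t ∈ Finset.range c, qs q (2 * l - (t + 1 : ℕ))) *
          ∏ i ∈ Finset.range (k - 1 - c), qs q (2 * Y + 2 + 2 * (c + 1 + i : ℕ) - 2 * l)) := by
  have hne := evenFact_ne_zero hqs (Y + k - l)
  have hprod : ∏ i ∈ Finset.range (k - 1 - c), qs q (2 * Y + 2 + 2 * (c + 1 + i : ℕ) - 2 * l) =
      evenProd q (Y + 2 + c - l) (k - 1 - c) :=
    Finset.prod_congr rfl fun i _ => congrArg _ (by push_cast; ring)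
  have hcast : ∀ t : ℕ, (2 * (l : ℤ) - (t + 1 : ℕ)) = ((2 * l - 1 : ℕ) : ℤ) - t := fun t => by omega
  simp only [hcast]
  rw [hprod]
  split_ifs with hch
  · rw [pathFun_wtFun_shift h2 hq hqs _ (by omega) (by rw [Int.even_iff]; omega),
      qsInvFact_sub hqs h2 (by omega), qsProd_eq_evenProd (a := Y + 2 + c - l) (by omega)]
    have h4 := evenProd_mul_evenFact (q := q) (Y + 2 + c - l) (N := 2 * l - 1 - c) (M := k - 1 - c)
      (p := Y + l) (r := Y + k - l) (by omega) (by omega)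
    field_simp
    linear_combination (qsInvFact q (2 * l - 1) *
      ∏ t ∈ Finset.range c, qs q (((2 * l - 1 : ℕ) : ℤ) - t)) * h4
  · rw [prod_range_qs_sub_eq_zero (by omega)]
    ring

/-- The rows of the determinants are multiples of the rows of the mixed Cauchy determinant. -/
theorem det_append_eq {m k Y : ℕ} (hqs : ∀ a : ℤ, a ≠ 0 → qs q a ≠ 0) (hq : q ≠ 0)
    (h : Fin (m + k) → ℕ) (l : Fin m → ℕ) (hl : StrictMono l)
    (hl1 : ∀ j, 1 ≤ l j) (hlY : ∀ j, l j ≤ Y) (hhY : ∀ j, h j ≤ Y + k)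
    (α : Fin k → ℤ) (hα : Function.Injective α) (hα0 : ∀ c, 0 ≤ α c)
    (κ : Fin (m + k) → K) (κ' : Fin m → K) (ε : Fin k → K)
    (A : Fin (m + k) → Fin m → K) (E : Fin (m + k) → Fin k → K)
    (hA : ∀ i j, A i j = κ i * κ' j / 2 *
      (qsProd q (2 * h i) (2 * Y + 1) * qsProd q (2 * l j) (2 * Y + 1)) / qs q (2 * h i + 2 * l j))
    (hE : ∀ i c, E i c = κ i * evenFact q (Y + h i) / evenFact q (Y + k - h i) * ε c *
      ((∏ t ∈ Finset.Iio c, qs q (2 * h i - α t)) *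
        ∏ t ∈ Finset.Ioi c, qs q (2 * Y + 2 + 2 * t - 2 * h i))) :
    (Matrix.of fun i => Fin.append (A i) (E i)).det =
      (∏ i, κ i * evenFact q (Y + h i) / evenFact q (Y + k - h i)) *
      (∏ j, κ' j / 2 * evenFact q (Y + k + l j) / evenFact q (Y - l j)) * (∏ c, ε c) *
      (pairProd q (fun i => 2 * (h i : ℤ)) * pairProd q (fun j => 2 * (l j : ℤ)) *
        (∏ c : Fin k, ∏ t ∈ Finset.Ioi c, qs q (2 * Y + 2 + 2 * (t : ℕ) - α c)) /
          ∏ i, ∏ j, qs q (2 * h i + 2 * l j)) := by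
  have hdet := det_cauchy_append hq hqs (fun i => 2 * (h i : ℤ)) (fun j => 2 * (l j : ℤ)) α
    (fun t : Fin k => (2 * Y + 2 + 2 * t : ℤ))
    (fun i j hij => hl.injective (by
      dsimp only at hij
      omega)) hα
    (fun j c => by
      have := hl1 j
      have := hα0 c
      omega)
    (fun i j => by
      have := hl1 j
      omega)
  have hfac : (Matrix.of fun i => Fin.append (A i) (E i)) = Matrix.of fun i j =>
      (κ i * evenFact q (Y + h i) / evenFact q (Y + k - h i)) *
        (Matrix.of fun i j => (Fin.append (fun j => κ' j / 2 * qsProd q (2 * l j) (2 * Y + 1)) ε) j *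
          (Matrix.of fun i : Fin (m + k) => Fin.append
      (fun j : Fin m => (∏ t : Fin k, qs q ((2 * Y + 2 + 2 * t : ℤ) - 2 * h i)) /
        qs q (2 * h i + 2 * l j))
      (fun c => (∏ t ∈ Finset.Iio c, qs q (2 * h i - α t)) *
        ∏ t ∈ Finset.Ioi c, qs q ((2 * Y + 2 + 2 * t : ℤ) - 2 * h i))) i j) i j := by
    ext i j
    simp only [Matrix.of_apply]
    refine Fin.addCases (fun j => ?_) (fun c => ?_) j
    · simp only [Fin.append_left]
      have hne := evenFact_ne_zero hqs (Y + k - h i)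
      have hprod : ∏ t : Fin k, qs q ((2 * Y + 2 + 2 * t : ℤ) - 2 * h i) =
          evenProd q (Y + 1 - h i) k := by
        rw [Fin.prod_univ_eq_prod_range (fun t => qs q ((2 * Y + 2 + 2 * t : ℤ) - 2 * h i))]
        exact Finset.prod_congr rfl fun t _ => congrArg _ (by ring)
      have h4 := evenProd_mul_evenFact (q := q) (Y + 1 - h i) (N := 2 * h i) (M := k)
        (p := Y + h i) (r := Y + k - h i) (by omega) (by have := hhY i; omega)
      have h5 := hqs (2 * h i + 2 * l j) (by have := hl1 j; omega)
      rw [hA, hprod, qsProd_eq_evenProd (i := 2 * h i) (a := Y + 1 - h i) (by push_cast; ring)]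
      field_simp
      linear_combination (κ i * κ' j / 2 * qsProd q (2 * l j) (2 * Y + 1)) * h4
    · simp only [Fin.append_right]
      rw [hE]
      ring
  rw [hfac, Matrix.det_mul_column, Matrix.det_mul_row, hdet]
  have hcol : ∏ j, Fin.append (fun j => κ' j / 2 * qsProd q (2 * l j) (2 * Y + 1)) ε j =
      (∏ j, κ' j / 2 * qsProd q (2 * l j) (2 * Y + 1)) * ∏ c, ε c := by
    rw [Fin.prod_univ_add]
    simp only [Fin.append_left, Fin.append_right]
  have hl' : (∏ j, κ' j / 2 * qsProd q (2 * l j) (2 * Y + 1)) *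
      ∏ j, ∏ t : Fin k, qs q (2 * Y + 2 + 2 * t + 2 * l j) =
      ∏ j, κ' j / 2 * evenFact q (Y + k + l j) / evenFact q (Y - l j) := by
    rw [← Finset.prod_mul_distrib]
    refine Finset.prod_congr rfl fun j _ => ?_
    have hne := evenFact_ne_zero hqs (Y - l j)
    have hY := hlY j
    have hprod : ∏ t : Fin k, qs q (2 * Y + 2 + 2 * t + 2 * l j) =
        evenProd q ((Y + l j : ℕ) + 1) k := by
      rw [Fin.prod_univ_eq_prod_range (fun t => qs q (2 * Y + 2 + 2 * t + 2 * l j))]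
      exact Finset.prod_congr rfl fun t _ => congrArg _ (by push_cast; ring)
    have h4 := evenFact_add (q := q) (Y + l j) k
    have h5 := evenFact_add (q := q) (Y - l j) (2 * l j)
    rw [hprod, qsProd_eq_evenProd (i := 2 * l j) (a := (Y - l j : ℕ) + 1) (by omega), eq_div_iff hne,
      show Y + k + l j = Y + l j + k by ring, h4, show Y + l j = Y - l j + 2 * l j by omega, h5]
    ring
  rw [← hl', hcol]
  ring

/-- The generating function of the region, if there are at least as many upper bumps. -/
theorem gf_regionS_upper (h2 : (2 : K) ≠ 0) (hq : q ≠ 0) (hqs : ∀ a : ℤ, a ≠ 0 → qs q a ≠ 0)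
    {x u d m k : ℕ} {l : Fin m → ℕ} {h : Fin (m + k) → ℕ} (hmd : m ≤ d) (hnu : m + k ≤ u)
    (hl : StrictMono l) (hl1 : ∀ j, 1 ≤ l j) (hld : ∀ j, l j ≤ d)
    (hh : StrictMono h) (hh1 : ∀ j, 1 ≤ h j) (hhu : ∀ j, h j ≤ u) {Y : ℕ}
    (hY : Y = xBar x u d m (m + k) + m) :
    gf (wtFun q) (regionS x u d l h) =
      (∏ i, qsInvFact q (2 * h i) * evenFact q (Y + h i) / evenFact q (Y + k - h i)) *
      (∏ j, qsInvFact q (2 * l j - 1) / 2 * evenFact q (Y + k + l j) / evenFact q (Y - l j)) *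
      (∏ c : Fin k, 2 ^ (c : ℕ) * qs q (2 * Y + 2 + (c : ℕ))) *
      (pairProd q (fun i => 2 * (h i : ℤ)) * pairProd q (fun j => 2 * (l j : ℤ)) *
        (∏ c : Fin k, ∏ t ∈ Finset.Ioi c, qs q (2 * Y + 2 + 2 * (t : ℕ) - (c : ℕ))) /
          ∏ i, ∏ j, qs q (2 * h i + 2 * l j)) := by
  have hYd : d ≤ Y := by
    unfold xBar at hY
    omega
  have hYu : u ≤ Y + k := by
    unfold xBar at hY
    omega
  rw [gf_regionS_eq_det_upper (wtFun q) hmd hnu hl hl1 hld hh hh1 hhu (β := 2 * Y + 2)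
    (by rw [hY])]
  refine det_append_eq hqs hq h l hl hl1 (fun j => (hld j).trans hYd)
    (fun j => (hhu j).trans hYu) (fun c => (c : ℕ))
    (fun a b hab => Fin.ext (by simpa using hab)) (fun c => by positivity)
    (fun i => qsInvFact q (2 * h i)) (fun j => qsInvFact q (2 * l j - 1))
    (fun c => 2 ^ (c : ℕ) * qs q (2 * Y + 2 + (c : ℕ))) _ _ (fun i j => ?_) fun i c => ?_
  · obtain ⟨h', hh'⟩ : ∃ h', h i = h' + 1 := ⟨h i - 1, by have := hh1 i; omega⟩
    obtain ⟨l', hl'⟩ : ∃ l', l j = l' + 1 := ⟨l j - 1, by have := hl1 j; omega⟩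
    rw [hh', hl', show (2 * Y + 2 - 1 : ℤ) = 2 * Y + 1 by ring,
      show 2 * (l' + 1) - 1 = 2 * l' + 1 by omega,
      partialSum_pathFun_mul h2 hq hqs h' l' (by positivity) (by simp)]
    push_cast
    rfl
  · rw [exit_upper h2 hq hqs ((hhu i).trans hYu) c.2,
      prod_fin_Iio (fun t => qs q (2 * h i - (t : ℤ))),
      prod_fin_Ioi (fun t => qs q (2 * Y + 2 + 2 * (t : ℤ) - 2 * h i))]

/-- The generating function of the region, if there are at least as many lower bumps. -/
theorem gf_regionS_lower (h2 : (2 : K) ≠ 0) (hq : q ≠ 0) (hqs : ∀ a : ℤ, a ≠ 0 → qs q a ≠ 0)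
    {x u d n k : ℕ} {l : Fin (n + k) → ℕ} {h : Fin n → ℕ} (hmd : n + k ≤ d) (hnu : n ≤ u)
    (hl : StrictMono l) (hl1 : ∀ j, 1 ≤ l j) (hld : ∀ j, l j ≤ d)
    (hh : StrictMono h) (hh1 : ∀ j, 1 ≤ h j) (hhu : ∀ j, h j ≤ u) {Y : ℕ}
    (hY : Y = xBar x u d (n + k) n + n) :
    gf (wtFun q) (regionS x u d l h) =
      (∏ i, qsInvFact q (2 * l i - 1) * evenFact q (Y + l i) / evenFact q (Y + k - l i)) *
      (∏ j, qsInvFact q (2 * h j) / 2 * evenFact q (Y + k + h j) / evenFact q (Y - h j)) *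
      (∏ c : Fin k, 2 ^ (c : ℕ)) *
      (pairProd q (fun i => 2 * (l i : ℤ)) * pairProd q (fun j => 2 * (h j : ℤ)) *
        (∏ c : Fin k, ∏ t ∈ Finset.Ioi c, qs q (2 * Y + 2 + 2 * (t : ℕ) - (c + 1 : ℕ))) /
          ∏ i, ∏ j, qs q (2 * l i + 2 * h j)) := by
  have hYd : d ≤ Y + k := by
    unfold xBar at hY
    omega
  have hYu : u ≤ Y := by
    unfold xBar at hY
    omega
  rw [gf_regionS_eq_det_lower (wtFun q) hmd hnu hl hl1 hld hh hh1 hhu (β := 2 * Y + 2)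
    (by rw [hY])]
  refine det_append_eq hqs hq l h hh hh1 (fun j => (hhu j).trans hYu)
    (fun j => (hld j).trans hYd) (fun c => (c + 1 : ℕ))
    (fun a b hab => Fin.ext (by simpa using hab)) (fun c => by positivity)
    (fun i => qsInvFact q (2 * l i - 1)) (fun j => qsInvFact q (2 * h j))
    (fun c => 2 ^ (c : ℕ)) _ _ (fun i j => ?_) fun i c => ?_
  · obtain ⟨h', hh'⟩ : ∃ h', h j = h' + 1 := ⟨h j - 1, by have := hh1 j; omega⟩
    obtain ⟨l', hl'⟩ : ∃ l', l i = l' + 1 := ⟨l i - 1, by have := hl1 i; omega⟩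
    rw [hh', hl', show (2 * Y + 2 - 1 : ℤ) = 2 * Y + 1 by ring,
      show 2 * (l' + 1) - 1 = 2 * l' + 1 by omega,
      partialSum_pathFun_mul h2 hq hqs h' l' (by positivity) (by simp)]
    push_cast
    rw [add_comm (2 * ((h' : ℤ) + 1))]
    ring
  · rw [exit_lower h2 hq hqs (hl1 i) ((hld i).trans hYd) c.2,
      prod_fin_Iio (fun t => qs q (2 * l i - ((t + 1 : ℕ) : ℤ))),
      prod_fin_Ioi (fun t => qs q (2 * Y + 2 + 2 * (t : ℤ) - 2 * l i))]

end Evaluation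

/-! ### Evaluation of the constant factor -/

section Constant

variable {M : Type*} [CommMonoid M]

theorem prod_Icc_one (f : ℕ → M) (n : ℕ) :
    ∏ i ∈ Finset.Icc 1 n, f i = ∏ i ∈ Finset.range n, f (i + 1) := by
  induction n with
  | zero => simp
  | succ n ih => rw [Finset.prod_Icc_succ_top (by omega), ih, Finset.prod_range_succ]

/-- The product of the first `p` values of `g`, starting with `g 1`. -/
def factProd (g : ℕ → M) (p : ℕ) : M := ∏ j ∈ Finset.range p, g (j + 1)

theorem factProd_add (g : ℕ → M) (p N : ℕ) :
    factProd g (p + N) = factProd g p * ∏ j ∈ Finset.range N, g (p + j + 1) :=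
  Finset.prod_range_add _ _ _

theorem factProd_succ (g : ℕ → M) (p : ℕ) : factProd g (p + 1) = factProd g p * g (p + 1) :=
  Finset.prod_range_succ _ _

theorem prod_half_eq (g : ℕ → M) (m : ℕ) :
    ∏ i ∈ Finset.Icc 1 ((m + 1) / 2), ∏ j ∈ Finset.Icc 1 (2 * m + 3 - 4 * i), g (2 * i + j - 1) =
      ∏ c ∈ Finset.range m, ∏ j ∈ Finset.range (c + 1), g (c + 2 + j) := by
  induction m using Nat.twoStepInduction generalizing g with
  | zero => simp
  | one => simp
  | more m ih ih' =>
    have h1 := ih fun j => g (j + 2)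
    rw [show (m + 2 + 1) / 2 = (m + 1) / 2 + 1 by omega, prod_Icc_one, Finset.prod_range_succ',
      Finset.prod_range_succ', Finset.prod_range_succ']
    rw [prod_Icc_one] at h1
    have h2 : ∏ i ∈ Finset.range ((m + 1) / 2),
        ∏ j ∈ Finset.Icc 1 (2 * (m + 2) + 3 - 4 * (i + 1 + 1)), g (2 * (i + 1 + 1) + j - 1) =
        ∏ c ∈ Finset.range m, ∏ j ∈ Finset.range (c + 1), g (c + 2 + j + 2) := by
      rw [← h1]
      refine Finset.prod_congr rfl fun i _ => ?_
      rw [show 2 * (m + 2) + 3 - 4 * (i + 1 + 1) = 2 * m + 3 - 4 * (i + 1) by omega]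
      refine Finset.prod_congr rfl fun j _ => congrArg g (by omega)
    have h3 : ∏ c ∈ Finset.range m, ∏ j ∈ Finset.range (c + 1 + 1 + 1), g (c + 1 + 1 + 2 + j) =
        (∏ c ∈ Finset.range m, ∏ j ∈ Finset.range (c + 1), g (c + 2 + j + 2)) *
          ∏ c ∈ Finset.range m, (g (2 * c + 5) * g (2 * c + 6)) := by
      rw [← Finset.prod_mul_distrib]
      refine Finset.prod_congr rfl fun c _ => ?_
      rw [Finset.prod_range_succ, Finset.prod_range_succ, mul_assoc]
      congr 1
      · exact Finset.prod_congr rfl fun j _ => congrArg g (by ring)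
      · congr 2 <;> ring
    have h4 : ∏ j ∈ Finset.Icc 1 (2 * (m + 2) + 3 - 4 * (0 + 1)), g (2 * (0 + 1) + j - 1) =
        (∏ c ∈ Finset.range m, (g (2 * c + 5) * g (2 * c + 6))) * (g 2 * g 3 * g 4) := by
      rw [prod_Icc_one]
      have h5 : ∀ j, g (2 * (0 + 1) + (j + 1) - 1) = g (j + 2) := fun j => congrArg g (by omega)
      simp only [h5]
      rw [show 2 * (m + 2) + 3 - 4 * (0 + 1) = 2 * m + 3 by omega]
      clear h1 h2 h3 ih h5 ih'
      induction m with
      | zero => simp [Finset.prod_range_succ]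
      | succ m ih =>
        rw [show 2 * (m + 1) + 3 = 2 * m + 3 + 1 + 1 by ring, Finset.prod_range_succ,
          Finset.prod_range_succ, ih, Finset.prod_range_succ, show 2 * m + 3 + 2 = 2 * m + 5 by ring,
          show 2 * m + 3 + 1 + 2 = 2 * m + 6 by ring]
        ac_rfl
    rw [h2, h3, h4]
    simp [Finset.prod_range_succ, mul_assoc, mul_comm]

variable {K : Type*} [Field K] {g D : ℕ → K}

theorem factProd_ne_zero (hg : ∀ j, g (j + 1) ≠ 0) (p : ℕ) : factProd g p ≠ 0 :=
  Finset.prod_ne_zero_iff.2 fun _ _ => hg _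

theorem prod_ratio_mul (hg : ∀ j, g (j + 1) ≠ 0) (hD : ∀ p, D (p + 1) = D p * g (2 * p + 2))
    (m n : ℕ) :
    (∏ i ∈ Finset.range m, g (2 * (i + n + 1)) / g (2 * (i + n + 1) + 1)) *
      factProd g (2 * m + 2 * n + 2) * g (2 * m + 2 * n + 2) * D (n + 1) * D n =
      factProd g (2 * n + 2) * D (n + m + 1) ^ 2 := by
  induction m with
  | zero =>
    simp only [Finset.prod_range_zero, mul_zero, zero_add, add_zero, hD]
    ring
  | succ m ih =>
    have h1 := hg (2 * (m + n + 1))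
    rw [Finset.prod_range_succ, show 2 * (m + 1) + 2 * n + 2 = 2 * m + 2 * n + 2 + 1 + 1 by ring,
      factProd_succ, factProd_succ, show n + (m + 1) + 1 = n + m + 1 + 1 by ring, hD (n + m + 1),
      show 2 * (n + m + 1) + 2 = 2 * m + 2 * n + 2 + 1 + 1 by ring]
    rw [show 2 * (m + n + 1) = 2 * m + 2 * n + 2 by ring] at *
    field_simp
    linear_combination g (2 * m + 2 * n + 2 + 1 + 1) ^ 2 * ih

theorem prod_range_sub_div (D : ℕ → K) (m a : ℕ) :
    ∏ c ∈ Finset.range m, D (m - (c + 1)) / D (a + c + 1) =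
      (∏ c ∈ Finset.range m, D c) / ∏ c ∈ Finset.range m, D (a + c + 1) := by
  rw [Finset.prod_div_distrib]
  congr 1
  rw [← Finset.prod_range_reflect D m]
  exact Finset.prod_congr rfl fun c _ => congrArg D (by omega)

theorem constant_eq (hg : ∀ j, g (j + 1) ≠ 0) (hD0 : ∀ p, D p ≠ 0)
    (hD : ∀ p, D (p + 1) = D p * g (2 * p + 2)) (m n : ℕ) :
    (∏ c ∈ Finset.range m, ∏ j ∈ Finset.range (c + 1), g (c + 2 + j)) *
      (∏ i ∈ Finset.range n, g (2 * (m + i + 1))) *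
      (∏ i ∈ Finset.range n, ∏ j ∈ Finset.range (m + i + 1), g (m + (i + 1) + (j + 1))) *
      (∏ i ∈ Finset.range m, ∏ j ∈ Finset.range n,
        g (2 * (i + j + 1)) / g (2 * (i + j + 1) + 1)) *
      (∏ c ∈ Finset.range m, D (m - (c + 1)) / D (n + c + 1)) *
      (∏ c ∈ Finset.range n, D (n - (c + 1)) / D (m + c + 1)) =
    (∏ c ∈ Finset.range m, factProd g (2 * c + 1)) * (∏ c ∈ Finset.range n, factProd g (2 * c + 2)) /
      ∏ j ∈ Finset.range (m + n), factProd g (j + 1) := by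
  have hI := factProd_ne_zero hg
  rw [prod_range_sub_div, prod_range_sub_div]
  have hP : ∀ (f : ℕ → ℕ) (s : Finset ℕ), ∏ c ∈ s, D (f c) ≠ 0 := fun f s =>
    Finset.prod_ne_zero_iff.2 fun c _ => hD0 _
  have hQ : ∀ (f : ℕ → ℕ) (s : Finset ℕ), ∏ c ∈ s, factProd g (f c) ≠ 0 := fun f s =>
    Finset.prod_ne_zero_iff.2 fun c _ => hI _
  induction n with
  | zero =>
    have h1 : (∏ c ∈ Finset.range m, ∏ j ∈ Finset.range (c + 1), g (c + 2 + j)) *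
        (∏ c ∈ Finset.range m, factProd g (c + 1)) * D 0 =
        (∏ c ∈ Finset.range m, factProd g (2 * c + 1)) * D m := by
      induction m with
      | zero => simp
      | succ m ih =>
        have h2 := factProd_add g (m + 1) (m + 1)
        rw [show m + 1 + (m + 1) = 2 * m + 1 + 1 by ring, factProd_succ] at h2
        have h3 : ∀ j, g (m + 1 + j + 1) = g (m + 2 + j) := fun j => congrArg g (by ring)
        simp only [h3] at h2
        rw [Finset.prod_range_succ (fun c => ∏ j ∈ Finset.range (c + 1), g (c + 2 + j)),
          Finset.prod_range_succ (fun c => factProd g (c + 1)),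
          Finset.prod_range_succ (fun c => factProd g (2 * c + 1)), hD]
        linear_combination (factProd g (m + 1) *
          ∏ j ∈ Finset.range (m + 1), g (m + 2 + j)) * ih -
          ((∏ c ∈ Finset.range m, factProd g (2 * c + 1)) * D m) * h2
    have h4 := hP (fun c => 0 + c + 1) (Finset.range m)
    have h5 : (∏ c ∈ Finset.range m, D c) * D m = (∏ c ∈ Finset.range m, D (0 + c + 1)) * D 0 := by
      simp only [zero_add]
      rw [← Finset.prod_range_succ, ← Finset.prod_range_succ']
    have h6 := hQ (fun c => c + 1) (Finset.range m)
    simp only [Finset.prod_range_zero, mul_one, add_zero, Finset.prod_const_one, div_one]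
    rw [eq_div_iff h6, mul_div_assoc', div_mul_eq_mul_div, div_eq_iff h4]
    refine mul_right_cancel₀ (mul_ne_zero (hD0 0) (hD0 m)) ?_
    linear_combination (∏ c ∈ Finset.range m, D c) * D m * h1 +
      (∏ c ∈ Finset.range m, factProd g (2 * c + 1)) * D m * h5
  | succ n ih =>
    have h1 := prod_ratio_mul (D := D) hg hD m n
    have h2 := factProd_add g (m + n + 1) (m + n + 1)
    simp only [add_assoc _ _ 1] at h2
    simp only [← add_assoc m n 1] at h2
    rw [show m + n + 1 + (m + n + 1) = 2 * m + 2 * n + 2 by ring] at h2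
    have h4 : (∏ i ∈ Finset.range m, ∏ j ∈ Finset.range (n + 1),
        g (2 * (i + j + 1)) / g (2 * (i + j + 1) + 1)) =
        (∏ i ∈ Finset.range m, ∏ j ∈ Finset.range n,
          g (2 * (i + j + 1)) / g (2 * (i + j + 1) + 1)) *
        ∏ i ∈ Finset.range m, g (2 * (i + n + 1)) / g (2 * (i + n + 1) + 1) := by
      rw [← Finset.prod_mul_distrib]
      exact Finset.prod_congr rfl fun i _ => Finset.prod_range_succ _ _
    have h5 : (∏ c ∈ Finset.range m, D (n + 1 + c + 1)) * D (n + 1) =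
        (∏ c ∈ Finset.range m, D (n + c + 1)) * D (n + m + 1) := by
      have h6 := Finset.prod_range_succ (fun c => D (n + c + 1)) m
      rw [Finset.prod_range_succ'] at h6
      have h7 : ∀ c, D (n + (c + 1) + 1) = D (n + 1 + c + 1) := fun c => congrArg D (by ring)
      simp only [h7] at h6
      exact h6
    rw [h4, Finset.prod_range_succ _ n, Finset.prod_range_succ _ n, Finset.prod_range_succ _ n,
      Finset.prod_range_succ _ n, Finset.prod_range_succ _ n, ← add_assoc m n 1,
      Finset.prod_range_succ (fun j => factProd g (j + 1))]
    set R := ∏ i ∈ Finset.range m, g (2 * (i + n + 1)) / g (2 * (i + n + 1) + 1)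
    set J := ∏ j ∈ Finset.range (m + n + 1), g (m + n + 1 + (j + 1))
    have n1 := hP (fun c => n + c + 1) (Finset.range m)
    have n2 := hP (fun c => n + 1 + c + 1) (Finset.range m)
    have n3 := hP (fun c => m + c + 1) (Finset.range n)
    have n4 := hQ (fun c => c + 1) (Finset.range (m + n))
    have n5 := hI (m + n + 1)
    have n6 := hD0 (m + n + 1)
    have n7 := hD0 (n + 1)
    rw [show n + m + 1 = m + n + 1 by ring] at h1 h5
    rw [h2] at h1
    have h8 : R * J * g (2 * m + 2 * n + 2) * D (n + 1) * D n * factProd g (m + n + 1) =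
        factProd g (2 * n + 2) * D (m + n + 1) ^ 2 := by
      linear_combination h1
    rw [show 2 * (m + n + 1) = 2 * m + 2 * n + 2 by ring]
    have h9 : ∏ c ∈ Finset.range m, D (n + 1 + c + 1) =
        (∏ c ∈ Finset.range m, D (n + c + 1)) * D (m + n + 1) / D (n + 1) :=
      (eq_div_iff n7).2 h5
    rw [h9]
    set A1 := ∏ c ∈ Finset.range m, ∏ j ∈ Finset.range (c + 1), g (c + 2 + j)
    set A2 := ∏ i ∈ Finset.range n, g (2 * (m + i + 1))
    set A3 := ∏ i ∈ Finset.range n, ∏ j ∈ Finset.range (m + i + 1), g (m + (i + 1) + (j + 1))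
    set A4 := ∏ i ∈ Finset.range m, ∏ j ∈ Finset.range n,
      g (2 * (i + j + 1)) / g (2 * (i + j + 1) + 1)
    have h10 : A1 * (A2 * g (2 * m + 2 * n + 2)) * (A3 * J) * (A4 * R) *
        ((∏ c ∈ Finset.range m, D c) / ((∏ c ∈ Finset.range m, D (n + c + 1)) *
          D (m + n + 1) / D (n + 1))) *
        ((∏ c ∈ Finset.range n, D c) * D n / ((∏ c ∈ Finset.range n, D (m + c + 1)) *
          D (m + n + 1))) =
        (A1 * A2 * A3 * A4 *
          ((∏ c ∈ Finset.range m, D c) / ∏ c ∈ Finset.range m, D (n + c + 1)) *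
          ((∏ c ∈ Finset.range n, D c) / ∏ c ∈ Finset.range n, D (m + c + 1))) *
        (R * J * g (2 * m + 2 * n + 2) * D (n + 1) * D n * factProd g (m + n + 1)) /
          (D (m + n + 1) ^ 2 * factProd g (m + n + 1)) := by
      field_simp
    rw [h10, ih, h8]
    field_simp

theorem prod_factProd_eq (g : ℕ → K) (m : ℕ) :
    (∏ c ∈ Finset.range m, factProd g (2 * c + 1)) * (∏ c ∈ Finset.range m, factProd g (2 * c + 2)) =
      ∏ j ∈ Finset.range (2 * m), factProd g (j + 1) := by
  induction m with
  | zero => simp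
  | succ m ih =>
    rw [Finset.prod_range_succ, Finset.prod_range_succ,
      show 2 * (m + 1) = 2 * m + 1 + 1 by ring, Finset.prod_range_succ, Finset.prod_range_succ, ← ih]
    ring

theorem constant_eq_upper (hg : ∀ j, g (j + 1) ≠ 0) (m k : ℕ) :
    (∏ c ∈ Finset.range m, factProd g (2 * c + 1)) *
      (∏ c ∈ Finset.range (m + k), factProd g (2 * c + 2)) /
      ∏ j ∈ Finset.range (m + (m + k)), factProd g (j + 1) =
    ∏ t ∈ Finset.range k, ∏ j ∈ Finset.range (t + 1), g (2 * m + 2 + t + j) := by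
  have hQ : ∀ (f : ℕ → ℕ) (s : Finset ℕ), ∏ c ∈ s, factProd g (f c) ≠ 0 := fun f s =>
    Finset.prod_ne_zero_iff.2 fun c _ => factProd_ne_zero hg _
  rw [div_eq_iff (hQ _ _)]
  induction k with
  | zero => rw [Finset.prod_range_zero, one_mul, add_zero, prod_factProd_eq, two_mul]
  | succ k ih =>
    have h2 := factProd_add g (m + (m + k) + 1) (k + 1)
    rw [show m + (m + k) + 1 + (k + 1) = 2 * (m + k) + 2 by ring] at h2
    have h3 : ∀ j, g (m + (m + k) + 1 + j + 1) = g (2 * m + 2 + k + j) := fun j =>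
      congrArg g (by ring)
    simp only [h3] at h2
    rw [← add_assoc m k 1, ← add_assoc m (m + k) 1,
      Finset.prod_range_succ (fun c => factProd g (2 * c + 2)),
      Finset.prod_range_succ (fun t => ∏ j ∈ Finset.range (t + 1), g (2 * m + 2 + t + j)),
      Finset.prod_range_succ (fun j => factProd g (j + 1)), h2]
    linear_combination (factProd g (m + (m + k) + 1) *
      ∏ j ∈ Finset.range (k + 1), g (2 * m + 2 + k + j)) * ih

theorem constant_eq_lower (hg : ∀ j, g (j + 1) ≠ 0) (n k : ℕ) :
    (∏ c ∈ Finset.range (n + k), factProd g (2 * c + 1)) *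
      (∏ c ∈ Finset.range n, factProd g (2 * c + 2)) /
      ∏ j ∈ Finset.range (n + k + n), factProd g (j + 1) =
    ∏ t ∈ Finset.range k, ∏ j ∈ Finset.range t, g (2 * n + 2 + t + j) := by
  have hQ : ∀ (f : ℕ → ℕ) (s : Finset ℕ), ∏ c ∈ s, factProd g (f c) ≠ 0 := fun f s =>
    Finset.prod_ne_zero_iff.2 fun c _ => factProd_ne_zero hg _
  rw [div_eq_iff (hQ _ _)]
  induction k with
  | zero => rw [Finset.prod_range_zero, one_mul, add_zero, prod_factProd_eq, two_mul]
  | succ k ih =>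
    have h2 := factProd_add g (n + k + n + 1) k
    rw [show n + k + n + 1 + k = 2 * (n + k) + 1 by ring] at h2
    have h3 : ∀ j, g (n + k + n + 1 + j + 1) = g (2 * n + 2 + k + j) := fun j =>
      congrArg g (by ring)
    simp only [h3] at h2
    rw [← add_assoc, add_right_comm (n + k) 1 n,
      Finset.prod_range_succ (fun c => factProd g (2 * c + 1)),
      Finset.prod_range_succ (fun t => ∏ j ∈ Finset.range t, g (2 * n + 2 + t + j)),
      Finset.prod_range_succ (fun j => factProd g (j + 1)), h2]
    linear_combination (factProd g (n + k + n + 1) *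
      ∏ j ∈ Finset.range k, g (2 * n + 2 + k + j)) * ih

end Constant

/-! ### The product formula in terms of symmetric `q`-integers -/

section SymmetricProduct

variable {K : Type*} [Field K] {q : K} {m n : ℕ}

/-- The factors of the product formula that contain differences and sums of the parameters. -/
noncomputable def parameterProd (b : ℕ → K) (l : Fin m → ℕ) (h : Fin n → ℕ) : K :=
  ((∏ i : Fin m, ∏ j ∈ Finset.Ioi i, b (2 * (l j - l i)))
      * ∏ i : Fin n, ∏ j ∈ Finset.Ioi i, b (2 * (h j - h i)))
    / ((∏ i : Fin m, ∏ j : Fin n, b (2 * (l i + h j)))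
      * (∏ i : Fin m, ∏ a ∈ Finset.Icc 1 (2 * l i - 1), b a)
      * ∏ j : Fin n, ∏ a ∈ Finset.Icc 1 (2 * h j), b a)

/-- The factors of the product formula that depend on the numbers of the parameters only. -/
noncomputable def constantProd (b : ℕ → K) (X m n : ℕ) : K :=
  (∏ i ∈ Finset.Icc 1 ((m + 1) / 2), ∏ j ∈ Finset.Icc 1 (2 * m + 3 - 4 * i),
      b (2 * X + 2 * i + j - 1))
    * (∏ i ∈ Finset.Icc 1 n, b (2 * (X + m + i)))
    * (∏ i ∈ Finset.Icc 1 n, ∏ j ∈ Finset.Icc 1 (m + i), b (2 * X + m + i + j))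
    * (∏ i ∈ Finset.Icc 1 m, ∏ j ∈ Finset.Icc 1 n,
        b (2 * (X + i + j - 1)) / b (2 * (X + i + j - 1) + 1))

/-- The factors of the product formula attached to one family of parameters. -/
noncomputable def singleProd (b : ℕ → K) (X m n : ℕ) (l : Fin m → ℕ) : K :=
  ∏ i : Fin m, ∏ j ∈ Finset.Icc 1 (l i - (i + 1)),
    (b (2 * (X + (i + 1) + j + n)) * b (2 * (X + m + 1 - (i + 1) - j)))

theorem prodP_eq (q : K) (x u d : ℕ) (l : Fin m → ℕ) (h : Fin n → ℕ) :
    prodP q x u d l h = (2 : K) ^ (-expF l h) * (q ^ (-expE x u d l h) *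
      (parameterProd (qInt (q ^ 2)) l h * constantProd (qInt (q ^ 2)) (xBar x u d m n) m n *
        singleProd (qInt (q ^ 2)) (xBar x u d m n) m n l *
        singleProd (qInt (q ^ 2)) (xBar x u d m n) n m h)) := by
  simp only [prodP, parameterProd, constantProd, singleProd, qFact]
  ring

theorem qsInvFact_eq (r : ℕ) :
    qsInvFact q r = ((2 : K) ^ r * ∏ a ∈ Finset.Icc 1 r, qs q a)⁻¹ := by
  rw [qsInvFact, prod_Icc_one, ← Finset.card_range r, ← Finset.prod_const, Finset.card_range,
    ← Finset.prod_mul_distrib, ← Finset.prod_inv_distrib]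
  push_cast
  rfl

theorem prod_pair_eq (hqs : ∀ a : ℤ, a ≠ 0 → qs q a ≠ 0) (X m n c : ℕ) {l : ℕ} (hcl : c ≤ l)
    (hl : l ≤ X + m) :
    ∏ j ∈ Finset.Icc 1 (l - c),
      (qs q (2 * (X + c + j + n) : ℕ) * qs q (2 * (X + m + 1 - c - j) : ℕ)) =
      evenFact q (X + n + l) / evenFact q (X + n + c) *
        (evenFact q (X + m - c) / evenFact q (X + m - l)) := by
  obtain ⟨N, rfl⟩ := Nat.exists_eq_add_of_le hcl
  rw [Nat.add_sub_cancel_left]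
  induction N with
  | zero =>
    simp only [add_zero, Finset.Icc_eq_empty_of_lt zero_lt_one, Finset.prod_empty]
    rw [div_self (evenFact_ne_zero hqs _), div_self (evenFact_ne_zero hqs _), mul_one]
  | succ N ih =>
    have h1 := evenFact_succ (q := q) (X + n + (c + N))
    have h2 := evenFact_succ (q := q) (X + m - (c + (N + 1)))
    rw [show X + m - (c + (N + 1)) + 1 = X + m - (c + N) by omega] at h2
    have n1 := evenFact_ne_zero hqs (X + n + c)
    have n2 := evenFact_ne_zero hqs (X + m - (c + N))
    have n3 := evenFact_ne_zero hqs (X + m - (c + (N + 1)))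
    have e1 : qs q (2 * (X + c + (N + 1) + n) : ℕ) =
        qs q (2 * (((X + n + (c + N) : ℕ) : ℤ) + 1)) := by
      congr 1
      push_cast
      ring
    have e2 : qs q (2 * (X + m + 1 - c - (N + 1)) : ℕ) =
        qs q (2 * (((X + m - (c + (N + 1)) : ℕ) : ℤ) + 1)) := by
      congr 1
      omega
    rw [Finset.prod_Icc_succ_top (by omega), ih (by omega) (by omega), e1, e2, ← add_assoc c N 1,
      ← add_assoc (X + n) (c + N) 1, h1]
    rw [← add_assoc c N 1] at h2 n3
    have n4 := right_ne_zero_of_mul (h2 ▸ n2)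
    rw [h2]
    field_simp

theorem singleProd_eq (hqs : ∀ a : ℤ, a ≠ 0 → qs q a ≠ 0) (X m n : ℕ) {l : Fin m → ℕ}
    (hl : ∀ i : Fin m, i + 1 ≤ l i) (hlX : ∀ i, l i ≤ X + m) :
    singleProd (fun k => qs q k) X m n l =
      (∏ i, evenFact q (X + n + l i) / evenFact q (X + m - l i)) *
        ∏ c ∈ Finset.range m, evenFact q (X + (m - (c + 1))) / evenFact q (X + (n + c + 1)) := by
  rw [← Fin.prod_univ_eq_prod_range
    (fun c => evenFact q (X + (m - (c + 1))) / evenFact q (X + (n + c + 1))),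
    ← Finset.prod_mul_distrib, singleProd]
  refine Finset.prod_congr rfl fun i _ => ?_
  rw [prod_pair_eq hqs X m n (i + 1) (hl i) (hlX i), show X + m - (i + 1) = X + (m - (i + 1)) by
    have := i.2
    omega, show X + (n + i + 1) = X + n + (i + 1) by ring]
  ring

theorem constantProd_eq_range (b : ℕ → K) (X m n : ℕ) :
    constantProd b X m n =
      (∏ c ∈ Finset.range m, ∏ j ∈ Finset.range (c + 1), b (2 * X + (c + 2 + j))) *
      (∏ i ∈ Finset.range n, b (2 * X + 2 * (m + i + 1))) *
      (∏ i ∈ Finset.range n, ∏ j ∈ Finset.range (m + i + 1),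
        b (2 * X + (m + (i + 1) + (j + 1)))) *
      (∏ i ∈ Finset.range m, ∏ j ∈ Finset.range n,
        b (2 * X + 2 * (i + j + 1)) / b (2 * X + (2 * (i + j + 1) + 1))) := by
  rw [constantProd]
  congr 1
  · congr 1
    · congr 1
      · refine Eq.trans ?_ (prod_half_eq (fun j : ℕ => b (2 * X + j)) m)
        refine Finset.prod_congr rfl fun i hi => Finset.prod_congr rfl fun j hj => ?_
        rw [Finset.mem_Icc] at hi hj
        rw [show 2 * X + 2 * i + j - 1 = 2 * X + (2 * i + j - 1) by omega]
      · rw [prod_Icc_one]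
        refine Finset.prod_congr rfl fun i _ => ?_
        rw [show 2 * (X + m + (i + 1)) = 2 * X + 2 * (m + i + 1) by ring]
    · rw [prod_Icc_one]
      refine Finset.prod_congr rfl fun i _ => ?_
      rw [prod_Icc_one]
      refine Finset.prod_congr rfl fun j _ => ?_
      rw [show 2 * X + m + (i + 1) + (j + 1) = 2 * X + (m + (i + 1) + (j + 1)) by ring]
  · rw [prod_Icc_one]
    refine Finset.prod_congr rfl fun i _ => ?_
    rw [prod_Icc_one]
    refine Finset.prod_congr rfl fun j _ => ?_
    rw [show 2 * (X + (i + 1) + (j + 1) - 1) = 2 * X + 2 * (i + j + 1) by omega,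
      add_assoc (2 * X)]

theorem constantProd_eq (hqs : ∀ a : ℤ, a ≠ 0 → qs q a ≠ 0) (X m n : ℕ) :
    constantProd (fun k => qs q k) X m n *
      (∏ c ∈ Finset.range m, evenFact q (X + (m - (c + 1))) / evenFact q (X + (n + c + 1))) *
      (∏ c ∈ Finset.range n, evenFact q (X + (n - (c + 1))) / evenFact q (X + (m + c + 1))) =
    (∏ c ∈ Finset.range m, factProd (fun j : ℕ => qs q (2 * X + j : ℕ)) (2 * c + 1)) *
      (∏ c ∈ Finset.range n, factProd (fun j : ℕ => qs q (2 * X + j : ℕ)) (2 * c + 2)) /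
      ∏ j ∈ Finset.range (m + n), factProd (fun j : ℕ => qs q (2 * X + j : ℕ)) (j + 1) := by
  rw [← constant_eq (D := fun p => evenFact q (X + p)) (fun j => hqs _ (by positivity))
    (fun p => evenFact_ne_zero hqs _) (fun p => by
      rw [← add_assoc, evenFact_succ]
      congr 2
      push_cast
      ring) m n, constantProd_eq_range]

theorem prod_qs_two_mul_sub {l : Fin m → ℕ} (hl : StrictMono l) :
    ∏ i : Fin m, ∏ j ∈ Finset.Ioi i, qs q (2 * (l j - l i) : ℕ) =
      pairProd q fun i => 2 * (l i : ℤ) := by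
  rw [pairProd]
  refine Finset.prod_congr rfl fun i _ => Finset.prod_congr rfl fun j hj => congrArg _ ?_
  have := hl (Finset.mem_Ioi.1 hj)
  omega

theorem sum_range_succ_mul_two (n : ℕ) : (∑ i : Fin n, ((i : ℤ) + 1)) * 2 = n * (n + 1) := by
  rw [Fin.sum_univ_eq_sum_range (fun i : ℕ => (i : ℤ) + 1)]
  induction n with
  | zero => simp
  | succ n ih =>
    rw [Finset.sum_range_succ, add_mul, ih]
    push_cast
    ring

theorem expF_upper {k : ℕ} (l : Fin m → ℕ) (h : Fin (m + k) → ℕ) :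
    -expF l h = (∑ c : Fin k, (c : ℕ) : ℕ) - (∑ i, 2 * l i : ℕ) - (∑ i, 2 * h i : ℕ) := by
  have h1 := sum_range_succ_mul_two m
  have h2 := sum_range_succ_mul_two (m + k)
  have h3 := sum_range_succ_mul_two k
  rw [Finset.sum_add_distrib] at h3
  simp only [Finset.sum_const, Finset.card_univ, Fintype.card_fin, nsmul_eq_mul, mul_one] at h3
  rw [expF, Finset.sum_sub_distrib, Finset.sum_sub_distrib]
  push_cast at *
  refine mul_right_cancel₀ (two_ne_zero (α := ℤ)) ?_
  linear_combination h1 + h2 - h3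

theorem expF_lower {k : ℕ} (l : Fin (n + k) → ℕ) (h : Fin n → ℕ) :
    -expF l h = (∑ c : Fin k, (c : ℕ) : ℕ) + k - (∑ i, 2 * l i : ℕ) - (∑ i, 2 * h i : ℕ) := by
  have h1 := sum_range_succ_mul_two n
  have h2 := sum_range_succ_mul_two (n + k)
  have h3 := sum_range_succ_mul_two k
  rw [Finset.sum_add_distrib] at h3
  simp only [Finset.sum_const, Finset.card_univ, Fintype.card_fin, nsmul_eq_mul, mul_one] at h3
  rw [expF, Finset.sum_sub_distrib, Finset.sum_sub_distrib]
  push_cast at *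
  refine mul_right_cancel₀ (two_ne_zero (α := ℤ)) ?_
  linear_combination h1 + h2 - h3

theorem add_one_le_of_strictMono {l : Fin m → ℕ} (hl : StrictMono l) (hl1 : ∀ i, 1 ≤ l i)
    (i : Fin m) : (i : ℕ) + 1 ≤ l i := by
  obtain ⟨i, hi⟩ := i
  induction i with
  | zero => exact hl1 _
  | succ i ih => exact (ih (by omega)).trans_lt (hl (Fin.mk_lt_mk.2 i.lt_succ_self))

/-- The product formula, apart from powers of `2` and `q`. -/
theorem symmetricProd_eq (hqs : ∀ a : ℤ, a ≠ 0 → qs q a ≠ 0) (X : ℕ) {l : Fin m → ℕ}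
    {h : Fin n → ℕ} (hl : StrictMono l) (hlX : ∀ i, l i ≤ X + m) (hl1 : ∀ i, 1 ≤ l i)
    (hh : StrictMono h) (hhX : ∀ i, h i ≤ X + n) (hh1 : ∀ i, 1 ≤ h i) :
    parameterProd (fun k => qs q k) l h * constantProd (fun k => qs q k) X m n *
        singleProd (fun k => qs q k) X m n l * singleProd (fun k => qs q k) X n m h =
      (∏ i, evenFact q (X + n + l i) / evenFact q (X + m - l i) /
        ∏ a ∈ Finset.Icc 1 (2 * l i - 1), qs q a) *
      (∏ j, evenFact q (X + m + h j) / evenFact q (X + n - h j) /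
        ∏ a ∈ Finset.Icc 1 (2 * h j), qs q a) *
      (pairProd q (fun i => 2 * (l i : ℤ)) * pairProd q (fun i => 2 * (h i : ℤ)) /
        ∏ i, ∏ j, qs q (2 * l i + 2 * h j)) *
      ((∏ c ∈ Finset.range m, factProd (fun j : ℕ => qs q (2 * X + j : ℕ)) (2 * c + 1)) *
      (∏ c ∈ Finset.range n, factProd (fun j : ℕ => qs q (2 * X + j : ℕ)) (2 * c + 2)) /
      ∏ j ∈ Finset.range (m + n), factProd (fun j : ℕ => qs q (2 * X + j : ℕ)) (j + 1)) := by
  rw [← constantProd_eq hqs, singleProd_eq hqs X m n (add_one_le_of_strictMono hl hl1) hlX,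
    singleProd_eq hqs X n m (add_one_le_of_strictMono hh hh1) hhX, parameterProd, prod_qs_two_mul_sub hl,
    prod_qs_two_mul_sub hh, Finset.prod_div_distrib (f := fun i =>
      evenFact q (X + n + l i) / evenFact q (X + m - l i)),
    Finset.prod_div_distrib (f := fun i =>
      evenFact q (X + m + h i) / evenFact q (X + n - h i))]
  have h1 : ∀ i j, qs q (2 * (l i + h j) : ℕ) = qs q (2 * l i + 2 * h j) := fun i j => by
    congr 1
    push_cast
    ring
  simp only [h1]
  ring

theorem prod_Ioi_comm {k : ℕ} (f : Fin k → Fin k → K) :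
    ∏ c, ∏ t ∈ Finset.Ioi c, f c t = ∏ t, ∏ c ∈ Finset.Iio t, f c t :=
  Finset.prod_comm' (by simp)

theorem gf_eq_upper (h2 : (2 : K) ≠ 0) (hq : q ≠ 0) (hqs : ∀ a : ℤ, a ≠ 0 → qs q a ≠ 0)
    {x u d k : ℕ} {l : Fin m → ℕ} {h : Fin (m + k) → ℕ} (hmd : m ≤ d) (hnu : m + k ≤ u)
    (hl : StrictMono l) (hl1 : ∀ j, 1 ≤ l j) (hld : ∀ j, l j ≤ d)
    (hh : StrictMono h) (hh1 : ∀ j, 1 ≤ h j) (hhu : ∀ j, h j ≤ u) {X : ℕ}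
    (hX : X = xBar x u d m (m + k)) :
    gf (wtFun q) (regionS x u d l h) = (2 : K) ^ (-expF l h) *
      (parameterProd (fun k => qs q k) l h * constantProd (fun k => qs q k) X m (m + k) *
        singleProd (fun k => qs q k) X m (m + k) l *
        singleProd (fun k => qs q k) X (m + k) m h) := by
  have hXd : d ≤ X + m := by
    unfold xBar at hX
    omega
  have hXu : u ≤ X + (m + k) := by
    unfold xBar at hX
    omega
  rw [gf_regionS_upper h2 hq hqs hmd hnu hl hl1 hld hh hh1 hhu (Y := X + m) (by rw [hX]),
    symmetricProd_eq hqs X hl (fun i => (hld i).trans hXd) hl1 hh (fun i => (hhu i).trans hXu) hh1,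
    constant_eq_upper (fun j => hqs _ (by positivity)), expF_upper, zpow_sub₀ h2, zpow_sub₀ h2,
    zpow_natCast, zpow_natCast, zpow_natCast, ← Finset.prod_pow_eq_pow_sum,
    ← Finset.prod_pow_eq_pow_sum, ← Finset.prod_pow_eq_pow_sum, prod_Ioi_comm]
  have e1 : ∏ i, qsInvFact q (2 * h i) * evenFact q (X + m + h i) / evenFact q (X + m + k - h i) =
      (∏ j, evenFact q (X + m + h j) / evenFact q (X + (m + k) - h j) /
        ∏ a ∈ Finset.Icc 1 (2 * h j), qs q a) / ∏ i, 2 ^ (2 * h i) := by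
    rw [← Finset.prod_div_distrib]
    refine Finset.prod_congr rfl fun i _ => ?_
    rw [qsInvFact_eq, add_assoc X m k]
    ring
  have e2 : ∏ i, qsInvFact q (2 * l i - 1) / 2 * evenFact q (X + m + k + l i) /
        evenFact q (X + m - l i) =
      (∏ i, evenFact q (X + (m + k) + l i) / evenFact q (X + m - l i) /
        ∏ a ∈ Finset.Icc 1 (2 * l i - 1), qs q a) / ∏ i, 2 ^ (2 * l i) := by
    rw [← Finset.prod_div_distrib]
    refine Finset.prod_congr rfl fun i _ => ?_
    have h3 : (2 : K) ^ (2 * l i) = 2 ^ (2 * l i - 1) * 2 := by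
      rw [← pow_succ]
      congr 1
      have := hl1 i
      omega
    rw [qsInvFact_eq, add_assoc X m k, h3]
    ring
  have e3 : ∏ i, ∏ j, qs q (2 * (h i : ℤ) + 2 * l j) = ∏ i, ∏ j, qs q (2 * (l i : ℤ) + 2 * h j) := by
    rw [Finset.prod_comm]
    simp only [add_comm]
  have e4 : (∏ c : Fin k, 2 ^ (c : ℕ) * qs q (2 * (X + m : ℕ) + 2 + (c : ℕ))) *
      ∏ t : Fin k, ∏ c ∈ Finset.Iio t, qs q (2 * (X + m : ℕ) + 2 + 2 * (t : ℕ) - (c : ℕ)) =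
      (∏ c : Fin k, 2 ^ (c : ℕ)) * ∏ t ∈ Finset.range k, ∏ j ∈ Finset.range (t + 1),
        qs q (2 * X + (2 * m + 2 + t + j) : ℕ) := by
    rw [Finset.prod_mul_distrib, mul_assoc, ← Finset.prod_mul_distrib,
      ← Fin.prod_univ_eq_prod_range (fun t => ∏ j ∈ Finset.range (t + 1),
        qs q (2 * X + (2 * m + 2 + t + j) : ℕ))]
    congr 1
    refine Finset.prod_congr rfl fun t _ => ?_
    rw [prod_fin_Iio (fun c => qs q (2 * (X + m : ℕ) + 2 + 2 * (t : ℕ) - (c : ℕ))),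
      ← Finset.prod_range_reflect, Finset.prod_range_succ', mul_comm]
    congr 1
    · refine Finset.prod_congr rfl fun c hc => congrArg _ ?_
      rw [Finset.mem_range] at hc
      omega
    · congr 1
      push_cast
      ring
  rw [e1, e2, e3]
  linear_combination ((∏ j, evenFact q (X + m + h j) / evenFact q (X + (m + k) - h j) /
        ∏ a ∈ Finset.Icc 1 (2 * h j), qs q a) / (∏ i, 2 ^ (2 * h i)) *
      ((∏ i, evenFact q (X + (m + k) + l i) / evenFact q (X + m - l i) /
        ∏ a ∈ Finset.Icc 1 (2 * l i - 1), qs q a) / ∏ i, 2 ^ (2 * l i)) *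
      (pairProd q (fun i => 2 * (l i : ℤ)) * pairProd q (fun i => 2 * (h i : ℤ)) /
        ∏ i, ∏ j, qs q (2 * l i + 2 * h j))) * e4

theorem gf_eq_lower (h2 : (2 : K) ≠ 0) (hq : q ≠ 0) (hqs : ∀ a : ℤ, a ≠ 0 → qs q a ≠ 0)
    {x u d k : ℕ} {l : Fin (n + k) → ℕ} {h : Fin n → ℕ} (hmd : n + k ≤ d) (hnu : n ≤ u)
    (hl : StrictMono l) (hl1 : ∀ j, 1 ≤ l j) (hld : ∀ j, l j ≤ d)
    (hh : StrictMono h) (hh1 : ∀ j, 1 ≤ h j) (hhu : ∀ j, h j ≤ u) {X : ℕ}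
    (hX : X = xBar x u d (n + k) n) :
    gf (wtFun q) (regionS x u d l h) = (2 : K) ^ (-expF l h) *
      (parameterProd (fun k => qs q k) l h * constantProd (fun k => qs q k) X (n + k) n *
        singleProd (fun k => qs q k) X (n + k) n l *
        singleProd (fun k => qs q k) X n (n + k) h) := by
  have hXd : d ≤ X + (n + k) := by
    unfold xBar at hX
    omega
  have hXu : u ≤ X + n := by
    unfold xBar at hX
    omega
  rw [gf_regionS_lower h2 hq hqs hmd hnu hl hl1 hld hh hh1 hhu (Y := X + n) (by rw [hX]),
    symmetricProd_eq hqs X hl (fun i => (hld i).trans hXd) hl1 hh (fun i => (hhu i).trans hXu) hh1,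
    constant_eq_lower (fun j => hqs _ (by positivity)), expF_lower, zpow_sub₀ h2, zpow_sub₀ h2,
    zpow_add₀ h2,
    zpow_natCast, zpow_natCast, zpow_natCast, zpow_natCast, ← Finset.prod_pow_eq_pow_sum,
    ← Finset.prod_pow_eq_pow_sum, ← Finset.prod_pow_eq_pow_sum, prod_Ioi_comm]
  have e1 : (∏ j, qsInvFact q (2 * h j) / 2 * evenFact q (X + n + k + h j) /
        evenFact q (X + n - h j)) * 2 ^ n =
      (∏ j, evenFact q (X + (n + k) + h j) / evenFact q (X + n - h j) /
        ∏ a ∈ Finset.Icc 1 (2 * h j), qs q a) / ∏ i, 2 ^ (2 * h i) := by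
    rw [← Finset.prod_div_distrib]
    conv_lhs => rw [← Fin.prod_const, ← Finset.prod_mul_distrib]
    refine Finset.prod_congr rfl fun i _ => ?_
    rw [qsInvFact_eq, add_assoc X n k]
    field_simp
  have e2 : ∏ i, qsInvFact q (2 * l i - 1) * evenFact q (X + n + l i) /
        evenFact q (X + n + k - l i) =
      (∏ i, evenFact q (X + n + l i) / evenFact q (X + (n + k) - l i) /
        ∏ a ∈ Finset.Icc 1 (2 * l i - 1), qs q a) / (∏ i, 2 ^ (2 * l i)) * 2 ^ (n + k) := by
    rw [← Finset.prod_div_distrib]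
    conv_rhs => rw [← Fin.prod_const, ← Finset.prod_mul_distrib]
    refine Finset.prod_congr rfl fun i _ => ?_
    have h3 : (2 : K) ^ (2 * l i) = 2 ^ (2 * l i - 1) * 2 := by
      rw [← pow_succ]
      congr 1
      have := hl1 i
      omega
    rw [qsInvFact_eq, add_assoc X n k, h3]
    field_simp
  have e4 : ∏ t : Fin k, ∏ c ∈ Finset.Iio t,
      qs q (2 * (X + n : ℕ) + 2 + 2 * (t : ℕ) - (c + 1 : ℕ)) =
      ∏ t ∈ Finset.range k, ∏ j ∈ Finset.range t, qs q (2 * X + (2 * n + 2 + t + j) : ℕ) := by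
    rw [← Fin.prod_univ_eq_prod_range (fun t => ∏ j ∈ Finset.range t,
        qs q (2 * X + (2 * n + 2 + t + j) : ℕ))]
    refine Finset.prod_congr rfl fun t _ => ?_
    rw [prod_fin_Iio (fun c => qs q (2 * (X + n : ℕ) + 2 + 2 * (t : ℕ) - (c + 1 : ℕ))),
      ← Finset.prod_range_reflect]
    refine Finset.prod_congr rfl fun c hc => congrArg _ ?_
    rw [Finset.mem_range] at hc
    omega
  have h2n : (2 : K) ^ n ≠ 0 := pow_ne_zero _ h2
  have key : ∀ L B H A C P₁ P₂ W E : K, L / B * 2 ^ (n + k) * (H / A / 2 ^ n) * C *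
      (P₁ * P₂ * W / E) = C * 2 ^ k / B / A * (L * H * (P₁ * P₂ / E) * W) := by
    intro L B H A C P₁ P₂ W E
    rw [pow_add, mul_comm ((2 : K) ^ n)]
    have : L / B * (2 ^ k * 2 ^ n) * (H / A / 2 ^ n) =
        L / B * 2 ^ k * (H / A) * (2 ^ n / 2 ^ n) := by ring
    rw [this, div_self h2n]
    ring
  rw [e2, e4, eq_div_of_mul_eq h2n e1]
  exact key _ _ _ _ _ _ _ _ _

end SymmetricProduct

/-! ### The exponent of `q` -/

section Exponent

variable {K : Type*} [Field K] {q : K} {m n : ℕ}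

theorem prod_zpow_mul (hq : q ≠ 0) {ι : Type*} (s : Finset ι) (e : ι → ℤ) (f : ι → K) :
    ∏ i ∈ s, (q ^ e i * f i) = q ^ (∑ i ∈ s, e i) * ∏ i ∈ s, f i := by
  classical
  induction s using Finset.induction_on with
  | empty => simp
  | insert a s ha ih =>
    rw [Finset.prod_insert ha, Finset.prod_insert ha, Finset.sum_insert ha, ih, zpow_add₀ hq]
    ring

theorem zpow_mul_mul_zpow_mul (hq : q ≠ 0) (a b : ℤ) (x y : K) :
    (q ^ a * x) * (q ^ b * y) = q ^ (a + b) * (x * y) := by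
  rw [zpow_add₀ hq]
  ring

theorem zpow_mul_div_zpow_mul (hq : q ≠ 0) (a b : ℤ) (x y : K) :
    (q ^ a * x) / (q ^ b * y) = q ^ (a - b) * (x / y) := by
  rw [zpow_sub₀ hq]
  ring

theorem sum_Fin_Ioi_sub (a : Fin m → ℤ) :
    ∑ i : Fin m, ∑ j ∈ Finset.Ioi i, (a j - a i) = ∑ i : Fin m, (2 * (i : ℤ) + 1 - m) * a i := by
  simp only [Finset.sum_sub_distrib]
  have h1 : ∑ i : Fin m, ∑ j ∈ Finset.Ioi i, a j = ∑ j : Fin m, ∑ i ∈ Finset.Iio j, a j :=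
    Finset.sum_comm' (by simp)
  rw [h1, ← Finset.sum_sub_distrib]
  refine Finset.sum_congr rfl fun i _ => ?_
  have := i.2
  rw [Finset.sum_const, Finset.sum_const, Fin.card_Iio, Fin.card_Ioi, nsmul_eq_mul, nsmul_eq_mul,
    Nat.cast_sub (by omega), Nat.cast_sub (by omega)]
  push_cast
  ring

theorem sum_two_mul_sub_sub_one {l : Fin m → ℕ} (hl : StrictMono l) :
    ∑ i : Fin m, ∑ j ∈ Finset.Ioi i, (((2 * (l j - l i) : ℕ) : ℤ) - 1) =
      ∑ i : Fin m, (2 * (2 * (i : ℤ) + 1 - m) * l i - (m - 1 - i)) := by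
  have h := sum_Fin_Ioi_sub (fun i : Fin m => 2 * (l i : ℤ))
  rw [Finset.sum_sub_distrib]
  have h2 : ∑ i : Fin m, (2 * (2 * (i : ℤ) + 1 - m) * l i) =
      ∑ i : Fin m, (2 * (i : ℤ) + 1 - m) * (2 * l i) :=
    Finset.sum_congr rfl fun i _ => by ring
  rw [h2, ← h, ← Finset.sum_sub_distrib]
  refine Finset.sum_congr rfl fun i _ => ?_
  have h3 : ((m : ℤ) - 1 - i) = ∑ j ∈ Finset.Ioi i, (1 : ℤ) := by
    have := i.2
    rw [Finset.sum_const, Fin.card_Ioi, nsmul_eq_mul, Nat.cast_sub (by omega),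
      Nat.cast_sub (by omega)]
    push_cast
    ring
  rw [h3, ← Finset.sum_sub_distrib]
  refine Finset.sum_congr rfl fun j hj => ?_
  have := hl (Finset.mem_Ioi.1 hj)
  omega

theorem sum_Icc_one_sub_one (N : ℕ) :
    2 * ∑ a ∈ Finset.Icc 1 N, ((a : ℤ) - 1) = N * (N - 1) := by
  induction N with
  | zero => simp
  | succ N ih =>
    rw [Finset.sum_Icc_succ_top (by omega), mul_add, ih]
    push_cast
    ring

theorem two_mul_angle {b a : ℤ} (h : a ≤ b + 1) : 2 * angle b a = (b + 1 - a) * (a + b) := by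
  obtain ⟨N, hN⟩ := Int.eq_ofNat_of_zero_le (sub_nonneg.2 h)
  obtain rfl : b = a + N - 1 := by
    omega
  clear h hN
  unfold angle
  induction N with
  | zero => simp
  | succ N ih =>
    have h1 : Finset.Icc a (a + (N + 1 : ℕ) - 1) = insert (a + N) (Finset.Icc a (a + N - 1)) := by
      ext k
      simp only [Finset.mem_Icc, Finset.mem_insert]
      push_cast
      omega
    rw [h1, Finset.sum_insert (by simp), mul_add, ih]
    push_cast
    ring

theorem two_mul_fExp (t x y : ℤ) : 2 * fExp t x y = x * y * (2 * t + x - y) := by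
  unfold fExp
  refine Int.mul_ediv_cancel' ?_
  rcases Int.even_or_odd' x with ⟨a, rfl | rfl⟩
  · exact ⟨a * y * (2 * t + 2 * a - y), by ring⟩
  · rcases Int.even_or_odd' y with ⟨b, rfl | rfl⟩
    · exact ⟨(2 * a + 1) * b * (2 * t + (2 * a + 1) - 2 * b), by ring⟩
    · exact ⟨(2 * a + 1) * (2 * b + 1) * (t + a - b), by ring⟩

theorem parameterProd_qInt (hq : q ≠ 0) {l : Fin m → ℕ} {h : Fin n → ℕ} (hl : StrictMono l)
    (hl1 : ∀ i, 1 ≤ l i) (hh : StrictMono h) :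
    ∃ e : ℤ, parameterProd (qInt (q ^ 2)) l h = q ^ e * parameterProd (fun k => qs q k) l h ∧
      2 * e = ∑ i : Fin m, (2 * (2 * (2 * (i : ℤ) + 1 - m) * l i - (m - 1 - i)) - 4 * n * l i -
          (2 * l i - 1) * (2 * l i - 2)) +
        ∑ i : Fin n, (2 * (2 * (2 * (i : ℤ) + 1 - n) * h i - (n - 1 - i)) - 4 * m * h i -
          2 * h i * (2 * h i - 1)) + 2 * m * n := by
  refine ⟨_, by
    simp only [parameterProd, qs_natCast hq, prod_zpow_mul hq, zpow_mul_mul_zpow_mul hq,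
      zpow_mul_div_zpow_mul hq]
    rfl, ?_⟩
  rw [sum_two_mul_sub_sub_one hl, sum_two_mul_sub_sub_one hh]
  have h1 : ∑ i : Fin m, ∑ j : Fin n, (((2 * (l i + h j) : ℕ) : ℤ) - 1) =
      ∑ i : Fin m, 2 * n * (l i : ℤ) + ∑ j : Fin n, 2 * m * (h j : ℤ) - m * n := by
    push_cast
    simp only [mul_add, Finset.sum_sub_distrib, Finset.sum_add_distrib, Finset.sum_const,
      Finset.card_univ, Fintype.card_fin, nsmul_eq_mul, mul_one, ← Finset.mul_sum]
    ring
  have h2 : 2 * ∑ i : Fin m, ∑ a ∈ Finset.Icc 1 (2 * l i - 1), ((a : ℤ) - 1) =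
      ∑ i : Fin m, (2 * (l i : ℤ) - 1) * (2 * l i - 2) := by
    rw [Finset.mul_sum]
    refine Finset.sum_congr rfl fun i _ => ?_
    have := hl1 i
    rw [sum_Icc_one_sub_one, Nat.cast_sub (by omega)]
    push_cast
    ring
  have h3 : 2 * ∑ i : Fin n, ∑ a ∈ Finset.Icc 1 (2 * h i), ((a : ℤ) - 1) =
      ∑ i : Fin n, 2 * (h i : ℤ) * (2 * h i - 1) := by
    rw [Finset.mul_sum]
    refine Finset.sum_congr rfl fun i _ => ?_
    rw [sum_Icc_one_sub_one]
    push_cast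
    ring
  rw [h1, mul_sub, mul_add, mul_add, mul_add, h2, h3]
  simp only [Finset.sum_sub_distrib, ← Finset.mul_sum]
  ring

theorem singleProd_qInt (hq : q ≠ 0) (X m n : ℕ) {l : Fin m → ℕ}
    (hl : ∀ i : Fin m, i + 1 ≤ l i) (hlX : ∀ i, l i ≤ X + m) :
    singleProd (qInt (q ^ 2)) X m n l =
      q ^ (∑ i : Fin m, ((l i : ℤ) - (i + 1)) * (4 * X + 2 * m + 2 * n)) *
        singleProd (fun k => qs q k) X m n l := by
  simp only [singleProd, qs_natCast hq, prod_zpow_mul hq, zpow_mul_mul_zpow_mul hq]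
  congr 2
  refine Finset.sum_congr rfl fun i _ => ?_
  have h1 := hl i
  have h2 := hlX i
  rw [Finset.sum_congr rfl (g := fun _ => (4 * X + 2 * m + 2 * n : ℤ)), Finset.sum_const,
    Nat.card_Icc, nsmul_eq_mul]
  · congr 1
    omega
  · intro j hj
    rw [Finset.mem_Icc] at hj
    omega

theorem constantProd_qInt (hq : q ≠ 0) (X m n : ℕ) :
    ∃ e : ℤ, constantProd (qInt (q ^ 2)) X m n = q ^ e * constantProd (fun k => qs q k) X m n ∧
      2 * e = (m + n) * (m + n + 1) * (m + n + 2 * X) + 2 * n * (2 * X + m + n) := by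
  refine ⟨_, by
    simp only [constantProd_eq_range, qs_natCast hq, prod_zpow_mul hq, zpow_mul_mul_zpow_mul hq,
      zpow_mul_div_zpow_mul hq]
    rfl, ?_⟩
  have hrow : ∀ c N : ℕ, 2 * ∑ j ∈ Finset.range N, (((2 * X + (c + 2 + j) : ℕ) : ℤ) - 1) =
      N * (4 * X + 2 * c + N + 1) := fun c N => by
    induction N with
    | zero => simp
    | succ N ih =>
      rw [Finset.sum_range_succ, mul_add, ih]
      push_cast
      ring
  have h1 : ∀ m : ℕ, 2 * ∑ c ∈ Finset.range m, ∑ j ∈ Finset.range (c + 1),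
      (((2 * X + (c + 2 + j) : ℕ) : ℤ) - 1) = m * (m + 1) * (m + 2 * X) := fun m => by
    induction m with
    | zero => simp
    | succ m ih =>
      rw [Finset.sum_range_succ, mul_add, ih, hrow]
      push_cast
      ring
  have h2 : ∑ i ∈ Finset.range n, (((2 * X + 2 * (m + i + 1) : ℕ) : ℤ) - 1) =
      n * (2 * X + 2 * m + n) := by
    induction n with
    | zero => simp
    | succ n ih =>
      rw [Finset.sum_range_succ, ih]
      push_cast
      ring
  have h3 : 2 * ∑ i ∈ Finset.range n, ∑ j ∈ Finset.range (m + i + 1),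
      (((2 * X + (m + (i + 1) + (j + 1)) : ℕ) : ℤ) - 1) =
      (m + n) * (m + n + 1) * (m + n + 2 * X) - m * (m + 1) * (m + 2 * X) := by
    have h4 : ∀ i j, 2 * X + (m + (i + 1) + (j + 1)) = 2 * X + (m + i + 2 + j) := fun i j => by ring
    simp only [h4]
    clear h2
    induction n with
    | zero => simp
    | succ n ih =>
      rw [Finset.sum_range_succ, mul_add, ih, hrow]
      push_cast
      ring
  have h5 : ∑ i ∈ Finset.range m, ∑ j ∈ Finset.range n,
      ((((2 * X + 2 * (i + j + 1) : ℕ) : ℤ) - 1) -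
        (((2 * X + (2 * (i + j + 1) + 1) : ℕ) : ℤ) - 1)) = -(m * n) := by
    rw [Finset.sum_congr rfl (g := fun _ => -(n : ℤ))]
    · simp
    · intro i _
      rw [Finset.sum_congr rfl (g := fun _ => (-1 : ℤ))]
      · simp
      · intro j _
        push_cast
        ring
  rw [h2, h5, mul_add, mul_add, mul_add, h1, h3]
  ring

theorem sum_range_succ_sq_mul_six (n : ℕ) :
    (∑ i : Fin n, ((i : ℤ) + 1) ^ 2) * 6 = (n : ℤ) * (n + 1) * (2 * n + 1) := by
  rw [Fin.sum_univ_eq_sum_range (fun i : ℕ => ((i : ℤ) + 1) ^ 2)]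
  induction n with
  | zero => simp
  | succ n ih =>
    rw [Finset.sum_range_succ, add_mul, ih]
    push_cast
    ring

theorem two_mul_expE {x u d : ℕ} {l : Fin m → ℕ} {h : Fin n → ℕ} (hmd : m ≤ d) (hnu : n ≤ u)
    (hl : ∀ i : Fin m, i + 1 ≤ l i) (hh : ∀ i : Fin n, i + 1 ≤ h i) {X : ℕ}
    (hX : X = xBar x u d m n) :
    2 * expE x u d l h = n * (m + 1) * (4 * X + m + n + 1) +
      ∑ i : Fin m, (2 * (l i : ℤ) - (i + 1)) * (4 * X + 1 + 3 * (i + 1) - 2 * l i) +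
      ∑ i : Fin n, (2 * (h i : ℤ) - (i + 1)) * (4 * X - 1 + 3 * (i + 1) - 2 * h i) := by
  have h1 : (south x u d m n : ℤ) = X + m - d := by
    rw [hX]
    unfold south xBar
    omega
  have h2 : (north x u d m n : ℤ) = X + n - u := by
    rw [hX]
    unfold north xBar
    omega
  rw [expE]
  rw [mul_add, mul_add, two_mul_fExp, h1, h2, Finset.mul_sum, Finset.mul_sum]
  congr 1
  · congr 1
    · ring
    · refine Finset.sum_congr rfl fun i _ => ?_
      have := hl i
      rw [two_mul_angle (by omega)]
      ring
  · refine Finset.sum_congr rfl fun i _ => ?_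
    have := hh i
    rw [two_mul_angle (by omega)]
    ring

theorem symmetricProd_qInt (hq : q ≠ 0) {x u d : ℕ} {l : Fin m → ℕ} {h : Fin n → ℕ}
    (hmd : m ≤ d) (hnu : n ≤ u)
    (hl : StrictMono l) (hl1 : ∀ j, 1 ≤ l j) (hld : ∀ j, l j ≤ d)
    (hh : StrictMono h) (hh1 : ∀ j, 1 ≤ h j) (hhu : ∀ j, h j ≤ u) {X : ℕ}
    (hX : X = xBar x u d m n) :
    q ^ (-expE x u d l h) * (parameterProd (qInt (q ^ 2)) l h *
        constantProd (qInt (q ^ 2)) X m n * singleProd (qInt (q ^ 2)) X m n l *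
        singleProd (qInt (q ^ 2)) X n m h) =
      parameterProd (fun k => qs q k) l h * constantProd (fun k => qs q k) X m n *
        singleProd (fun k => qs q k) X m n l * singleProd (fun k => qs q k) X n m h := by
  have hXd : d ≤ X + m := by
    unfold xBar at hX
    omega
  have hXu : u ≤ X + n := by
    unfold xBar at hX
    omega
  obtain ⟨e₁, h1, h1'⟩ := parameterProd_qInt hq hl hl1 hh
  obtain ⟨e₂, h2, h2'⟩ := constantProd_qInt hq X m n
  rw [h1, h2, singleProd_qInt hq X m n (add_one_le_of_strictMono hl hl1)
    (fun i => (hld i).trans hXd), singleProd_qInt hq X n m (add_one_le_of_strictMono hh hh1)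
    (fun i => (hhu i).trans hXu), zpow_mul_mul_zpow_mul hq, zpow_mul_mul_zpow_mul hq,
    zpow_mul_mul_zpow_mul hq, ← mul_assoc, ← zpow_add₀ hq]
  have key : expE x u d l h = e₁ + e₂ +
      (∑ i : Fin m, ((l i : ℤ) - (i + 1)) * (4 * X + 2 * m + 2 * n)) +
      ∑ i : Fin n, ((h i : ℤ) - (i + 1)) * (4 * X + 2 * n + 2 * m) := by
    have h3 := two_mul_expE hmd hnu (add_one_le_of_strictMono hl hl1)
      (add_one_le_of_strictMono hh hh1) hX
    have s1 := sum_range_succ_mul_two m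
    have s2 := sum_range_succ_mul_two n
    have s3 := sum_range_succ_sq_mul_six m
    have s4 := sum_range_succ_sq_mul_six n
    have hA : ∑ i : Fin m, (2 * (2 * (2 * (i : ℤ) + 1 - m) * l i - (m - 1 - i)) - 4 * n * l i -
          (2 * l i - 1) * (2 * l i - 2)) +
        2 * (∑ i : Fin m, ((l i : ℤ) - (i + 1)) * (4 * X + 2 * m + 2 * n)) -
        ∑ i : Fin m, (2 * (l i : ℤ) - (i + 1)) * (4 * X + 1 + 3 * (i + 1) - 2 * l i) =
        m * (-2 * m - 2) + (∑ i : Fin m, ((i : ℤ) + 1)) * (3 - 4 * X - 4 * (n + m)) +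
          (∑ i : Fin m, ((i : ℤ) + 1) ^ 2) * 3 := by
      rw [Finset.mul_sum, ← Finset.sum_add_distrib, ← Finset.sum_sub_distrib, Finset.sum_mul,
        Finset.sum_mul]
      have : (m : ℤ) * (-2 * m - 2) = ∑ i : Fin m, (-2 * (m : ℤ) - 2) := by
        simp
        ring
      rw [this, ← Finset.sum_add_distrib, ← Finset.sum_add_distrib]
      refine Finset.sum_congr rfl fun i _ => ?_
      ring
    have hB : ∑ i : Fin n, (2 * (2 * (2 * (i : ℤ) + 1 - n) * h i - (n - 1 - i)) - 4 * m * h i -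
          2 * h i * (2 * h i - 1)) +
        2 * (∑ i : Fin n, ((h i : ℤ) - (i + 1)) * (4 * X + 2 * n + 2 * m)) -
        ∑ i : Fin n, (2 * (h i : ℤ) - (i + 1)) * (4 * X - 1 + 3 * (i + 1) - 2 * h i) =
        n * (-2 * n) + (∑ i : Fin n, ((i : ℤ) + 1)) * (1 - 4 * X - 4 * (n + m)) +
          (∑ i : Fin n, ((i : ℤ) + 1) ^ 2) * 3 := by
      rw [Finset.mul_sum, ← Finset.sum_add_distrib, ← Finset.sum_sub_distrib, Finset.sum_mul,
        Finset.sum_mul]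
      have : (n : ℤ) * (-2 * n) = ∑ i : Fin n, (-2 * (n : ℤ)) := by simp
      rw [this, ← Finset.sum_add_distrib, ← Finset.sum_add_distrib]
      refine Finset.sum_congr rfl fun i _ => ?_
      ring
    refine mul_left_cancel₀ (two_ne_zero (α := ℤ)) (mul_left_cancel₀ (two_ne_zero (α := ℤ)) ?_)
    linear_combination 2 * h3 - 2 * h1' - 2 * h2' - 2 * hA - 2 * hB -
      (3 - 4 * (X : ℤ) - 4 * (n + m)) * s1 - (1 - 4 * (X : ℤ) - 4 * (n + m)) * s2 - s3 - s4
  rw [key, neg_add_cancel, zpow_zero, one_mul]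

end Exponent

end HybridHexagon

theorem HybridHexagon.tilingGF_eq_gf {K : Type*} [Field K] (q : K)
    (R : Finset HybridHexagon.UnitTriangle) :
    HybridHexagon.tilingGF q R = HybridHexagon.gf (HybridHexagon.wtFun q) R := rfl

theorem mainTheorem1 {K : Type*} [Field K] (q : K)
    (hK : (2 : K) ≠ 0) (hq : q ≠ 0)
    (hqInt : ∀ k : ℕ, 1 ≤ k → HybridHexagon.qInt (q ^ 2) k ≠ 0)
    (x u d m n : ℕ) (hmd : m ≤ d) (hnu : n ≤ u)
    (l : Fin m → ℕ) (h : Fin n → ℕ)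
    (hl : StrictMono l) (hl1 : ∀ i, 1 ≤ l i) (hld : ∀ i, l i ≤ d)
    (hh : StrictMono h) (hh1 : ∀ j, 1 ≤ h j) (hhu : ∀ j, h j ≤ u) :
    HybridHexagon.tilingGF q (HybridHexagon.regionS x u d l h) =
      HybridHexagon.prodP q x u d l h := by
  have hqs : ∀ a : ℤ, a ≠ 0 → HybridHexagon.qs q a ≠ 0 := fun a ha =>
    HybridHexagon.qs_ne_zero hq hqInt ha
  rw [HybridHexagon.tilingGF_eq_gf, HybridHexagon.prodP_eq,
    HybridHexagon.symmetricProd_qInt hq hmd hnu hl hl1 hld hh hh1 hhu rfl]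
  rcases le_total m n with hmn | hnm
  · obtain ⟨k, rfl⟩ := Nat.exists_eq_add_of_le hmn
    exact HybridHexagon.gf_eq_upper hK hq hqs hmd hnu hl hl1 hld hh hh1 hhu rfl
  · obtain ⟨k, rfl⟩ := Nat.exists_eq_add_of_le hnm
    exact HybridHexagon.gf_eq_lower hK hq hqs hmd hnu hl hl1 hld hh hh1 hhu rfl
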